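/- **Setting.** Let $n,k,d$ be integers with $1\le k\le n$ and $2\le d\le n$, let $0<\sigma\le 1$, and let $a_1,\dots,a_n\in[0,1]^d$ be arbitrary. The data points are $x_i=a_i+g_i$, where $g_1,\dots,g_n$ are independent $d$-dimensional Gaussian vectors with mean $0$ and standard deviation $\sigma$ in each coordinate; $\mathcal X$ denotes the resulting point set. Put $D=\sqrt{90\,kd\ln n}$ and $\mathcal D=[-D/2,D/2]^d$. For a nonempty set $S$ of data points, $\mathrm{cm}(S)$ is its center of mass. **k-means.** Run k-means on $\mathcal X$ from any $k$ pairwise distinct initial centers: assign every point to a closest center (ties are broken arbitrarily), remove clusters without points, replace each center by the center of mass of its cluster, and repeat. "Iteration" means an iteration after the first one; it leads from a clustering $C$, whose centers are its centers of mass, to a clustering $C'$. The potential of a clustering is $\Psi=\sum_{x}\|x-\mathrm{cm}(\text{cluster of }x)\|^2$, and the improvement made by the iteration is $\Psi(C)-\Psi(C')$. Iterations in which a cluster loses all its points are disregarded. **Blueprints.** The transition graph of an iteration is the directed multigraph with one node for each cluster and, for each data point $x$ switching from a cluster $\mathcal C_i$ to another cluster $\mathcal C_j$, an edge $(\mathcal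 C_i,\mathcal C_j)$ labeled $x$. The degree of a node is its in-degree plus its out-degree; a node is balanced if its in-degree equals its out-degree. For $\varepsilon>0$ let $L_\varepsilon$ be the set of points of $\mathcal D$ all of whose coordinates are integer multiples of $\sqrt{n\varepsilon/d}$, and let $L_0=\mathcal D$. An $(m,b,\varepsilon)$ transition blueprint consists of a weakly connected transition graph $G$ with $m$ edges and $b$ balanced nodes and of one point of $L_\varepsilon$ for each balanced node. An iteration follows the blueprint if $G$ is a connected component of its transition graph and the center, at the beginning of the iteration, of each balanced cluster of $G$ has distance at most $\sqrt{n\varepsilon}$ from the chosen lattice point. The approximate center of a balanced cluster is its lattice point; that of an unbalanced cluster that gains the set $A$ and loses the set $B$ of points (according to $G$) is $$\frac{|B|\,\mathrm{cm}(B)-|A|\,\mathrm{cm}(A)}{|B|-|A|}$$ (where $|S|\,\mathrm{cm}(S)=\sum_{x\in S}x$, which is $0$ for $S=\emptyset$). The blueprint is non-degenerate if the two end nodes of every edge of $G$ have distinct approximate centers. **Lemma.** There is an absolute constant $c>0$ such that, for all $n,k,d,\sigma,a_1,\dots,a_n$ as above, the following holds. Fix $\varepsilon\in[0,1]$ and let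 $\Delta_6$ be the smallest improvement made by any iteration, in any run of k-means on $\mathcal X$, that follows, for some $m$ and $b$, an $(m,b,\varepsilon)$ transition blueprint which * is non-degenerate, * has only balanced nodes of in- and out-degree at least $8d+1$ (unbalanced nodes are not restricted by this), * has no node of degree one, * has at most two disjoint pairs of adjacent unbalanced nodes of degree two, and * has a node of degree at least $8$ ($\Delta_6=\infty$ if there is no such iteration). Then $$\Pr\bigl[\mathcal X\subseteq\mathcal D\ \text{ and }\ \Delta_6\le\varepsilon\bigr]\;\le\;\varepsilon\cdot\frac{c\,n^{33}k^{30}d^3D^3}{\sigma^6}.$$ -/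

import Mathlib

open MeasureTheory ProbabilityTheory

namespace KMeans

/-- The ambient Euclidean space `ℝ^d`. -/
abbrev Pt (d : ℕ) := EuclideanSpace ℝ (Fin d)

/-! ### The k-means method

The data points are a family `X : Fin n → Pt d`. A clustering is an assignment `C : Fin n → Fin k` of
the (indices of the) data points to cluster names. A cluster name to which no point is assigned
stands for a cluster that has been removed. -/

/-- The center of mass of the data points with index in `S`. -/
noncomputable def mass {n d : ℕ} (X : Fin n → Pt d) (S : Finset (Fin n)) : Pt d :=
  (S.card : ℝ)⁻¹ • ∑ x ∈ S, X x

/-- The data points in cluster `i` of the clustering `C`. -/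
def cluster {n k : ℕ} (C : Fin n → Fin k) (i : Fin k) : Finset (Fin n) :=
  Finset.univ.filter fun x => C x = i

/-- The clusters of `C` that have not been removed, i.e. those that serve at least one point. -/
def active {n k : ℕ} (C : Fin n → Fin k) : Finset (Fin k) :=
  Finset.univ.image C

/-- The centers of the clusters of `C` (meaningful for active clusters). -/
noncomputable def centers {n k d : ℕ} (X : Fin n → Pt d) (C : Fin n → Fin k) (i : Fin k) : Pt d :=
  mass X (cluster C i)

/-- `C` assigns every data point to one of the clusters in `act` whose center is closest to it.
Ties are broken arbitrarily. -/
def AssignsClosest {n k d : ℕ} (X : Fin n → Pt d) (c : Fin k → Pt d) (act : Finset (Fin k))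
    (C : Fin n → Fin k) : Prop :=
  ∀ x, C x ∈ act ∧ ∀ j ∈ act, ‖X x - c (C x)‖ ≤ ‖X x - c j‖

/-- One iteration of k-means (after the first one) leads from the clustering `C`, whose centers are
its centers of mass, to the clustering `C'`. -/
def IsIteration {n k d : ℕ} (X : Fin n → Pt d) (C C' : Fin n → Fin k) : Prop :=
  AssignsClosest X (centers X C) (active C) C'

/-- The clusterings that occur in some run of k-means on `X`, started from some choice of `k`
distinct initial centers. -/
inductive Occurs {n k d : ℕ} (X : Fin n → Pt d) : (Fin n → Fin k) → Prop
  | first (c : Fin k → Pt d) (hc : Function.Injective c) (C : Fin n → Fin k)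
      (h : AssignsClosest X c Finset.univ C) : Occurs X C
  | next (C C' : Fin n → Fin k) (hC : Occurs X C) (h : IsIteration X C C') : Occurs X C'

/-- The potential `Ψ` for cluster centers `c` and the clustering `C`. -/
noncomputable def potential {n k d : ℕ} (X : Fin n → Pt d) (c : Fin k → Pt d) (C : Fin n → Fin k) :
    ℝ :=
  ∑ x, ‖X x - c (C x)‖ ^ 2

/-- The improvement of the potential made by the iteration from `C` to `C'`. -/
noncomputable def improvement {n k d : ℕ} (X : Fin n → Pt d) (C C' : Fin n → Fin k) : ℝ :=
  potential X (centers X C) C - potential X (centers X C') C'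

/-! ### Transition graphs -/

/-- A directed multigraph whose vertices are clusters and whose edges are labeled by data points:
the triple `(x, i, j)` is an edge from cluster `i` to cluster `j` with label `x`. As a data point
switches at most once in an iteration, and to another cluster, labels are distinct and there are no
loops. -/
structure TransitionGraph (n k : ℕ) where
  verts : Finset (Fin k)
  edges : Finset (Fin n × Fin k × Fin k)
  src_mem : ∀ e ∈ edges, e.2.1 ∈ verts
  tgt_mem : ∀ e ∈ edges, e.2.2 ∈ verts
  src_ne_tgt : ∀ e ∈ edges, e.2.1 ≠ e.2.2
  label_inj : ∀ e ∈ edges, ∀ f ∈ edges, e.1 = f.1 → e = f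

namespace TransitionGraph

/-- The edges into `i`. -/
def inEdges {n k : ℕ} (G : TransitionGraph n k) (i : Fin k) : Finset (Fin n × Fin k × Fin k) :=
  G.edges.filter fun e => e.2.2 = i

/-- The edges out of `i`. -/
def outEdges {n k : ℕ} (G : TransitionGraph n k) (i : Fin k) : Finset (Fin n × Fin k × Fin k) :=
  G.edges.filter fun e => e.2.1 = i

def inDegree {n k : ℕ} (G : TransitionGraph n k) (i : Fin k) : ℕ := (G.inEdges i).card

def outDegree {n k : ℕ} (G : TransitionGraph n k) (i : Fin k) : ℕ := (G.outEdges i).card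

def degree {n k : ℕ} (G : TransitionGraph n k) (i : Fin k) : ℕ := G.inDegree i + G.outDegree i

/-- The balanced clusters: those with in-degree equal to out-degree. -/
def balanced {n k : ℕ} (G : TransitionGraph n k) : Finset (Fin k) :=
  G.verts.filter fun i => G.inDegree i = G.outDegree i

/-- The data points gained by cluster `i`. -/
def gained {n k : ℕ} (G : TransitionGraph n k) (i : Fin k) : Finset (Fin n) :=
  (G.inEdges i).image Prod.fst

/-- The data points lost by cluster `i`. -/
def lost {n k : ℕ} (G : TransitionGraph n k) (i : Fin k) : Finset (Fin n) :=
  (G.outEdges i).image Prod.fst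

/-- `i` and `j` are joined by an edge, in either direction. -/
def Adj {n k : ℕ} (G : TransitionGraph n k) (i j : Fin k) : Prop :=
  ∃ x, (x, i, j) ∈ G.edges ∨ (x, j, i) ∈ G.edges

def WeaklyConnected {n k : ℕ} (G : TransitionGraph n k) : Prop :=
  G.verts.Nonempty ∧ ∀ i ∈ G.verts, ∀ j ∈ G.verts, Relation.ReflTransGen G.Adj i j

/-- `G` is a (weakly) connected component of `H`. -/
def IsComponent {n k : ℕ} (G H : TransitionGraph n k) : Prop :=
  G.WeaklyConnected ∧ G.verts ⊆ H.verts ∧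
    G.edges = H.edges.filter fun e => e.2.1 ∈ G.verts ∨ e.2.2 ∈ G.verts

/-- `G` has at least `s` disjoint pairs of adjacent unbalanced nodes of degree two: the `t`-th pair
consists of the nodes `f (t, 0)` and `f (t, 1)`. -/
def HasDisjointPairs {n k : ℕ} (G : TransitionGraph n k) (s : ℕ) : Prop :=
  ∃ f : Fin s × Fin 2 → Fin k, Function.Injective f ∧
    (∀ p, f p ∈ G.verts ∧ f p ∉ G.balanced ∧ G.degree (f p) = 2) ∧
    ∀ t, G.Adj (f (t, 0)) (f (t, 1))

/-- The transition graph of the iteration from `C` to `C'`: one vertex for each cluster, and one edge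
for each data point that switches clusters. The set of vertices is the set of all clusters that are
present in the iteration. -/
def ofIteration {n k : ℕ} (C C' : Fin n → Fin k) (h : ∀ x, C' x ∈ active C) :
    TransitionGraph n k where
  verts := active C
  edges := (Finset.univ.filter fun x => C x ≠ C' x).image fun x => (x, C x, C' x)
  src_mem := by
    intro e he
    obtain ⟨x, -, rfl⟩ := Finset.mem_image.1 he
    exact Finset.mem_image_of_mem C (Finset.mem_univ x)
  tgt_mem := by
    intro e he
    obtain ⟨x, -, rfl⟩ := Finset.mem_image.1 he
    exact h x
  src_ne_tgt := by
    intro e he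
    obtain ⟨x, hx, rfl⟩ := Finset.mem_image.1 he
    exact (Finset.mem_filter.1 hx).2
  label_inj := by
    intro e he f hf hef
    obtain ⟨x, -, rfl⟩ := Finset.mem_image.1 he
    obtain ⟨y, -, rfl⟩ := Finset.mem_image.1 hf
    obtain rfl : x = y := hef
    rfl

end TransitionGraph

/-! ### Transition blueprints -/

/-- The side length `D = √(90 k d ln n)` of the hypercube. -/
noncomputable def sideLength (n k d : ℕ) : ℝ := √(90 * k * d * Real.log n)

/-- The hypercube `[-D/2, D/2]^d`. -/
def cube (n k d : ℕ) : Set (Pt d) := {p | ∀ j, |p j| ≤ sideLength n k d / 2}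

/-- The lattice with spacing `√(nε/d)` that tiles the hypercube. In the limit case `ε = 0` of spacing
zero, it consists of all points of the hypercube. -/
def lattice (n k d : ℕ) (ε : ℝ) : Set (Pt d) :=
  {p | p ∈ cube n k d ∧ (ε = 0 ∨ ∀ j, ∃ z : ℤ, p j = z * √(n * ε / d))}

/-- An `(m, b, ε)` transition blueprint: a weakly connected transition graph with `m` edges and `b`
balanced clusters, and a lattice point for each balanced cluster. -/
structure Blueprint (n k d m b : ℕ) (ε : ℝ) where
  graph : TransitionGraph n k
  connected : graph.WeaklyConnected
  card_edges : graph.edges.card = m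
  card_balanced : graph.balanced.card = b
  latticePt : {i // i ∈ graph.balanced} → Pt d
  latticePt_mem : ∀ i, latticePt i ∈ lattice n k d ε

namespace Blueprint

/-- The iteration from `C` to `C'` follows the blueprint `B`. -/
def IsFollowedBy {n k d m b : ℕ} {ε : ℝ} (B : Blueprint n k d m b ε) (X : Fin n → Pt d)
    (C C' : Fin n → Fin k) : Prop :=
  (∃ h : ∀ x, C' x ∈ active C, B.graph.IsComponent (TransitionGraph.ofIteration C C' h)) ∧
    ∀ i, ‖B.latticePt i - centers X C i‖ ≤ √(n * ε)

/-- The approximate center of a cluster of the blueprint: the lattice point if it is balanced, and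
`(|B| cm(B) - |A| cm(A)) / (|B| - |A|)` if it is unbalanced, gains `A` and loses `B`. -/
noncomputable def approxCenter {n k d m b : ℕ} {ε : ℝ} (B : Blueprint n k d m b ε)
    (X : Fin n → Pt d) (i : Fin k) : Pt d :=
  if h : i ∈ B.graph.balanced then B.latticePt ⟨i, h⟩
  else
    (((B.graph.lost i).card : ℝ) - ((B.graph.gained i).card : ℝ))⁻¹ •
      (((B.graph.lost i).card : ℝ) • mass X (B.graph.lost i) -
        ((B.graph.gained i).card : ℝ) • mass X (B.graph.gained i))

/-- The approximate bisector is well defined for every data point that switches clusters. -/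
def NonDegenerate {n k d m b : ℕ} {ε : ℝ} (B : Blueprint n k d m b ε) (X : Fin n → Pt d) : Prop :=
  ∀ e ∈ B.graph.edges, B.approxCenter X e.2.1 ≠ B.approxCenter X e.2.2

/-- The blueprints of the general case. -/
structure IsGeneral {n k d m b : ℕ} {ε : ℝ} (B : Blueprint n k d m b ε) (X : Fin n → Pt d) :
    Prop where
  nonDegenerate : B.NonDegenerate X
  balanced_degree : ∀ i ∈ B.graph.balanced,
    8 * d + 1 ≤ B.graph.inDegree i ∧ 8 * d + 1 ≤ B.graph.outDegree i
  degree_ne_one : ∀ i ∈ B.graph.verts, B.graph.degree i ≠ 1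
  pairs_le_two : ¬ B.graph.HasDisjointPairs 3
  exists_large_degree : ∃ i ∈ B.graph.verts, 8 ≤ B.graph.degree i

end Blueprint

/-- `Δ₆`: the smallest improvement made by any iteration (after the first one) of k-means on `X` in
which no cluster loses all its points and which follows a blueprint of the general case. It is `⊤` if
there is no such iteration. As there are only finitely many clusterings, it is attained otherwise. -/
noncomputable def delta6 {n d : ℕ} (k : ℕ) (X : Fin n → Pt d) (ε : ℝ) : EReal :=
  sInf {δ | ∃ C C' : Fin n → Fin k, Occurs X C ∧ IsIteration X C C' ∧ active C ⊆ active C' ∧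
    (∃ (m b : ℕ) (B : Blueprint n k d m b ε), B.IsFollowedBy X C C' ∧ B.IsGeneral X) ∧
    δ = (improvement X C C' : EReal)}

/-- The law of the perturbed data points: independently for every `i`, a Gaussian random vector with
mean `0` and standard deviation `σ` is added to the point `a i`. -/
noncomputable def perturbedLaw {n d : ℕ} (a : Fin n → Pt d) (σ : ℝ) : Measure (Fin n → Pt d) :=
  Measure.pi fun i => (stdGaussian (Pt d)).map fun z => a i + σ • z

end KMeans

/-! Put r = √ε and N = n k², the number of possible labeled edges. If an iteration improves the
potential by at most ε, every switching point gains at most ε, so it lies in a thin slab around the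
bisector of the two centers involved, and every center hardly moves. The latter says that excess ·
center is close to (sum of lost points) − (sum of gained points) for every cluster. Hence the
switching points determine the center of an unbalanced cluster up to √(nε), whereas for a balanced
cluster the lost and gained sums almost agree; its center is approximated by a point of a finite
grid of spacing r. These consequences form `IsTight`, and the probability of tightness is what gets
bounded.

A configuration is treated as a vector-valued function on the edges, with `bdry` as its boundary at
a node. Approximate centers depend only on boundaries at unbalanced nodes, and shifts along a cycle
of the graph change no boundary. Since the Gaussian component along one direction can be averaged on
its own (`lintegral_mul_le_of_direction`), each of the m − |V| + 1 fundamental cycles contributes a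
slab probability of order r / ‖gap‖, where gap is the difference of the approximate centers. Outside
of unlikely events, every gap is at least half of `sepDist`, a large multiple of r, and even √r / 2
next to a balanced cluster (`exists_isTight`). So each slab factor is at most N⁻⁸, and the degree
conditions (`exists_counts`) provide enough cycles for these factors to outweigh the number of
graphs.

The factor ε = r² comes from a few reserved slab factors. Between two unbalanced clusters the gap
itself has a Gaussian component in dimension at least 2, so the mean of (r / ‖gap‖)³ over gaps of
size at least of order r has order r³ / r (`lintegral_inv_norm_cube_le`). Next to a balanced cluster
four factors of order √r suffice. A grid coordinate costs a factor of order 1 / r, which is repaid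
by the small boundary of the balanced cluster. If all clusters are balanced, the switching points
are free individually, and there are at least eight edges per grid coordinate. Summing N^(−|E|) over
all edge sets E gives at most e. -/

namespace KMeans

open scoped ENNReal NNReal

/-! ### Averaging a Gaussian configuration along one direction. -/

/-- The configuration that moves every point `x` by `v x • y`. -/
def shift {n d : ℕ} (v : Fin n → ℝ) (y : Pt d) : Fin n → Pt d := fun x => v x • y

/-- The linear map that replaces the component of a configuration along the direction `v` by a
prescribed vector. -/
noncomputable def resample {n : ℕ} (d : ℕ) (v : Fin n → ℝ) :
    ((Fin n → Pt d) × Pt d) →L[ℝ] (Fin n → Pt d) :=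
  ContinuousLinearMap.pi fun i =>
    (ContinuousLinearMap.proj i).comp (ContinuousLinearMap.fst ℝ (Fin n → Pt d) (Pt d)) -
      v i • ∑ j, v j •
        (ContinuousLinearMap.proj j).comp (ContinuousLinearMap.fst ℝ (Fin n → Pt d) (Pt d)) +
      v i • ContinuousLinearMap.snd ℝ (Fin n → Pt d) (Pt d)

theorem resample_apply {n d : ℕ} (v : Fin n → ℝ) (z : Fin n → Pt d) (y : Pt d) :
    resample d v (z, y) = z + shift v (-∑ j, v j • z j) + shift v y := by
  ext i l
  simp [resample, shift, sub_eq_add_neg]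

/-- By rotation invariance the component along the unit vector `v` is independent of the rest, so it
may be replaced by a fresh Gaussian. For characteristic functions this is Pythagoras: the dual
vector `w` splits into the part `w i - v i • s` orthogonal to `v` and the part `s` along it. -/
theorem map_resample {n d : ℕ} (v : Fin n → ℝ) (hv : ∑ i, v i ^ 2 = 1) :
    ((Measure.pi fun _ : Fin n => stdGaussian (Pt d)).prod (stdGaussian (Pt d))).map
      (resample d v) = Measure.pi fun _ : Fin n => stdGaussian (Pt d) := by
  apply Measure.ext_of_charFunDual
  ext L
  have hw : ∀ i, ∃ w : Pt d, L ∘SL ContinuousLinearMap.single ℝ (fun _ => Pt d) i =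
      InnerProductSpace.toDual ℝ (Pt d) w := fun i =>
    ⟨(InnerProductSpace.toDual ℝ (Pt d)).symm _,
      (LinearIsometryEquiv.apply_symm_apply _ _).symm⟩
  choose w hw using hw
  have hL : ∀ z : Fin n → Pt d, L z = ∑ i, inner ℝ (w i) (z i) := by
    intro z
    rw [← ContinuousLinearMap.sum_comp_single _ _ L z]
    refine Finset.sum_congr rfl fun i _ => ?_
    have := congrArg (fun f => f (z i)) (hw i)
    simpa [InnerProductSpace.toDual_apply_apply] using this
  set s : Pt d := ∑ j, v j • w j with hs
  rw [charFunDual_map, charFunDual_prod, charFunDual_pi, charFunDual_pi]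
  have h1 : ∀ i, ((L ∘SL resample d v) ∘SL ContinuousLinearMap.inl ℝ (Fin n → Pt d) (Pt d)) ∘SL
      ContinuousLinearMap.single ℝ (fun _ => Pt d) i =
      InnerProductSpace.toDual ℝ (Pt d) (w i - v i • s) := by
    intro i
    ext y
    have h0 : ∑ j, v j • (Pi.single i y : Fin n → Pt d) j = v i • y := by
      rw [Finset.sum_eq_single i] <;> simp +contextual
    have h2 : ∑ j, inner ℝ (w j) ((Pi.single i y : Fin n → Pt d) j) = inner ℝ (w i) y := by
      rw [Finset.sum_eq_single i] <;> simp +contextual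
    simp only [ContinuousLinearMap.comp_apply, ContinuousLinearMap.inl_apply,
      ContinuousLinearMap.single_apply, resample_apply, map_add, h0]
    rw [hL, hL, hL, h2]
    simp [shift, InnerProductSpace.toDual_apply_apply, inner_smul_right, hs, Finset.mul_sum,
      Finset.sum_neg_distrib, sub_eq_add_neg]
    refine Finset.sum_congr rfl fun j _ => ?_
    ring
  have h3 : (L ∘SL resample d v) ∘SL ContinuousLinearMap.inr ℝ (Fin n → Pt d) (Pt d) =
      InnerProductSpace.toDual ℝ (Pt d) s := by
    ext y
    simp only [ContinuousLinearMap.comp_apply, ContinuousLinearMap.inr_apply, resample_apply,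
      hL]
    simp [shift, InnerProductSpace.toDual_apply_apply, inner_smul_right, hs]
  simp_rw [h1, h3, hw, charFunDual_stdGaussian, LinearIsometryEquiv.norm_map]
  rw [← Complex.exp_sum, ← Complex.exp_sum, ← Complex.exp_add]
  congr 1
  have h4 : ∑ i, ‖w i - v i • s‖ ^ 2 + ‖s‖ ^ 2 = ∑ i, ‖w i‖ ^ 2 := by
    have h5 : ∀ i, ‖w i - v i • s‖ ^ 2 =
        ‖w i‖ ^ 2 - 2 * (v i * inner ℝ (w i) s) + v i ^ 2 * ‖s‖ ^ 2 := by
      intro i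
      rw [norm_sub_sq_real, inner_smul_right, norm_smul, mul_pow, Real.norm_eq_abs, sq_abs]
    have h6 : ∑ i, v i * inner ℝ (w i) s = ‖s‖ ^ 2 := by
      rw [← real_inner_self_eq_norm_sq, hs, sum_inner, ← hs]
      simp [inner_smul_left]
    simp_rw [h5, Finset.sum_add_distrib, Finset.sum_sub_distrib, ← Finset.mul_sum, h6,
      ← Finset.sum_mul, hv]
    ring
  rw [← Finset.sum_div, ← Finset.sum_div, ← add_div, Finset.sum_neg_distrib,
    Finset.sum_neg_distrib, ← neg_add]
  congr 2
  exact_mod_cast h4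

instance {n d : ℕ} (a : Fin n → Pt d) (σ : ℝ) : IsProbabilityMeasure (perturbedLaw a σ) := by
  unfold perturbedLaw
  have : ∀ i, IsProbabilityMeasure ((stdGaussian (Pt d)).map fun z => a i + σ • z) := fun i =>
    Measure.isProbabilityMeasure_map (by fun_prop)
  infer_instance

theorem perturbedLaw_eq_map {n d : ℕ} (a : Fin n → Pt d) (σ : ℝ) :
    perturbedLaw a σ =
      (Measure.pi fun _ : Fin n => stdGaussian (Pt d)).map fun z => a + σ • z := by
  have : ∀ i, IsProbabilityMeasure ((stdGaussian (Pt d)).map fun z => a i + σ • z) := fun i =>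
    Measure.isProbabilityMeasure_map (by fun_prop)
  unfold perturbedLaw
  rw [← Measure.pi_map_pi fun i => by fun_prop]
  rfl

theorem measurable_shift {n d : ℕ} (v : Fin n → ℝ) : Measurable (shift v : Pt d → Fin n → Pt d) := by
  unfold shift
  fun_prop

/-- The Euclidean length of a direction. -/
noncomputable def len {n : ℕ} (v : Fin n → ℝ) : ℝ := √(∑ i, v i ^ 2)

theorem len_sq {n : ℕ} (v : Fin n → ℝ) : len v ^ 2 = ∑ i, v i ^ 2 :=
  Real.sq_sqrt (Finset.sum_nonneg fun _ _ => sq_nonneg _)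

theorem len_pos {n : ℕ} {v : Fin n → ℝ} (hv : v ≠ 0) : 0 < len v := by
  obtain ⟨i, hi⟩ := Function.ne_iff.1 hv
  exact Real.sqrt_pos.2
    (Finset.sum_pos' (fun i _ => sq_nonneg _) ⟨i, Finset.mem_univ _, by simpa using sq_pos_of_ne_zero hi⟩)

/-- A bound for the Gaussian average along one direction can be used under the expectation, next to
a factor that does not change along this direction. -/
theorem lintegral_mul_le_of_direction {n d : ℕ} (a : Fin n → Pt d) (σ : ℝ) {v : Fin n → ℝ}
    (hv : v ≠ 0) {f g h : (Fin n → Pt d) → ℝ≥0∞}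
    (hf : Measurable f) (hg : Measurable g) (hh : Measurable h)
    (hfv : ∀ X y, f (X + shift v y) = f X) (hhv : ∀ X y, h (X + shift v y) = h X)
    (hgh : ∀ X, ∫⁻ y, g (X + shift v ((σ / len v) • y)) ∂stdGaussian (Pt d) ≤ h X) :
    ∫⁻ X, f X * g X ∂perturbedLaw a σ ≤ ∫⁻ X, f X * h X ∂perturbedLaw a σ := by
  have hN := len_pos hv
  set u : Fin n → ℝ := fun i => v i / len v with hu
  have hu1 : ∑ i, u i ^ 2 = 1 := by
    simp_rw [hu, div_pow, ← Finset.sum_div, ← len_sq]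
    exact div_self (by positivity)
  have hushift : ∀ y : Pt d, σ • shift u y = shift v ((σ / len v) • y) := by
    intro y
    ext i l
    simp [shift, hu]
    ring
  have hmeas : Measurable fun z : Fin n → Pt d => a + σ • z := by fun_prop
  set w : (Fin n → Pt d) → Pt d := fun z => (σ / len v) • (-∑ j, u j • z j) with hw
  -- The shift by `w z` removes the old component along `v`. It is harmless, since `f` and `h` do
  -- not see it and the bound for `g` holds from every base point.
  have key : ∀ (z : Fin n → Pt d) (y : Pt d), a + σ • (resample d u (z, y)) =
      a + σ • z + shift v (w z) + shift v ((σ / len v) • y) := by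
    intro z y
    rw [resample_apply, smul_add, smul_add, hushift, hushift]
    abel
  have expand : ∀ F : (Fin n → Pt d) → ℝ≥0∞, Measurable F → ∫⁻ X, F X ∂perturbedLaw a σ =
      ∫⁻ z, ∫⁻ y, F (a + σ • resample d u (z, y)) ∂stdGaussian (Pt d)
        ∂(Measure.pi fun _ : Fin n => stdGaussian (Pt d)) := by
    intro F hF
    have h1 : Measurable fun z : Fin n → Pt d => F (a + σ • z) := hF.comp hmeas
    rw [perturbedLaw_eq_map, lintegral_map hF hmeas]
    conv_lhs => rw [← map_resample u hu1]
    rw [lintegral_map h1 (by fun_prop)]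
    exact lintegral_prod _ (h1.comp (resample d u).continuous.measurable).aemeasurable
  rw [expand (fun X => f X * g X) (hf.mul hg), expand (fun X => f X * h X) (hf.mul hh)]
  refine lintegral_mono fun z => ?_
  simp_rw [key, hfv, hhv]
  rw [lintegral_const_mul, lintegral_const, measure_univ, mul_one]
  · gcongr
    exact (hgh _).trans_eq (hhv _ _)
  · exact hg.comp (measurable_const.add ((measurable_shift v).comp (by fun_prop)))

/-- The iterated form of `lintegral_mul_le_of_direction`. -/
theorem lintegral_mul_prod_le {n d : ℕ} (a : Fin n → Pt d) (σ : ℝ) {ι : Type*} [DecidableEq ι]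
    (R : Finset ι) (v : ι → Fin n → ℝ) (s w : ι → (Fin n → Pt d) → ℝ≥0∞)
    (hv : ∀ e ∈ R, v e ≠ 0)
    (hs : ∀ e ∈ R, Measurable (s e)) (hw : ∀ e ∈ R, Measurable (w e))
    (hsv : ∀ e ∈ R, ∀ e' ∈ R, e ≠ e' → ∀ X y, s e (X + shift (v e') y) = s e X)
    (hwv : ∀ e ∈ R, ∀ e' ∈ R, ∀ X y, w e (X + shift (v e') y) = w e X)
    (hsw : ∀ e ∈ R, ∀ X,
      ∫⁻ y, s e (X + shift (v e) ((σ / len (v e)) • y)) ∂stdGaussian (Pt d) ≤ w e X)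
    {f : (Fin n → Pt d) → ℝ≥0∞} (hf : Measurable f)
    (hfv : ∀ e ∈ R, ∀ X y, f (X + shift (v e) y) = f X) :
    ∫⁻ X, f X * ∏ e ∈ R, s e X ∂perturbedLaw a σ ≤
      ∫⁻ X, f X * ∏ e ∈ R, w e X ∂perturbedLaw a σ := by
  induction R using Finset.induction_on generalizing f with
  | empty => simp
  | insert e R he ih =>
    simp only [Finset.forall_mem_insert] at *
    have hne : ∀ e' ∈ R, e' ≠ e := fun e' h h' => he (h' ▸ h)
    simp_rw [Finset.prod_insert he]
    have h1 := lintegral_mul_le_of_direction a σ hv.1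
      (f := fun X => f X * ∏ e' ∈ R, s e' X) (g := s e) (h := w e)
      (hf.mul (Finset.measurable_fun_prod _ hs.2)) hs.1 hw.1 (fun X y => by
        simp only [hfv.1]
        congr 1
        exact Finset.prod_congr rfl fun e' h => (hsv.2 e' h).1 (hne e' h) X y) hwv.1.1 hsw.1
    -- Once `s e` has been replaced by `w e`, the latter is constant along all remaining directions
    -- and can join the factor `f`.
    have h2 := ih hv.2 hs.2 hw.2 (fun e' h => (hsv.2 e' h).2) (fun e' h => (hwv.2 e' h).2) hsw.2
      (f := fun X => f X * w e X) (hf.mul hw.1) (fun e' h X y => by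
        simp only [hfv.2 e' h, hwv.1.2 e' h])
    calc _ = ∫⁻ X, f X * (∏ e' ∈ R, s e' X) * s e X ∂perturbedLaw a σ := by
          congr 1; ext X; ring
      _ ≤ _ := h1
      _ = ∫⁻ X, f X * w e X * (∏ e' ∈ R, s e' X) ∂perturbedLaw a σ := by
          congr 1; ext X; ring
      _ ≤ _ := h2
      _ = _ := by congr 1; ext X; ring

/-! ### Gaussian estimates: slabs, balls and an inverse moment. -/

theorem gaussianReal_Icc_le (m : ℝ) {v : ℝ≥0} (hv : v ≠ 0) (a b : ℝ) :
    gaussianReal m v (Set.Icc a b) ≤ ENNReal.ofReal ((b - a) / (2 * √v)) := by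
  have hv' : 0 < √(v : ℝ) := Real.sqrt_pos.2 (by positivity)
  have hpdf : ∀ x, gaussianPDF m v x ≤ ENNReal.ofReal (1 / (2 * √v)) := by
    intro x
    refine ENNReal.ofReal_le_ofReal ?_
    rw [gaussianPDFReal]
    have h1 : Real.exp (-(x - m) ^ 2 / (2 * v)) ≤ 1 := by
      rw [Real.exp_le_one_iff]
      exact div_nonpos_of_nonpos_of_nonneg (neg_nonpos.2 (sq_nonneg _)) (by positivity)
    have h2 : 2 * √(v : ℝ) ≤ √(2 * Real.pi * v) := by
      rw [Real.sqrt_mul (by positivity)]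
      gcongr
      rw [Real.le_sqrt (by norm_num) (by positivity)]
      nlinarith [Real.pi_gt_three]
    calc _ ≤ (√(2 * Real.pi * v))⁻¹ * 1 := by gcongr
      _ ≤ _ := by
        rw [mul_one, one_div]
        gcongr
  rw [gaussianReal_apply m hv]
  calc _ ≤ ∫⁻ _ in Set.Icc a b, ENNReal.ofReal (1 / (2 * √v)) := lintegral_mono hpdf
    _ = ENNReal.ofReal (1 / (2 * √v)) * ENNReal.ofReal (b - a) := by
      rw [setLIntegral_const, Real.volume_Icc]
    _ = _ := by
      rw [← ENNReal.ofReal_mul (by positivity)]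
      congr 1
      ring

theorem stdGaussian_map_inner {d : ℕ} (w : Pt d) :
    (stdGaussian (Pt d)).map (fun y => inner ℝ w y) = gaussianReal 0 (‖w‖₊ ^ 2) := by
  have h := IsGaussian.map_eq_gaussianReal (μ := stdGaussian (Pt d)) (innerSL ℝ w)
  rw [integral_strongDual_stdGaussian, variance_dual_stdGaussian, innerSL_apply_norm] at h
  rw [show (‖w‖₊ ^ 2 : ℝ≥0) = (‖w‖ ^ 2).toNNReal by
    ext; simp]
  rw [← h]
  rfl

/-- The probability that a Gaussian vector is close to a hyperplane. -/
theorem stdGaussian_slab_le {d : ℕ} {w : Pt d} (hw : w ≠ 0) (b t : ℝ) :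
    stdGaussian (Pt d) {y | |inner ℝ w y + b| ≤ t} ≤ ENNReal.ofReal (t / ‖w‖) := by
  have h1 : {y : Pt d | |inner ℝ w y + b| ≤ t} =
      (fun y => inner ℝ w y) ⁻¹' Set.Icc (-b - t) (-b + t) := by
    ext y
    simp only [Set.mem_ofPred_eq, Set.mem_preimage, Set.mem_Icc, abs_le]
    constructor <;> rintro ⟨h1, h2⟩ <;> constructor <;> linarith
  rw [h1, ← Measure.map_apply (by fun_prop) measurableSet_Icc, stdGaussian_map_inner]
  refine (gaussianReal_Icc_le _ (by simpa using hw) _ _).trans (ENNReal.ofReal_le_ofReal ?_)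
  rw [NNReal.coe_pow, coe_nnnorm, Real.sqrt_sq (norm_nonneg _)]
  apply le_of_eq
  ring

/-- The probability that a Gaussian vector lies in a small ball. -/
theorem stdGaussian_ball_le {d : ℕ} (x : Pt d) {s : ℝ} (hs : 0 < s) (r : ℝ) :
    stdGaussian (Pt d) {y | ‖x + s • y‖ ≤ r} ≤ ENNReal.ofReal (r / s) ^ d := by
  have h1 : {y : Pt d | ‖x + s • y‖ ≤ r} ⊆
      {y | ∀ j, y j ∈ Set.Icc ((-x j - r) / s) ((-x j + r) / s)} := by
    intro y hy j
    have h2 : |x j + s * y j| ≤ r := by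
      have := (EuclideanSpace.norm_eq (x + s • y)) ▸ Real.abs_le_sqrt
        (x := (x + s • y) j) (Finset.single_le_sum (f := fun j => ‖(x + s • y) j‖ ^ 2)
          (fun i _ => by positivity) (Finset.mem_univ j) |>.trans' (by simp))
      simpa using this.trans hy
    rw [abs_le] at h2
    constructor
    · rw [div_le_iff₀ hs]; linarith
    · rw [le_div_iff₀ hs]; linarith
  refine (measure_mono h1).trans ?_
  have h2 : MeasurableSet {y : Pt d | ∀ j, y j ∈ Set.Icc ((-x j - r) / s) ((-x j + r) / s)} := by
    simp only [Set.ofPred_forall]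
    exact MeasurableSet.iInter fun j => measurableSet_Icc.preimage (by fun_prop)
  rw [← map_pi_eq_stdGaussian, Measure.map_apply (by fun_prop) h2]
  have h3 : (WithLp.toLp 2) ⁻¹' {y : Pt d | ∀ j, y j ∈ Set.Icc ((-x j - r) / s) ((-x j + r) / s)} =
      Set.pi Set.univ fun j => Set.Icc ((-x j - r) / s) ((-x j + r) / s) := by
    ext y
    simp only [Set.mem_preimage, Set.mem_ofPred_eq, Set.mem_pi, Set.mem_univ, true_implies]
  rw [h3, Measure.pi_pi]
  calc _ ≤ ∏ _j : Fin d, ENNReal.ofReal (r / s) := by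
        refine Finset.prod_le_prod' fun j _ => ?_
        refine (gaussianReal_Icc_le _ one_ne_zero _ _).trans (ENNReal.ofReal_le_ofReal ?_)
        apply le_of_eq
        simp
        ring
    _ = _ := by simp

/-- Two dimensions suffice for the third inverse moment below, so the exponent `d` is lowered to 2;
a ratio above 1 makes the bound trivial. -/
theorem stdGaussian_ball_le_sq {d : ℕ} (hd : 2 ≤ d) (x : Pt d) {s : ℝ} (hs : 0 < s) (r : ℝ) :
    stdGaussian (Pt d) {y | ‖x + s • y‖ ≤ r} ≤ ENNReal.ofReal (r / s) ^ 2 := by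
  rcases le_total (ENNReal.ofReal (r / s)) 1 with h | h
  · exact (stdGaussian_ball_le x hs r).trans (pow_le_pow_right_of_le_one' h hd)
  · exact prob_le_one.trans (one_le_pow₀ h)

/-- The truncated third inverse moment of the norm of a Gaussian vector. -/
theorem lintegral_inv_norm_cube_le {d : ℕ} (hd : 2 ≤ d) (x : Pt d) {s c δ : ℝ} (hs : 0 < s)
    (hδ : 0 < δ) (hc : 0 ≤ c) :
    ∫⁻ y, {z : Pt d | δ ≤ ‖z‖}.indicator (fun z => ENNReal.ofReal (c / ‖z‖) ^ 3) (x + s • y)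
      ∂stdGaussian (Pt d) ≤ ENNReal.ofReal (8 * c ^ 3 / (s ^ 2 * δ)) := by
  -- Dyadic shells `2 ^ l * δ ≤ ‖z‖ < 2 ^ (l + 1) * δ`: the integrand decays like `8 ^ (-l)` while
  -- the ball probability grows like `4 ^ l`, which leaves a geometric series of ratio 1/2.
  have h1 : ∀ z : Pt d, {z : Pt d | δ ≤ ‖z‖}.indicator
      (fun z => ENNReal.ofReal (c / ‖z‖) ^ 3) z ≤
      ∑' l : ℕ, {z : Pt d | ‖z‖ ≤ 2 ^ (l + 1) * δ}.indicator
        (fun _ => ENNReal.ofReal (c / (2 ^ l * δ)) ^ 3) z := by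
    intro z
    by_cases hz : δ ≤ ‖z‖
    · obtain ⟨l, hl1, hl2⟩ := exists_nat_pow_near (x := ‖z‖ / δ) (y := (2 : ℝ))
        (by rwa [one_le_div hδ]) one_lt_two
      rw [le_div_iff₀ hδ] at hl1
      rw [div_lt_iff₀ hδ] at hl2
      refine le_trans ?_ (ENNReal.le_tsum l)
      rw [Set.indicator_of_mem (by exact hz), Set.indicator_of_mem (by exact hl2.le)]
      gcongr
    · rw [Set.indicator_of_notMem (by exact hz)]
      exact zero_le
  calc _ ≤ ∫⁻ y, ∑' l : ℕ, {z : Pt d | ‖z‖ ≤ 2 ^ (l + 1) * δ}.indicator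
        (fun _ => ENNReal.ofReal (c / (2 ^ l * δ)) ^ 3) (x + s • y) ∂stdGaussian (Pt d) :=
        lintegral_mono fun y => h1 _
    _ = ∑' l : ℕ, ENNReal.ofReal (c / (2 ^ l * δ)) ^ 3 *
        stdGaussian (Pt d) {y | ‖x + s • y‖ ≤ 2 ^ (l + 1) * δ} := by
      have hm : ∀ l : ℕ, MeasurableSet {y : Pt d | ‖x + s • y‖ ≤ 2 ^ (l + 1) * δ} := fun l =>
        measurableSet_le (by fun_prop) (by fun_prop)
      have he : ∀ (l : ℕ) (y : Pt d), {z : Pt d | ‖z‖ ≤ 2 ^ (l + 1) * δ}.indicator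
          (fun _ => ENNReal.ofReal (c / (2 ^ l * δ)) ^ 3) (x + s • y) =
          {y | ‖x + s • y‖ ≤ 2 ^ (l + 1) * δ}.indicator
            (fun _ => ENNReal.ofReal (c / (2 ^ l * δ)) ^ 3) y := fun l y => rfl
      simp_rw [he]
      rw [lintegral_tsum fun l => (measurable_const.indicator (hm l)).aemeasurable]
      refine tsum_congr fun l => ?_
      rw [lintegral_indicator_const (hm l)]
    _ ≤ ∑' l : ℕ, ENNReal.ofReal (4 * c ^ 3 / (s ^ 2 * δ) * (1 / 2) ^ l) := by
      refine ENNReal.tsum_le_tsum fun l => ?_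
      refine (mul_le_mul_right (stdGaussian_ball_le_sq hd x hs _) _).trans ?_
      rw [← ENNReal.ofReal_pow (by positivity), ← ENNReal.ofReal_pow (by positivity),
        ← ENNReal.ofReal_mul (by positivity)]
      refine ENNReal.ofReal_le_ofReal (le_of_eq ?_)
      rw [one_div_pow]
      field_simp
      ring
    _ = _ := by
      rw [← ENNReal.ofReal_tsum_of_nonneg (fun l => by positivity)
        (summable_geometric_two.mul_left _), tsum_mul_left, tsum_geometric_two]
      congr 1
      ring

/-! ### Boundaries, spanning trees and fundamental cycles of a transition graph. -/

namespace TransitionGraph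

variable {n k : ℕ} (G : TransitionGraph n k)

/-- The sum of the values of the outgoing edges of `i` minus that of its incoming edges. -/
def bdry {M : Type*} [AddCommGroup M] (i : Fin k) (X : Fin n → M) : M :=
  ∑ e ∈ G.outEdges i, X e.1 - ∑ e ∈ G.inEdges i, X e.1

/-- The number of data points that `i` loses minus the number of those that it gains. -/
def excess (i : Fin k) : ℝ := (G.outDegree i : ℝ) - (G.inDegree i : ℝ)

theorem bdry_add {M : Type*} [AddCommGroup M] (i : Fin k) (X Y : Fin n → M) :
    G.bdry i (X + Y) = G.bdry i X + G.bdry i Y := by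
  simp only [bdry, Pi.add_apply, Finset.sum_add_distrib]
  abel

theorem bdry_smul (i : Fin k) (c : ℝ) (v : Fin n → ℝ) : G.bdry i (c • v) = c * G.bdry i v := by
  simp only [bdry, Pi.smul_apply, smul_eq_mul, ← Finset.mul_sum]
  ring

theorem bdry_sub {M : Type*} [AddCommGroup M] (i : Fin k) (X Y : Fin n → M) :
    G.bdry i (X - Y) = G.bdry i X - G.bdry i Y := by
  simp only [bdry, Pi.sub_apply, Finset.sum_sub_distrib]
  abel

theorem bdry_shift {d : ℕ} (i : Fin k) (v : Fin n → ℝ) (y : Pt d) :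
    G.bdry i (shift v y) = G.bdry i v • y := by
  simp only [bdry, shift, ← Finset.sum_smul, sub_smul]

theorem bdry_add_shift {d : ℕ} (i : Fin k) (X : Fin n → Pt d) (v : Fin n → ℝ) (y : Pt d) :
    G.bdry i (X + shift v y) = G.bdry i X + G.bdry i v • y := by
  rw [bdry_add, bdry_shift]

theorem bdry_single {e : Fin n × Fin k × Fin k} (he : e ∈ G.edges) (i : Fin k) :
    G.bdry i (Pi.single e.1 (1 : ℝ)) =
      (if i = e.2.1 then 1 else 0) - (if i = e.2.2 then 1 else 0) := by
  have h : ∀ f ∈ G.edges, (Pi.single e.1 (1 : ℝ) : Fin n → ℝ) f.1 = if f = e then 1 else 0 := by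
    intro f hf
    by_cases hfe : f = e
    · simp [hfe]
    · rw [Pi.single_apply, if_neg hfe, if_neg fun h => hfe (G.label_inj f hf e he h)]
  unfold bdry inEdges outEdges
  rw [Finset.sum_congr rfl fun f hf => h f (Finset.mem_filter.1 hf).1,
    Finset.sum_congr rfl fun f hf => h f (Finset.mem_filter.1 hf).1]
  simp [he, eq_comm]

theorem measurable_bdry {d : ℕ} (i : Fin k) :
    Measurable fun X : Fin n → Pt d => G.bdry i X := by
  unfold bdry
  fun_prop

/-- The total boundary over all nodes vanishes. -/
theorem sum_bdry {M : Type*} [AddCommGroup M] (X : Fin n → M) :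
    ∑ i ∈ G.verts, G.bdry i X = 0 := by
  have h1 : ∑ i ∈ G.verts, ∑ e ∈ G.outEdges i, X e.1 = ∑ e ∈ G.edges, X e.1 := by
    unfold outEdges
    exact Finset.sum_fiberwise_of_maps_to (fun e he => G.src_mem e he) fun e => X e.1
  have h2 : ∑ i ∈ G.verts, ∑ e ∈ G.inEdges i, X e.1 = ∑ e ∈ G.edges, X e.1 := by
    unfold inEdges
    exact Finset.sum_fiberwise_of_maps_to (fun e he => G.tgt_mem e he) fun e => X e.1
  simp only [bdry, Finset.sum_sub_distrib, h1, h2, sub_self]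

theorem sum_degree : ∑ i ∈ G.verts, G.degree i = 2 * G.edges.card := by
  have h1 : ∑ i ∈ G.verts, G.outDegree i = G.edges.card :=
    (Finset.card_eq_sum_card_fiberwise fun e he => G.src_mem e he).symm
  have h2 : ∑ i ∈ G.verts, G.inDegree i = G.edges.card :=
    (Finset.card_eq_sum_card_fiberwise fun e he => G.tgt_mem e he).symm
  simp only [degree, Finset.sum_add_distrib, h1, h2]
  ring

/-- In a connected graph, a set of nodes that is neither empty nor everything is left by an edge. -/
theorem exists_edge_leaving (hG : G.WeaklyConnected) {W : Finset (Fin k)} {r : Fin k} (hr : r ∈ W)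
    (hW : W ⊆ G.verts) (hne : W ≠ G.verts) :
    ∃ e ∈ G.edges, (e.2.1 ∈ W ∧ e.2.2 ∉ W) ∨ (e.2.1 ∉ W ∧ e.2.2 ∈ W) := by
  obtain ⟨j, hj, hjW⟩ := Finset.exists_of_ssubset (hW.ssubset_of_ne hne)
  have h := hG.2 r (hW hr) j hj
  induction h with
  | refl => exact absurd hr hjW
  | @tail a b _ hab ih =>
    by_cases ha : a ∈ W
    · obtain ⟨x, hx | hx⟩ := hab
      · exact ⟨_, hx, Or.inl ⟨ha, hjW⟩⟩
      · exact ⟨_, hx, Or.inr ⟨hjW, ha⟩⟩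
    · refine ih ?_ ha
      obtain ⟨x, hx | hx⟩ := hab
      · exact G.src_mem _ hx
      · exact G.tgt_mem _ hx

/-- A partial spanning tree with edge set `F` and node set `W`, together with the unit flows `π i`
in the tree from its nodes to the root `r`. -/
structure IsTree (r : Fin k) (W : Finset (Fin k)) (F : Finset (Fin n × Fin k × Fin k))
    (π : Fin k → Fin n → ℝ) : Prop where
  root_mem : r ∈ W
  subset_verts : W ⊆ G.verts
  subset_edges : F ⊆ G.edges
  card : F.card + 1 = W.card
  bdry_flow : ∀ i ∈ W, ∀ j, G.bdry j (π i) =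
    (if j = i then 1 else 0) - (if j = r then 1 else 0)
  abs_le : ∀ i ∈ W, ∀ x, |π i x| ≤ 1
  support : ∀ i ∈ W, ∀ x, π i x ≠ 0 → x ∈ F.image Prod.fst
  ends_mem : ∀ e ∈ F, e.2.1 ∈ W ∧ e.2.2 ∈ W

theorem isTree_root {r : Fin k} (hr : r ∈ G.verts) : G.IsTree r {r} ∅ fun _ => 0 where
  root_mem := by simp
  subset_verts := by simpa using hr
  subset_edges := by simp
  card := by simp
  bdry_flow := by
    intro i hi j
    rw [Finset.mem_singleton.1 hi]
    simp [bdry]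
  abs_le := by simp
  support := by simp
  ends_mem := by simp

variable {G}

/-- The flow of the new node `j` runs over `e` to its neighbor `i` and then follows the flow of `i`;
the sign `c` makes the contributions at `i` cancel. As `e` carries a label not yet used by the tree,
all values stay in [-1, 1]. -/
theorem IsTree.extend {r : Fin k} {W : Finset (Fin k)} {F : Finset (Fin n × Fin k × Fin k)}
    {π : Fin k → Fin n → ℝ} (h : G.IsTree r W F π) {e : Fin n × Fin k × Fin k} (he : e ∈ G.edges)
    {i j : Fin k} (hi : i ∈ W) (hj : j ∉ W) {c : ℝ} (hc : |c| = 1)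
    (hij : (e.2.1 = i ∧ e.2.2 = j ∧ c = -1) ∨ (e.2.1 = j ∧ e.2.2 = i ∧ c = 1)) :
    ∃ F' π', G.IsTree r (insert j W) F' π' := by
  have heF : e ∉ F := by
    intro h'
    rcases hij with ⟨-, h2, -⟩ | ⟨h2, -, -⟩
    · exact hj (h2 ▸ (h.ends_mem e h').2)
    · exact hj (h2 ▸ (h.ends_mem e h').1)
  have hlab : e.1 ∉ F.image Prod.fst := by
    intro h'
    obtain ⟨f, hf, hfe⟩ := Finset.mem_image.1 h'
    exact heF (G.label_inj f (h.subset_edges hf) e he hfe ▸ hf)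
  have hne : ∀ l ∈ W, l ≠ j := fun l hl hlj => hj (hlj ▸ hl)
  have hzero : π i e.1 = 0 := by
    by_contra h'
    exact hlab (h.support i hi _ h')
  refine ⟨insert e F, Function.update π j (π i + c • Pi.single e.1 1), ?_⟩
  constructor
  · exact Finset.mem_insert_of_mem h.root_mem
  · refine Finset.insert_subset ?_ h.subset_verts
    rcases hij with ⟨-, h2, -⟩ | ⟨h2, -, -⟩
    · exact h2 ▸ G.tgt_mem e he
    · exact h2 ▸ G.src_mem e he
  · exact Finset.insert_subset he h.subset_edges
  · rw [Finset.card_insert_of_notMem heF, Finset.card_insert_of_notMem hj, h.card]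
  · intro l hl m
    rcases Finset.mem_insert.1 hl with rfl | hl
    · rw [Function.update_self, bdry_add, bdry_smul, h.bdry_flow i hi, G.bdry_single he]
      rcases hij with ⟨h1, h2, h3⟩ | ⟨h1, h2, h3⟩ <;> rw [h1, h2, h3] <;> ring
    · rw [Function.update_of_ne (hne l hl)]
      exact h.bdry_flow l hl m
  · intro l hl x
    rcases Finset.mem_insert.1 hl with rfl | hl
    · rw [Function.update_self]
      by_cases hx : x = e.1
      · subst hx
        simp [hzero, hc]
      · simpa [hx] using h.abs_le i hi x
    · rw [Function.update_of_ne (hne l hl)]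
      exact h.abs_le l hl x
  · intro l hl x hx
    rw [Finset.image_insert, Finset.mem_insert]
    rcases Finset.mem_insert.1 hl with rfl | hl
    · rw [Function.update_self] at hx
      by_cases hxe : x = e.1
      · exact Or.inl hxe
      · exact Or.inr (h.support i hi x (by simpa [hxe] using hx))
    · rw [Function.update_of_ne (hne l hl)] at hx
      exact Or.inr (h.support l hl x hx)
  · intro f hf
    rcases Finset.mem_insert.1 hf with rfl | hf
    · rcases hij with ⟨h1, h2, -⟩ | ⟨h1, h2, -⟩ <;> rw [h1, h2] <;> simp [hi]
    · exact ⟨Finset.mem_insert_of_mem (h.ends_mem f hf).1,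
        Finset.mem_insert_of_mem (h.ends_mem f hf).2⟩

variable (G)

/-- A connected graph has a spanning tree. -/
theorem exists_isTree (hG : G.WeaklyConnected) {r : Fin k} (hr : r ∈ G.verts) :
    ∃ F π, G.IsTree r G.verts F π := by
  -- Induction on a bound `s` for the number of nodes not yet reached.
  have key : ∀ s : ℕ, ∀ W F π, G.IsTree r W F π → G.verts.card ≤ W.card + s →
      ∃ F π, G.IsTree r G.verts F π := by
    intro s
    induction s with
    | zero =>
      intro W F π h hs
      exact ⟨F, π, Finset.eq_of_subset_of_card_le h.subset_verts hs ▸ h⟩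
    | succ s ih =>
      intro W F π h hs
      by_cases hW : W = G.verts
      · exact ⟨F, π, hW ▸ h⟩
      obtain ⟨e, he, h1 | h1⟩ := G.exists_edge_leaving hG h.root_mem h.subset_verts hW
      · obtain ⟨F', π', h'⟩ := h.extend he h1.1 h1.2 (c := -1) (by simp) (Or.inl ⟨rfl, rfl, rfl⟩)
        refine ih _ _ _ h' ?_
        rw [Finset.card_insert_of_notMem h1.2]
        omega
      · obtain ⟨F', π', h'⟩ := h.extend he h1.2 h1.1 (c := 1) (by simp) (Or.inr ⟨rfl, rfl, rfl⟩)
        refine ih _ _ _ h' ?_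
        rw [Finset.card_insert_of_notMem h1.1]
        omega
  exact key G.verts.card _ _ _ (G.isTree_root hr) (by omega)

variable {G}

/-- The fundamental cycle of an edge outside of the spanning tree. -/
noncomputable def cycleVec (π : Fin k → Fin n → ℝ) (e : Fin n × Fin k × Fin k) : Fin n → ℝ :=
  Pi.single e.1 1 - π e.2.1 + π e.2.2

namespace IsTree

variable {r : Fin k} {F : Finset (Fin n × Fin k × Fin k)} {π : Fin k → Fin n → ℝ}

theorem flow_eq_zero (h : G.IsTree r G.verts F π) {i : Fin k} (hi : i ∈ G.verts)
    {e : Fin n × Fin k × Fin k} (he : e ∈ G.edges \ F) : π i e.1 = 0 := by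
  rw [Finset.mem_sdiff] at he
  by_contra h'
  obtain ⟨f, hf, hfe⟩ := Finset.mem_image.1 (h.support i hi _ h')
  exact he.2 (G.label_inj f (h.subset_edges hf) e he.1 hfe ▸ hf)

theorem bdry_cycleVec (h : G.IsTree r G.verts F π) {e : Fin n × Fin k × Fin k} (he : e ∈ G.edges)
    (i : Fin k) : G.bdry i (cycleVec π e) = 0 := by
  rw [cycleVec, bdry_add, bdry_sub, G.bdry_single he, h.bdry_flow _ (G.src_mem e he),
    h.bdry_flow _ (G.tgt_mem e he)]
  ring

/-- Tree flows vanish on the labels of non-tree edges. Hence fundamental cycles are dual to the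
non-tree edges: moving along one of them moves exactly one of the non-tree points, which separates
their slab events. -/
theorem cycleVec_apply (h : G.IsTree r G.verts F π) {e f : Fin n × Fin k × Fin k}
    (he : e ∈ G.edges \ F) (hf : f ∈ G.edges \ F) :
    cycleVec π e f.1 = if f = e then 1 else 0 := by
  have heG := (Finset.mem_sdiff.1 he).1
  have hfG := (Finset.mem_sdiff.1 hf).1
  simp only [cycleVec, Pi.add_apply, Pi.sub_apply, h.flow_eq_zero (G.src_mem e heG) hf,
    h.flow_eq_zero (G.tgt_mem e heG) hf, sub_zero, add_zero]
  by_cases hfe : f = e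
  · simp [hfe]
  · rw [Pi.single_apply, if_neg hfe, if_neg fun h => hfe (G.label_inj f hfG e heG h)]

theorem len_cycleVec_le (h : G.IsTree r G.verts F π) {e : Fin n × Fin k × Fin k}
    (he : e ∈ G.edges \ F) : len (cycleVec π e) ≤ 2 * √n := by
  have heG := (Finset.mem_sdiff.1 he).1
  rw [len, Real.sqrt_le_left (by positivity), mul_pow, Real.sq_sqrt (Nat.cast_nonneg n)]
  have h1 : ∀ x, cycleVec π e x ^ 2 ≤ 2 ^ 2 := by
    intro x
    rw [sq_le_sq, abs_of_nonneg (zero_le_two (α := ℝ))]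
    by_cases hx : x = e.1
    · subst hx
      rw [h.cycleVec_apply he he]
      norm_num
    · have h2 := h.abs_le _ (G.src_mem e heG) x
      have h3 := h.abs_le _ (G.tgt_mem e heG) x
      simp only [cycleVec, Pi.add_apply, Pi.sub_apply, Pi.single_eq_of_ne hx]
      rw [_root_.abs_le] at *
      constructor <;> linarith [h2.1, h2.2, h3.1, h3.2]
  refine (Finset.sum_le_sum fun x _ => h1 x).trans (le_of_eq ?_)
  simp
  ring

theorem len_flow_le (h : G.IsTree r G.verts F π) {i : Fin k} (hi : i ∈ G.verts) :
    len (π i) ≤ √n := by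
  refine Real.sqrt_le_sqrt ?_
  have h1 : ∀ x, π i x ^ 2 ≤ 1 := fun x => by
    rw [sq_le_one_iff_abs_le_one]
    exact h.abs_le i hi x
  refine (Finset.sum_le_sum fun x _ => h1 x).trans (le_of_eq ?_)
  simp

theorem len_flow_sub_le (h : G.IsTree r G.verts F π) {i j : Fin k} (hi : i ∈ G.verts)
    (hj : j ∈ G.verts) : len (π i - π j) ≤ 2 * √n := by
  rw [len, Real.sqrt_le_left (by positivity), mul_pow, Real.sq_sqrt (Nat.cast_nonneg n)]
  have h1 : ∀ x, (π i - π j) x ^ 2 ≤ 2 ^ 2 := by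
    intro x
    rw [sq_le_sq, abs_of_nonneg (zero_le_two (α := ℝ))]
    have h2 := h.abs_le i hi x
    have h3 := h.abs_le j hj x
    simp only [Pi.sub_apply]
    rw [_root_.abs_le] at *
    constructor <;> linarith [h2.1, h2.2, h3.1, h3.2]
  refine (Finset.sum_le_sum fun x _ => h1 x).trans (le_of_eq ?_)
  simp
  ring

theorem card_sdiff_add (h : G.IsTree r G.verts F π) :
    (G.edges \ F).card + G.verts.card = G.edges.card + 1 := by
  have h1 := Finset.card_sdiff_add_card_eq_card h.subset_edges
  have h2 := h.card
  omega

end IsTree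

end TransitionGraph

/-! ### Counting nodes, edges and cycles in the general case. -/

namespace TransitionGraph

variable {n k : ℕ} (G : TransitionGraph n k)

/-- The sum of degrees over `P` counts an edge once for each of its end nodes in `P`, thus twice if
it lies inside. -/
theorem sum_degree_eq (P : Finset (Fin k)) : ∑ i ∈ P, G.degree i =
    (G.edges.filter fun e => e.2.1 ∈ P ∨ e.2.2 ∈ P).card +
      (G.edges.filter fun e => e.2.1 ∈ P ∧ e.2.2 ∈ P).card := by
  have h1 : ∑ i ∈ P, G.outDegree i = (G.edges.filter fun e => e.2.1 ∈ P).card := by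
    simp only [outDegree, outEdges, Finset.card_filter]
    rw [Finset.sum_comm]
    simp
  have h2 : ∑ i ∈ P, G.inDegree i = (G.edges.filter fun e => e.2.2 ∈ P).card := by
    simp only [inDegree, inEdges, Finset.card_filter]
    rw [Finset.sum_comm]
    simp
  simp only [degree, Finset.sum_add_distrib, h1, h2]
  rw [add_comm, Finset.filter_or, Finset.filter_and, Finset.card_union_add_card_inter]

/-- If there are not more than `s` disjoint pairs of adjacent unbalanced nodes of degree two, then
there are at most `3 s` edges between such nodes. -/
theorem card_edges_degree_two_le {s : ℕ} (hs : G.HasDisjointPairs s)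
    (hs' : ¬ G.HasDisjointPairs (s + 1)) {U : Finset (Fin k)}
    (hU : ∀ i ∈ U, i ∈ G.verts ∧ i ∉ G.balanced ∧ G.degree i = 2) :
    (G.edges.filter fun e => e.2.1 ∈ U ∧ e.2.2 ∈ U).card ≤ 3 * s := by
  obtain ⟨f, hf, hfd, hfa⟩ := hs
  set P := Finset.univ.image f with hP
  have hfP : ∀ p, f p ∈ P := fun p => Finset.mem_image_of_mem f (Finset.mem_univ p)
  have hcard : P.card = 2 * s := by
    rw [hP, Finset.card_image_of_injective _ hf]
    simp [mul_comm]
  have hsum : ∑ i ∈ P, G.degree i = 4 * s := by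
    rw [Finset.sum_congr rfl (g := fun _ => 2), Finset.sum_const, hcard, smul_eq_mul]
    · ring
    · intro i hi
      obtain ⟨p, -, rfl⟩ := Finset.mem_image.1 hi
      exact (hfd p).2.2
  -- Every pair supplies an edge of its own inside `P`. So the total degree `4 * s` of `P` meets at
  -- most `3 * s` edges.
  have hboth : s ≤ (G.edges.filter fun e => e.2.1 ∈ P ∧ e.2.2 ∈ P).card := by
    have h1 : ∀ t : Fin s, ∃ e ∈ G.edges, (e.2.1 = f (t, 0) ∧ e.2.2 = f (t, 1)) ∨
        (e.2.1 = f (t, 1) ∧ e.2.2 = f (t, 0)) := by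
      intro t
      obtain ⟨x, hx | hx⟩ := hfa t
      · exact ⟨_, hx, Or.inl ⟨rfl, rfl⟩⟩
      · exact ⟨_, hx, Or.inr ⟨rfl, rfl⟩⟩
    choose g hg hg' using h1
    have hinj : Function.Injective g := by
      intro t t' h
      have h1 := hg' t
      have h2 := hg' t'
      rw [h] at h1
      rcases h1 with ⟨h1, -⟩ | ⟨h1, -⟩ <;> rcases h2 with ⟨h2, -⟩ | ⟨h2, -⟩ <;>
        exact congrArg Prod.fst (hf (h1.symm.trans h2))
    calc s = (Finset.univ.image g).card := by simp [Finset.card_image_of_injective _ hinj]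
      _ ≤ _ := Finset.card_le_card fun e he => by
        obtain ⟨t, -, rfl⟩ := Finset.mem_image.1 he
        rw [Finset.mem_filter]
        refine ⟨hg t, ?_⟩
        rcases hg' t with ⟨h1, h2⟩ | ⟨h1, h2⟩ <;> rw [h1, h2] <;> exact ⟨hfP _, hfP _⟩
  -- By maximality: an edge between nodes of `U` that avoids `P` would be one more disjoint pair,
  -- appended by `Fin.snoc`.
  have htouch : (G.edges.filter fun e => e.2.1 ∈ U ∧ e.2.2 ∈ U).card ≤
      (G.edges.filter fun e => e.2.1 ∈ P ∨ e.2.2 ∈ P).card := by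
    refine Finset.card_le_card fun e he => ?_
    rw [Finset.mem_filter] at he ⊢
    refine ⟨he.1, ?_⟩
    by_contra hcon
    push Not at hcon
    refine hs' ⟨fun p => (Fin.snoc (α := fun _ => Fin 2 → Fin k) (fun t c => f (t, c))
      ![e.2.1, e.2.2] p.1 : Fin 2 → Fin k) p.2, ?_, ?_, ?_⟩
    · have hne := G.src_ne_tgt e he.1
      have h0 : ∀ p, e.2.1 ≠ f p := fun p h => hcon.1 (h ▸ hfP p)
      have h1 : ∀ p, e.2.2 ≠ f p := fun p h => hcon.2 (h ▸ hfP p)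
      rintro ⟨t, c⟩ ⟨t', c'⟩ h
      induction t using Fin.lastCases with
      | last =>
        induction t' using Fin.lastCases with
        | last =>
          fin_cases c <;> fin_cases c' <;> simp_all
        | cast t' =>
          fin_cases c
          · exact absurd (by simpa using h) (h0 (t', c'))
          · exact absurd (by simpa using h) (h1 (t', c'))
      | cast t =>
        induction t' using Fin.lastCases with
        | last =>
          fin_cases c'
          · exact absurd (by simpa using h.symm) (h0 (t, c))
          · exact absurd (by simpa using h.symm) (h1 (t, c))
        | cast t' =>
          simp only [Fin.snoc_castSucc] at h
          have := hf h
          simp_all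
    · rintro ⟨t, c⟩
      induction t using Fin.lastCases with
      | last =>
        fin_cases c
        · simpa using hU _ he.2.1
        · simpa using hU _ he.2.2
      | cast t => simpa using hfd (t, c)
    · intro t
      induction t using Fin.lastCases with
      | last => simpa using ⟨e.1, Or.inl he.1⟩
      | cast t => simpa using hfa t
  have := G.sum_degree_eq P
  omega

theorem hasDisjointPairs_zero : G.HasDisjointPairs 0 :=
  ⟨fun p => p.1.elim0, fun p => p.1.elim0, fun p => p.1.elim0, fun t => t.elim0⟩

/-- The graphs of the blueprints of the general case. -/
structure IsGeneralGraph (d : ℕ) : Prop where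
  connected : G.WeaklyConnected
  balanced_degree : ∀ i ∈ G.balanced, 8 * d + 1 ≤ G.inDegree i ∧ 8 * d + 1 ≤ G.outDegree i
  degree_ne_one : ∀ i ∈ G.verts, G.degree i ≠ 1
  pairs_le_two : ¬ G.HasDisjointPairs 3
  exists_large_degree : ∃ i ∈ G.verts, 8 ≤ G.degree i

variable {G}

namespace IsGeneralGraph

variable {d : ℕ}

theorem two_le_degree (h : G.IsGeneralGraph d) {i : Fin k} (hi : i ∈ G.verts) :
    2 ≤ G.degree i := by
  have h1 := h.degree_ne_one i hi
  by_cases hb : i ∈ G.balanced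
  · have := h.balanced_degree i hb
    unfold degree
    omega
  · have : G.inDegree i ≠ G.outDegree i := fun h' => hb (Finset.mem_filter.2 ⟨hi, h'⟩)
    unfold degree at *
    omega

/-- All linear inequalities between the numbers of edges and nodes that are needed: `u₂` is the
number of nodes of degree two and `u₃` the number of the other unbalanced nodes. -/
theorem exists_counts (h : G.IsGeneralGraph d) : ∃ u₂ u₃ : ℕ,
    G.verts.card = u₂ + u₃ + G.balanced.card ∧ 2 * u₂ ≤ G.edges.card + 6 ∧
    2 * u₂ + 3 * u₃ + (16 * d + 2) * G.balanced.card ≤ 2 * G.edges.card ∧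
    (G.balanced = ∅ → 2 * u₂ + 3 * u₃ + 5 ≤ 2 * G.edges.card) ∧ 8 ≤ G.edges.card := by
  set U := (G.verts \ G.balanced).filter fun i => G.degree i = 2 with hU
  set W := (G.verts \ G.balanced).filter fun i => ¬ G.degree i = 2 with hW
  have hbal : G.balanced ⊆ G.verts := Finset.filter_subset _ _
  have hsplit : ∀ f : Fin k → ℕ, ∑ i ∈ G.verts, f i =
      ∑ i ∈ U, f i + ∑ i ∈ W, f i + ∑ i ∈ G.balanced, f i := by
    intro f
    rw [hU, hW, Finset.sum_filter_add_sum_filter_not, Finset.sum_sdiff hbal]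
  have hUd : ∑ i ∈ U, G.degree i = 2 * U.card := by
    rw [Finset.sum_congr rfl (g := fun _ => 2), Finset.sum_const, smul_eq_mul, mul_comm]
    exact fun i hi => (Finset.mem_filter.1 hi).2
  have hW3 : ∀ i ∈ W, 3 ≤ G.degree i := by
    intro i hi
    rw [hW, Finset.mem_filter, Finset.mem_sdiff] at hi
    have := h.two_le_degree hi.1.1
    omega
  have hWd : 3 * W.card ≤ ∑ i ∈ W, G.degree i := by
    rw [mul_comm, ← smul_eq_mul]
    exact Finset.card_nsmul_le_sum _ _ _ hW3
  have hBd : (16 * d + 2) * G.balanced.card ≤ ∑ i ∈ G.balanced, G.degree i := by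
    rw [mul_comm, ← smul_eq_mul]
    refine Finset.card_nsmul_le_sum _ _ _ fun i hi => ?_
    have := h.balanced_degree i hi
    unfold degree
    omega
  have hdeg := G.sum_degree
  rw [hsplit] at hdeg
  have hm : 8 ≤ G.edges.card := by
    obtain ⟨i, hi, hi8⟩ := h.exists_large_degree
    have h1 := G.sum_degree_eq {i}
    have h2 : (G.edges.filter fun e => e.2.1 ∈ ({i} : Finset (Fin k)) ∧
        e.2.2 ∈ ({i} : Finset (Fin k))).card = 0 := by
      rw [Finset.card_eq_zero, Finset.filter_eq_empty_iff]
      rintro e he ⟨h1, h2⟩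
      exact G.src_ne_tgt e he ((Finset.mem_singleton.1 h1).trans (Finset.mem_singleton.1 h2).symm)
    rw [h2, Finset.sum_singleton] at h1
    have := Finset.card_filter_le G.edges fun e => e.2.1 ∈ ({i} : Finset (Fin k)) ∨
        e.2.2 ∈ ({i} : Finset (Fin k))
    omega
  refine ⟨U.card, W.card, ?_, ?_, by omega, ?_, hm⟩
  · simpa using hsplit fun _ => 1
  -- The total degree `2 * u₂` of the degree-two nodes is the number of edges meeting `U`, at most
  -- all edges, plus the number inside `U`, at most `3 * 2` because there are at most two disjoint
  -- pairs.
  · have h1 := G.sum_degree_eq U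
    have h2 : ∀ i ∈ U, i ∈ G.verts ∧ i ∉ G.balanced ∧ G.degree i = 2 := by
      intro i hi
      rw [hU, Finset.mem_filter, Finset.mem_sdiff] at hi
      exact ⟨hi.1.1, hi.1.2, hi.2⟩
    have h3 : (G.edges.filter fun e => e.2.1 ∈ U ∧ e.2.2 ∈ U).card ≤ 6 := by
      by_cases p1 : G.HasDisjointPairs 1
      · by_cases p2 : G.HasDisjointPairs 2
        · exact G.card_edges_degree_two_le p2 h.pairs_le_two h2
        · exact (G.card_edges_degree_two_le p1 p2 h2).trans (by omega)
      · exact (G.card_edges_degree_two_le G.hasDisjointPairs_zero p1 h2).trans (by omega)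
    have h4 := Finset.card_filter_le G.edges fun e => e.2.1 ∈ U ∨ e.2.2 ∈ U
    omega
  -- Without balanced nodes the node of degree at least 8 belongs to `W`; it exceeds the generic
  -- bound 3 by the surplus 5.
  · intro hb
    obtain ⟨i, hi, hi8⟩ := h.exists_large_degree
    have hiW : i ∈ W := by
      rw [hW, Finset.mem_filter, Finset.mem_sdiff, hb]
      exact ⟨⟨hi, by simp⟩, by omega⟩
    have h1 : 3 * (W.erase i).card ≤ ∑ j ∈ W.erase i, G.degree j := by
      rw [mul_comm, ← smul_eq_mul]
      exact Finset.card_nsmul_le_sum _ _ _ fun j hj => hW3 j (Finset.mem_of_mem_erase hj)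
    have h2 := Finset.add_sum_erase W G.degree hiW
    have h3 := Finset.card_erase_add_one hiW
    omega

/-- The size of the cycle space if there are no balanced nodes. -/
theorem cycles_of_balanced_empty (h : G.IsGeneralGraph d) (hb : G.balanced = ∅) {T : ℕ}
    (hT : T + G.verts.card = G.edges.card + 1) : 3 ≤ T ∧ G.edges.card ≤ 8 * (T - 2) := by
  obtain ⟨u₂, u₃, h1, h2, -, h3, h4⟩ := h.exists_counts
  have h5 := h3 hb
  rw [hb, Finset.card_empty] at h1
  -- The counts give 6 |V| ≤ 5 m − 4, hence 6 T ≥ m + 10, and m ≥ 8 yields both claims.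
  omega

/-- The size of the cycle space if there are balanced nodes. -/
theorem cycles_of_balanced_nonempty (h : G.IsGeneralGraph d) (hd : 2 ≤ d) (hb : G.balanced.Nonempty)
    {T : ℕ} (hT : T + G.verts.card = G.edges.card + 1) :
    4 ≤ T ∧ G.edges.card + 16 * (d * G.balanced.card) ≤ 8 * (T - 4) := by
  obtain ⟨u₂, u₃, h1, h2, h3, -, h4⟩ := h.exists_counts
  have h5 : 1 ≤ G.balanced.card := hb.card_pos
  have h6 : 2 * G.balanced.card ≤ d * G.balanced.card := by gcongr
  have h7 : (16 * d + 2) * G.balanced.card = 16 * (d * G.balanced.card) + 2 * G.balanced.card := by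
    ring
  omega

/-- The number of edges if all nodes are balanced. -/
theorem le_card_edges (h : G.IsGeneralGraph d) :
    8 * (d * G.balanced.card) ≤ G.edges.card := by
  obtain ⟨u₂, u₃, h1, h2, h3, -, h4⟩ := h.exists_counts
  have h7 : (16 * d + 2) * G.balanced.card = 16 * (d * G.balanced.card) + 2 * G.balanced.card := by
    ring
  omega

/-- The nodes of `G` are the end nodes of its edges. -/
theorem verts_eq (h : G.IsGeneralGraph d) :
    G.verts = G.edges.image (fun e => e.2.1) ∪ G.edges.image fun e => e.2.2 := by
  ext i
  rw [Finset.mem_union, Finset.mem_image, Finset.mem_image]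
  constructor
  · intro hi
    have h2 := h.two_le_degree hi
    unfold degree at h2
    rcases Nat.eq_zero_or_pos (G.outDegree i) with h0 | h0
    · obtain ⟨e, he⟩ := Finset.card_pos.1 (show 0 < (G.inEdges i).card by unfold inDegree at h2; omega)
      exact Or.inr ⟨e, Finset.mem_filter.1 he⟩
    · obtain ⟨e, he⟩ := Finset.card_pos.1 h0
      exact Or.inl ⟨e, Finset.mem_filter.1 he⟩
  · rintro (⟨e, he, rfl⟩ | ⟨e, he, rfl⟩)
    · exact G.src_mem e he
    · exact G.tgt_mem e he

/-- Since no node is isolated, the union bound over graphs can be taken over edge sets. -/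
theorem eq_of_edges_eq {G' : TransitionGraph n k} (h : G.IsGeneralGraph d)
    (h' : G'.IsGeneralGraph d) (he : G.edges = G'.edges) : G = G' := by
  have hv : G.verts = G'.verts := by rw [h.verts_eq, h'.verts_eq, he]
  cases G
  cases G'
  simp_all

end IsGeneralGraph

end TransitionGraph

/-- The factor `s` is going to contain the inverse excess of a cluster, which may be negative; a
reflection reduces this to the positive case. -/
theorem lintegral_inv_norm_cube_le_of_ne {d : ℕ} (hd : 2 ≤ d) (x : Pt d) {s c δ : ℝ} (hs : s ≠ 0)
    (hδ : 0 < δ) (hc : 0 ≤ c) :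
    ∫⁻ y, {z : Pt d | δ ≤ ‖z‖}.indicator (fun z => ENNReal.ofReal (c / ‖z‖) ^ 3) (x + s • y)
      ∂stdGaussian (Pt d) ≤ ENNReal.ofReal (8 * c ^ 3 / (s ^ 2 * δ)) := by
  rcases lt_or_gt_of_ne hs with h | h
  · have := lintegral_inv_norm_cube_le hd (-x) (neg_pos.2 h) hδ hc
    rw [neg_sq] at this
    refine le_trans (le_of_eq (lintegral_congr fun y => ?_)) this
    rw [show -x + -s • y = -(x + s • y) by rw [neg_smul]; abel]
    simp only [Set.indicator, Set.mem_ofPred_eq, norm_neg]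
  · exact lintegral_inv_norm_cube_le hd x h hδ hc

/-! ### Approximate centers, tightness and the conditional slab probability. -/

namespace TransitionGraph

variable {n k d : ℕ} (G : TransitionGraph n k)

/-- The approximate centers, for a choice `ℓ` of points for the balanced clusters. -/
noncomputable def ctr (ℓ : Fin k → Pt d) (i : Fin k) (X : Fin n → Pt d) : Pt d :=
  if i ∈ G.balanced then ℓ i else (G.excess i)⁻¹ • G.bdry i X

/-- The difference of the approximate centers of the end nodes of an edge. -/
noncomputable def gap (ℓ : Fin k → Pt d) (e : Fin n × Fin k × Fin k) (X : Fin n → Pt d) : Pt d :=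
  G.ctr ℓ e.2.1 X - G.ctr ℓ e.2.2 X

/-- The difference of the squared distances of a switching point from the approximate centers. -/
noncomputable def sqDiff (ℓ : Fin k → Pt d) (e : Fin n × Fin k × Fin k) (X : Fin n → Pt d) : ℝ :=
  ‖X e.1 - G.ctr ℓ e.2.1 X‖ ^ 2 - ‖X e.1 - G.ctr ℓ e.2.2 X‖ ^ 2

/-- The possible differences of approximate centers that are at least `δ` apart, and at least `δ'`
apart if one of the clusters is balanced. -/
def farSet (d : ℕ) (δ δ' : ℝ) (e : Fin n × Fin k × Fin k) : Set (Pt d) :=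
  {z | δ ≤ ‖z‖ ∧ (e.2.1 ∈ G.balanced ∨ e.2.2 ∈ G.balanced → δ' ≤ ‖z‖)}

/-- The points are placed as in an iteration of small improvement that follows a blueprint. -/
structure IsTight (ℓ : Fin k → Pt d) (τ δ δ' β : ℝ) (X : Fin n → Pt d) : Prop where
  slab : ∀ e ∈ G.edges, |G.sqDiff ℓ e X| ≤ τ
  far : ∀ e ∈ G.edges, G.gap ℓ e X ∈ G.farSet d δ δ' e
  bdry : ∀ i ∈ G.balanced, ‖G.bdry i X‖ ≤ β

theorem measurable_ctr (ℓ : Fin k → Pt d) (i : Fin k) : Measurable (G.ctr ℓ i) := by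
  unfold ctr
  split_ifs
  · exact measurable_const
  · have h := G.measurable_bdry (d := d) i
    exact h.const_smul (G.excess i)⁻¹

theorem measurable_gap (ℓ : Fin k → Pt d) (e : Fin n × Fin k × Fin k) : Measurable (G.gap ℓ e) :=
  (G.measurable_ctr ℓ _).sub (G.measurable_ctr ℓ _)

theorem measurable_sqDiff (ℓ : Fin k → Pt d) (e : Fin n × Fin k × Fin k) :
    Measurable (G.sqDiff ℓ e) := by
  have h1 := G.measurable_ctr ℓ e.2.1
  have h2 := G.measurable_ctr ℓ e.2.2
  unfold sqDiff
  fun_prop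

theorem measurableSet_farSet (δ δ' : ℝ) (e : Fin n × Fin k × Fin k) :
    MeasurableSet (G.farSet d δ δ' e) := by
  unfold farSet
  by_cases h : e.2.1 ∈ G.balanced ∨ e.2.2 ∈ G.balanced
  · simp only [h, true_implies]
    exact (measurableSet_le measurable_const measurable_norm).inter
      (measurableSet_le measurable_const measurable_norm)
  · simp only [h, false_implies, and_true]
    exact measurableSet_le measurable_const measurable_norm

/-- Balanced centers are constants, and an unbalanced center sees the configuration only through the
boundary at its node. -/
theorem ctr_add_shift_of_bdry_eq_zero (ℓ : Fin k → Pt d) {i : Fin k} {v : Fin n → ℝ}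
    (h : i ∉ G.balanced → G.bdry i v = 0) (X : Fin n → Pt d) (y : Pt d) :
    G.ctr ℓ i (X + shift v y) = G.ctr ℓ i X := by
  unfold ctr
  split_ifs with hi
  · rfl
  · rw [bdry_add_shift, h hi, zero_smul, add_zero]

theorem ctr_add_shift (ℓ : Fin k → Pt d) {i : Fin k} (hi : i ∉ G.balanced) (v : Fin n → ℝ)
    (X : Fin n → Pt d) (y : Pt d) :
    G.ctr ℓ i (X + shift v y) = G.ctr ℓ i X + ((G.excess i)⁻¹ * G.bdry i v) • y := by
  unfold ctr
  rw [if_neg hi, if_neg hi, bdry_add_shift, smul_add, mul_smul]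

theorem gap_add_shift_of_bdry_eq_zero (ℓ : Fin k → Pt d) {e : Fin n × Fin k × Fin k}
    {v : Fin n → ℝ} (h : ∀ i, i ∉ G.balanced → G.bdry i v = 0) (X : Fin n → Pt d) (y : Pt d) :
    G.gap ℓ e (X + shift v y) = G.gap ℓ e X := by
  unfold gap
  rw [G.ctr_add_shift_of_bdry_eq_zero ℓ (h _), G.ctr_add_shift_of_bdry_eq_zero ℓ (h _)]

/-- With both centers fixed, the terms quadratic in `y` cancel. What remains is affine with a
gradient proportional to the gap, so a small value means that `y` lies in a slab of width inversely
proportional to the gap. -/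
theorem sqDiff_add_shift_of_bdry_eq_zero (ℓ : Fin k → Pt d) {e : Fin n × Fin k × Fin k}
    {v : Fin n → ℝ} (h : ∀ i, i ∉ G.balanced → G.bdry i v = 0) (X : Fin n → Pt d) (y : Pt d) :
    G.sqDiff ℓ e (X + shift v y) =
      inner ℝ ((-2 * v e.1) • G.gap ℓ e X) y + G.sqDiff ℓ e X := by
  unfold sqDiff gap
  rw [G.ctr_add_shift_of_bdry_eq_zero ℓ (h _), G.ctr_add_shift_of_bdry_eq_zero ℓ (h _)]
  simp only [Pi.add_apply, shift]
  have h1 : ∀ p : Pt d, ‖X e.1 + v e.1 • y - p‖ ^ 2 =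
      ‖X e.1 - p‖ ^ 2 + 2 * (v e.1 * inner ℝ (X e.1 - p) y) + ‖v e.1 • y‖ ^ 2 := by
    intro p
    rw [show X e.1 + v e.1 • y - p = (X e.1 - p) + v e.1 • y by abel, norm_add_sq_real,
      inner_smul_right]
  rw [h1, h1, inner_smul_left, inner_sub_left, inner_sub_left, inner_sub_left]
  simp
  ring

/-- The event that belongs to an edge. -/
def slabSet (ℓ : Fin k → Pt d) (τ δ δ' : ℝ) (e : Fin n × Fin k × Fin k) : Set (Fin n → Pt d) :=
  {X | |G.sqDiff ℓ e X| ≤ τ ∧ G.gap ℓ e X ∈ G.farSet d δ δ' e}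

theorem mem_slabSet_add_shift (ℓ : Fin k → Pt d) (τ δ δ' : ℝ) {e : Fin n × Fin k × Fin k}
    {v : Fin n → ℝ} (h : ∀ i, i ∉ G.balanced → G.bdry i v = 0) (X : Fin n → Pt d) (y : Pt d) :
    X + shift v y ∈ G.slabSet ℓ τ δ δ' e ↔
      |inner ℝ ((-2 * v e.1) • G.gap ℓ e X) y + G.sqDiff ℓ e X| ≤ τ ∧
        G.gap ℓ e X ∈ G.farSet d δ δ' e := by
  rw [← G.gap_add_shift_of_bdry_eq_zero ℓ h X y (e := e),
    G.gap_add_shift_of_bdry_eq_zero ℓ h X y (e := e), ← G.sqDiff_add_shift_of_bdry_eq_zero ℓ h,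
    ← G.gap_add_shift_of_bdry_eq_zero ℓ h X y (e := e)]
  rfl

/-- The indicator function of the event that belongs to an edge. -/
noncomputable def slabInd (ℓ : Fin k → Pt d) (τ δ δ' : ℝ) (e : Fin n × Fin k × Fin k) :
    (Fin n → Pt d) → ℝ≥0∞ :=
  (G.slabSet ℓ τ δ δ' e).indicator fun _ => 1

/-- The bound for the conditional probability of the event that belongs to an edge, given the
approximate centers. -/
noncomputable def weight (ℓ : Fin k → Pt d) (c δ δ' : ℝ) (e : Fin n × Fin k × Fin k)
    (X : Fin n → Pt d) : ℝ≥0∞ :=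
  (G.farSet d δ δ' e).indicator (fun z => ENNReal.ofReal (c / ‖z‖)) (G.gap ℓ e X)

theorem measurable_slabInd (ℓ : Fin k → Pt d) (τ δ δ' : ℝ) (e : Fin n × Fin k × Fin k) :
    Measurable (G.slabInd ℓ τ δ δ' e) :=
  measurable_const.indicator ((measurableSet_le (G.measurable_sqDiff ℓ e).abs measurable_const).inter
    (G.measurable_gap ℓ e (G.measurableSet_farSet δ δ' e)))

theorem measurable_weight (ℓ : Fin k → Pt d) (c δ δ' : ℝ) (e : Fin n × Fin k × Fin k) :
    Measurable (G.weight ℓ c δ δ' e) :=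
  (((measurable_const.div measurable_norm).ennreal_ofReal).indicator
    (G.measurableSet_farSet δ δ' e)).comp (G.measurable_gap ℓ e)

theorem slabInd_add_shift (ℓ : Fin k → Pt d) (τ δ δ' : ℝ) {e : Fin n × Fin k × Fin k}
    {v : Fin n → ℝ} (h : ∀ i, i ∉ G.balanced → G.bdry i v = 0) (hv : v e.1 = 0)
    (X : Fin n → Pt d) (y : Pt d) :
    G.slabInd ℓ τ δ δ' e (X + shift v y) = G.slabInd ℓ τ δ δ' e X := by
  have : X + shift v y ∈ G.slabSet ℓ τ δ δ' e ↔ X ∈ G.slabSet ℓ τ δ δ' e := by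
    rw [G.mem_slabSet_add_shift ℓ τ δ δ' h, hv]
    simp [slabSet]
  by_cases hX : X ∈ G.slabSet ℓ τ δ δ' e
  · rw [slabInd, Set.indicator_of_mem hX, Set.indicator_of_mem (this.2 hX)]
  · rw [slabInd, Set.indicator_of_notMem hX, Set.indicator_of_notMem (mt this.1 hX)]

theorem weight_add_shift (ℓ : Fin k → Pt d) (c δ δ' : ℝ) {e : Fin n × Fin k × Fin k}
    {v : Fin n → ℝ} (h : ∀ i, i ∉ G.balanced → G.bdry i v = 0)
    (X : Fin n → Pt d) (y : Pt d) :
    G.weight ℓ c δ δ' e (X + shift v y) = G.weight ℓ c δ δ' e X := by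
  simp only [weight, G.gap_add_shift_of_bdry_eq_zero ℓ h]

/-- The conditional probability of the event that belongs to an edge. -/
theorem lintegral_slabInd_le (ℓ : Fin k → Pt d) {τ δ δ' σ c : ℝ} (hδ : 0 < δ) (hσ : 0 < σ)
    {e : Fin n × Fin k × Fin k} {v : Fin n → ℝ}
    (h : ∀ i, i ∉ G.balanced → G.bdry i v = 0) (hv : v e.1 = 1) (hc : τ * len v / (2 * σ) ≤ c)
    (X : Fin n → Pt d) :
    ∫⁻ y, G.slabInd ℓ τ δ δ' e (X + shift v ((σ / len v) • y)) ∂stdGaussian (Pt d) ≤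
      G.weight ℓ c δ δ' e X := by
  have hlen : 0 < len v := len_pos (fun h0 => by simp [h0] at hv)
  by_cases hX : G.gap ℓ e X ∈ G.farSet d δ δ' e
  · have hpos : 0 < ‖G.gap ℓ e X‖ := hδ.trans_le hX.1
    have hne : (-2 * (σ / len v)) • G.gap ℓ e X ≠ 0 := by
      rw [smul_ne_zero_iff]
      exact ⟨by simp [hσ.ne', hlen.ne'], norm_pos_iff.1 hpos⟩
    have h1 : ∀ y, G.slabInd ℓ τ δ δ' e (X + shift v ((σ / len v) • y)) =
        {y | |inner ℝ ((-2 * (σ / len v)) • G.gap ℓ e X) y + G.sqDiff ℓ e X| ≤ τ}.indicator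
          (fun _ => 1) y := by
      intro y
      have h2 : X + shift v ((σ / len v) • y) ∈ G.slabSet ℓ τ δ δ' e ↔
          |inner ℝ ((-2 * (σ / len v)) • G.gap ℓ e X) y + G.sqDiff ℓ e X| ≤ τ := by
        rw [G.mem_slabSet_add_shift ℓ τ δ δ' h, hv, and_iff_left hX, inner_smul_left,
          inner_smul_left, inner_smul_right]
        simp only [map_mul, conj_trivial]
        ring_nf
      simp only [slabInd, Set.indicator, h2, Set.mem_ofPred_eq]
    simp_rw [h1]
    rw [lintegral_indicator_const (measurableSet_le (by fun_prop) measurable_const), one_mul, weight,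
      Set.indicator_of_mem hX]
    refine (stdGaussian_slab_le hne _ _).trans (ENNReal.ofReal_le_ofReal ?_)
    rw [norm_smul, Real.norm_eq_abs, abs_mul, abs_of_pos (div_pos hσ hlen), abs_neg, abs_two]
    calc _ = τ * len v / (2 * σ) / ‖G.gap ℓ e X‖ := by field_simp
      _ ≤ _ := by gcongr
  · have h1 : ∀ y, G.slabInd ℓ τ δ δ' e (X + shift v ((σ / len v) • y)) = 0 := by
      intro y
      refine Set.indicator_of_notMem ?_ _
      rw [G.mem_slabSet_add_shift ℓ τ δ δ' h]
      exact fun h => hX h.2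
    simp [h1]

theorem weight_le (ℓ : Fin k → Pt d) {c δ : ℝ} (hc : 0 ≤ c) (hδ : 0 < δ) (δ' : ℝ)
    (e : Fin n × Fin k × Fin k) (X : Fin n → Pt d) :
    G.weight ℓ c δ δ' e X ≤ ENNReal.ofReal (c / δ) := by
  unfold weight
  refine Set.indicator_le' (g := fun _ => ENNReal.ofReal (c / δ)) ?_ (fun _ _ => zero_le) _
  intro z hz
  have := hz.1
  gcongr

theorem weight_le_of_balanced (ℓ : Fin k → Pt d) {c δ' : ℝ} (hc : 0 ≤ c) (δ : ℝ) (hδ' : 0 < δ')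
    {e : Fin n × Fin k × Fin k} (he : e.2.1 ∈ G.balanced ∨ e.2.2 ∈ G.balanced)
    (X : Fin n → Pt d) :
    G.weight ℓ c δ δ' e X ≤ ENNReal.ofReal (c / δ') := by
  unfold weight
  refine Set.indicator_le' (g := fun _ => ENNReal.ofReal (c / δ')) ?_ (fun _ _ => zero_le) _
  intro z hz
  have := hz.2 he
  gcongr

/-- The indicator function of the event that no balanced center moves far. -/
noncomputable def bdryInd (d : ℕ) (β : ℝ) (i : Fin k) : (Fin n → Pt d) → ℝ≥0∞ :=
  {X | ‖G.bdry i X‖ ≤ β}.indicator fun _ => 1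

theorem measurable_bdryInd (β : ℝ) (i : Fin k) : Measurable (G.bdryInd d β i) :=
  measurable_const.indicator (measurableSet_le (G.measurable_bdry i).norm measurable_const)

theorem bdryInd_add_shift (β : ℝ) {i : Fin k} {v : Fin n → ℝ} (h : G.bdry i v = 0)
    (X : Fin n → Pt d) (y : Pt d) : G.bdryInd d β i (X + shift v y) = G.bdryInd d β i X := by
  simp only [bdryInd, Set.indicator, Set.mem_ofPred_eq, bdry_add_shift, h, zero_smul, add_zero]

theorem one_le_of_isTight {ℓ : Fin k → Pt d} {τ δ δ' β : ℝ} {X : Fin n → Pt d}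
    (h : G.IsTight ℓ τ δ δ' β X) {R : Finset (Fin n × Fin k × Fin k)} (hR : R ⊆ G.edges) :
    1 ≤ (∏ i ∈ G.balanced, G.bdryInd d β i X) * ∏ e ∈ R, G.slabInd ℓ τ δ δ' e X := by
  rw [Finset.prod_eq_one, Finset.prod_eq_one, one_mul]
  · intro e he
    exact Set.indicator_of_mem (s := G.slabSet ℓ τ δ δ' e) ⟨h.slab e (hR he), h.far e (hR he)⟩ _
  · intro i hi
    exact Set.indicator_of_mem (s := {X | ‖G.bdry i X‖ ≤ β}) (h.bdry i hi) _

/-- Markov's inequality, applied to a measurable superset so that `s` itself may be arbitrary. -/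
theorem measure_le_lintegral_of_one_le {α : Type*} [MeasurableSpace α] (μ : Measure α) {s : Set α}
    {f : α → ℝ≥0∞} (hf : Measurable f) (h : ∀ x ∈ s, 1 ≤ f x) : μ s ≤ ∫⁻ x, f x ∂μ := by
  calc μ s ≤ μ {x | 1 ≤ f x} := measure_mono h
    _ = 1 * μ {x | 1 ≤ f x} := (one_mul _).symm
    _ ≤ _ := mul_meas_ge_le_lintegral hf 1

/-- If all nodes are balanced, all switching points are independently close to given hyperplanes. -/
theorem measure_isTight_le_of_all_balanced (a : Fin n → Pt d) {σ : ℝ} (hσ : 0 < σ)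
    (hG : G.balanced = G.verts) (ℓ : Fin k → Pt d) {τ δ δ' c : ℝ} (β : ℝ) (hτ : 0 ≤ τ) (hδ : 0 < δ)
    (hδ' : 0 < δ') (hc : τ / (2 * σ) ≤ c) :
    perturbedLaw a σ {X | G.IsTight ℓ τ δ δ' β X} ≤ ENNReal.ofReal (c / δ') ^ G.edges.card := by
  -- All nodes are balanced, and outside of the graph boundaries vanish. So no direction moves a
  -- center, and each switching point can be averaged by itself.
  have hunb : ∀ (v : Fin n → ℝ) (i : Fin k), i ∉ G.balanced → G.bdry i v = 0 := by
    intro v i hi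
    rw [hG] at hi
    have h1 : G.outEdges i = ∅ := Finset.filter_eq_empty_iff.2
      fun e he h => hi (h ▸ G.src_mem e he)
    have h2 : G.inEdges i = ∅ := Finset.filter_eq_empty_iff.2
      fun e he h => hi (h ▸ G.tgt_mem e he)
    simp [bdry, h1, h2]
  have hlen : ∀ x : Fin n, len (Pi.single x 1 : Fin n → ℝ) = 1 := by
    intro x
    rw [len, Finset.sum_eq_single x] <;> simp +contextual
  have key := lintegral_mul_prod_le a σ G.edges (fun e => Pi.single e.1 1)
    (fun e => G.slabInd ℓ τ δ δ' e) (fun e => G.weight ℓ c δ δ' e) (f := fun _ => 1)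
    (fun e _ => by simp) (fun e _ => G.measurable_slabInd ..) (fun e _ => G.measurable_weight ..)
    (fun e he e' he' hne => G.slabInd_add_shift ℓ τ δ δ' (hunb _) (by
      rw [Pi.single_apply, if_neg fun h => hne (G.label_inj e he e' he' h)]))
    (fun e _ e' _ => G.weight_add_shift ℓ c δ δ' (hunb _))
    (fun e _ => G.lintegral_slabInd_le ℓ hδ hσ (hunb _) (by simp) (by rw [hlen, mul_one]; exact hc))
    measurable_const (fun _ _ _ _ => rfl)
  calc _ ≤ ∫⁻ X, 1 * ∏ e ∈ G.edges, G.slabInd ℓ τ δ δ' e X ∂perturbedLaw a σ := by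
        refine measure_le_lintegral_of_one_le _ ?_ fun X hX => ?_
        · exact measurable_const.mul (Finset.measurable_fun_prod _ fun e _ => G.measurable_slabInd ..)
        · rw [Finset.prod_eq_one, one_mul]
          exact fun e he => Set.indicator_of_mem (s := G.slabSet ℓ τ δ δ' e)
            ⟨hX.slab e he, hX.far e he⟩ _
    _ ≤ _ := key
    _ ≤ ∫⁻ X, ENNReal.ofReal (c / δ') ^ G.edges.card ∂perturbedLaw a σ := by
        refine lintegral_mono fun X => ?_
        rw [one_mul]
        refine Finset.prod_le_pow_card _ _ _ fun e he => ?_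
        exact G.weight_le_of_balanced ℓ ((by positivity : 0 ≤ τ / (2 * σ)).trans hc) δ hδ'
          (Or.inl (hG ▸ G.src_mem e he)) X
    _ = _ := by simp

end TransitionGraph

/-! ### The probability of tightness for one graph with an unbalanced node. -/

namespace TransitionGraph

variable {n k d : ℕ} (G : TransitionGraph n k)

theorem mem_balanced {i : Fin k} (hi : i ∈ G.verts) : i ∈ G.balanced ↔ G.excess i = 0 := by
  rw [balanced, Finset.mem_filter, and_iff_right hi, excess, sub_eq_zero, Nat.cast_inj, eq_comm]

theorem excess_eq_bdry (i : Fin k) : G.excess i = G.bdry i fun _ => (1 : ℝ) := by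
  simp [excess, bdry, inDegree, outDegree]

theorem outDegree_le (i : Fin k) : G.outDegree i ≤ n := by
  have h : Set.InjOn Prod.fst (G.outEdges i : Set (Fin n × Fin k × Fin k)) := fun e he f hf hef =>
    G.label_inj e (Finset.mem_filter.1 he).1 f (Finset.mem_filter.1 hf).1 hef
  rw [outDegree, ← Finset.card_image_of_injOn h]
  exact (Finset.card_le_univ _).trans_eq (Fintype.card_fin n)

theorem inDegree_le (i : Fin k) : G.inDegree i ≤ n := by
  have h : Set.InjOn Prod.fst (G.inEdges i : Set (Fin n × Fin k × Fin k)) := fun e he f hf hef =>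
    G.label_inj e (Finset.mem_filter.1 he).1 f (Finset.mem_filter.1 hf).1 hef
  rw [inDegree, ← Finset.card_image_of_injOn h]
  exact (Finset.card_le_univ _).trans_eq (Fintype.card_fin n)

theorem abs_excess_le (i : Fin k) : |G.excess i| ≤ n := by
  have h1 : (G.outDegree i : ℝ) ≤ n := by exact_mod_cast G.outDegree_le i
  have h2 : (G.inDegree i : ℝ) ≤ n := by exact_mod_cast G.inDegree_le i
  have h3 : (0 : ℝ) ≤ G.outDegree i := Nat.cast_nonneg _
  have h4 : (0 : ℝ) ≤ G.inDegree i := Nat.cast_nonneg _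
  rw [excess, abs_le]
  constructor <;> linarith

theorem one_le_abs_excess {i : Fin k} (h : G.excess i ≠ 0) : 1 ≤ |G.excess i| := by
  have h1 : G.excess i = (((G.outDegree i : ℤ) - G.inDegree i : ℤ) : ℝ) := by
    simp [excess]
  rw [h1] at h ⊢
  rw [← Int.cast_abs]
  exact_mod_cast Int.one_le_abs (by exact_mod_cast h)

/-- If only the two end nodes of an edge are unbalanced, their approximate centers are close to
each other. -/
theorem norm_gap_le (ℓ : Fin k → Pt d) {e : Fin n × Fin k × Fin k} (he : e ∈ G.edges)
    (h1 : e.2.1 ∉ G.balanced) (h2 : e.2.2 ∉ G.balanced)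
    (hall : ∀ l ∈ G.verts, l ∉ G.balanced → l = e.2.1 ∨ l = e.2.2) {β : ℝ} (hβ : 0 ≤ β)
    {X : Fin n → Pt d} (hX : ∀ i ∈ G.balanced, ‖G.bdry i X‖ ≤ β) :
    ‖G.gap ℓ e X‖ ≤ k * β := by
  have hs := G.src_mem e he
  have ht := G.tgt_mem e he
  have hne := G.src_ne_tgt e he
  -- Stated for every target group: it is used for the points themselves and for the constant 1,
  -- where it shows that the two excesses are opposite.
  have hsplit : ∀ {M : Type} [AddCommGroup M] (Y : Fin n → M),
      G.bdry e.2.1 Y + G.bdry e.2.2 Y = -∑ i ∈ G.balanced, G.bdry i Y := by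
    intro M _ Y
    have h3 : G.verts \ G.balanced = {e.2.1, e.2.2} := by
      ext l
      rw [Finset.mem_sdiff, Finset.mem_insert, Finset.mem_singleton]
      constructor
      · exact fun h => hall l h.1 h.2
      · rintro (rfl | rfl)
        · exact ⟨hs, h1⟩
        · exact ⟨ht, h2⟩
    have h4 := G.sum_bdry Y
    have h5 : G.balanced ⊆ G.verts := Finset.filter_subset _ _
    rw [← Finset.sum_sdiff h5, h3,
      Finset.sum_pair hne] at h4
    exact eq_neg_of_add_eq_zero_left h4
  have hex : G.excess e.2.2 = -G.excess e.2.1 := by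
    have h3 := hsplit fun _ => (1 : ℝ)
    simp only [← excess_eq_bdry] at h3
    have h4 : ∑ i ∈ G.balanced, G.excess i = 0 :=
      Finset.sum_eq_zero fun i hi => (G.mem_balanced (Finset.mem_filter.1 hi).1).1 hi
    linarith
  have hex1 := G.one_le_abs_excess (mt (G.mem_balanced hs).2 h1)
  have hgap : G.gap ℓ e X = -((G.excess e.2.1)⁻¹ • ∑ i ∈ G.balanced, G.bdry i X) := by
    rw [gap, ctr, ctr, if_neg h1, if_neg h2, hex, ← smul_neg, ← hsplit X, inv_neg, neg_smul,
      sub_neg_eq_add, smul_add]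
  rw [hgap, norm_neg, norm_smul, norm_inv, Real.norm_eq_abs]
  calc _ ≤ 1 * ‖∑ i ∈ G.balanced, G.bdry i X‖ := by
        gcongr
        exact inv_le_one_of_one_le₀ hex1
    _ ≤ ∑ i ∈ G.balanced, β := by
        rw [one_mul]
        exact norm_sum_le_of_le _ hX
    _ = G.balanced.card * β := by simp
    _ ≤ _ := by
        gcongr
        exact_mod_cast (Finset.card_le_univ _).trans_eq (Fintype.card_fin k)

section Tree

variable {G} {r : Fin k} {F : Finset (Fin n × Fin k × Fin k)} {π : Fin k → Fin n → ℝ}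

theorem IsTree.flow_ne_zero (h : G.IsTree r G.verts F π) {i : Fin k} (hi : i ∈ G.verts)
    (hir : i ≠ r) : π i ≠ 0 := by
  intro h0
  have h1 := h.bdry_flow i hi i
  rw [h0] at h1
  simp [bdry, hir] at h1

/-- The probability that no balanced center moves far. -/
theorem IsTree.lintegral_bdryInd_le (h : G.IsTree r G.verts F π) (hr : r ∉ G.balanced)
    (a : Fin n → Pt d) {σ : ℝ} (hσ : 0 < σ) {β : ℝ} (hβ : 0 ≤ β) :
    ∫⁻ X, ∏ i ∈ G.balanced, G.bdryInd d β i X ∂perturbedLaw a σ ≤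
      ENNReal.ofReal (β * √n / σ) ^ (d * G.balanced.card) := by
  have hb : ∀ i ∈ G.balanced, i ∈ G.verts ∧ i ≠ r := fun i hi =>
    ⟨(Finset.mem_filter.1 hi).1, fun h' => hr (h' ▸ hi)⟩
  have key := lintegral_mul_prod_le a σ G.balanced π (fun i => G.bdryInd d β i)
    (fun _ _ => ENNReal.ofReal (β * √n / σ) ^ d) (f := fun _ => 1)
    (fun i hi => h.flow_ne_zero (hb i hi).1 (hb i hi).2) (fun i _ => G.measurable_bdryInd β i)
    (fun _ _ => measurable_const)
    -- The flow from `j` to the unbalanced root changes no boundary at another balanced node, so the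
    -- balanced boundaries can be averaged one after the other.
    (fun i hi j hj hij => G.bdryInd_add_shift β (by
      rw [h.bdry_flow j (hb j hj).1, if_neg hij, if_neg (hb i hi).2, sub_self]))
    (fun _ _ _ _ _ _ => rfl)
    (fun i hi X => by
      have hlen := len_pos (h.flow_ne_zero (hb i hi).1 (hb i hi).2)
      have h1 : ∀ y : Pt d, G.bdryInd d β i (X + shift (π i) ((σ / len (π i)) • y)) =
          {y | ‖G.bdry i X + (σ / len (π i)) • y‖ ≤ β}.indicator (fun _ => 1) y := by
        intro y
        simp only [bdryInd, Set.indicator, Set.mem_ofPred_eq, bdry_add_shift,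
          h.bdry_flow i (hb i hi).1, if_neg (hb i hi).2, if_true, sub_zero, one_smul]
      simp_rw [h1]
      rw [lintegral_indicator_const (measurableSet_le (by fun_prop) measurable_const), one_mul]
      refine (stdGaussian_ball_le _ (div_pos hσ hlen) _).trans ?_
      rw [div_div_eq_mul_div]
      have := h.len_flow_le (hb i hi).1
      gcongr)
    measurable_const (fun _ _ _ _ => rfl)
  simp only [one_mul] at key
  refine key.trans (le_of_eq ?_)
  rw [lintegral_const, measure_univ, mul_one, Finset.prod_const, ← pow_mul]

/-- Bounding the product by powers of single weights avoids the joint law of the gaps: afterwards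
only one edge has to be averaged at a time. -/
theorem prod_le_sum_pow {ι : Type*} (R : Finset ι) (hR : R.Nonempty) (w : ι → ℝ≥0∞) :
    ∏ t ∈ R, w t ≤ ∑ t ∈ R, w t ^ R.card := by
  obtain ⟨t, ht, hmax⟩ := Finset.exists_max_image R w hR
  calc _ ≤ w t ^ R.card := Finset.prod_le_pow_card _ _ _ hmax
    _ ≤ _ := Finset.single_le_sum (f := fun t => w t ^ R.card) (fun _ _ => zero_le) ht

/-- The mean of a power of the weight of one edge, on the event that no balanced center moves
far. -/
theorem IsTree.lintegral_bdryInd_mul_weight_pow_le (h : G.IsTree r G.verts F π) (hd : 2 ≤ d)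
    (a : Fin n → Pt d) {σ : ℝ} (hσ : 0 < σ) {β : ℝ} (hβ : 0 ≤ β) (ℓ : Fin k → Pt d)
    {c δ δ' : ℝ} (hc : 0 ≤ c) (hδ : 0 < δ) (hδ' : 0 < δ') (hβδ : k * β < δ) {s : ℕ}
    {K : ℝ≥0∞} (hKb : G.balanced.Nonempty → ENNReal.ofReal (c / δ') ^ (s + 3) ≤ K)
    (hKu : ENNReal.ofReal (c / δ) ^ s * ENNReal.ofReal (32 * c ^ 3 * n ^ 3 / (σ ^ 2 * δ)) ≤ K)
    {e : Fin n × Fin k × Fin k} (he : e ∈ G.edges) :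
    ∫⁻ X, (∏ i ∈ G.balanced, G.bdryInd d β i X) * G.weight ℓ c δ δ' e X ^ (s + 3)
      ∂perturbedLaw a σ ≤
    (∫⁻ X, (∏ i ∈ G.balanced, G.bdryInd d β i X) ∂perturbedLaw a σ) * K := by
  have hmeas : Measurable fun X : Fin n → Pt d => ∏ i ∈ G.balanced, G.bdryInd d β i X :=
    Finset.measurable_fun_prod _ fun i _ => G.measurable_bdryInd β i
  rw [← lintegral_mul_const _ hmeas]
  -- An edge at a balanced cluster has a gap of at least `δ'`, so its weight is bounded pointwise.
  by_cases hb : e.2.1 ∈ G.balanced ∨ e.2.2 ∈ G.balanced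
  · refine lintegral_mono fun X => ?_
    gcongr
    refine le_trans ?_ (hKb ?_)
    · gcongr
      exact G.weight_le_of_balanced ℓ hc δ hδ' hb X
    · exact hb.elim (fun h => ⟨_, h⟩) fun h => ⟨_, h⟩
  push Not at hb
  have hs := G.src_mem e he
  have hne := G.src_ne_tgt e he
  -- If the ends of `e` are the only unbalanced nodes, their approximate centers nearly coincide.
  -- The gap is at most `k * β < δ`, and the weight is zero wherever the boundary indicators are
  -- not.
  by_cases hall : ∀ l ∈ G.verts, l ∉ G.balanced → l = e.2.1 ∨ l = e.2.2
  · refine lintegral_mono fun X => ?_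
    by_cases hX : ∀ i ∈ G.balanced, ‖G.bdry i X‖ ≤ β
    · have h1 := G.norm_gap_le ℓ he hb.1 hb.2 hall hβ hX
      have h2 : G.weight ℓ c δ δ' e X = 0 :=
        Set.indicator_of_notMem (fun h3 => (h1.trans_lt hβδ).not_ge h3.1) _
      simp [h2]
    · push Not at hX
      obtain ⟨i, hi, hiX⟩ := hX
      have h2 : G.bdryInd d β i X = 0 :=
        Set.indicator_of_notMem (s := {X | ‖G.bdry i X‖ ≤ β}) hiX.not_ge _
      rw [Finset.prod_eq_zero hi h2]
      simp
  push Not at hall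
  obtain ⟨l, hl, hlb, hl1, hl2⟩ := hall
  -- With a third unbalanced node `l`, the flow from `e.2.1` to `l` moves the center of `e.2.1` but
  -- neither that of `e.2.2` nor any balanced boundary. Along this direction the gap is Gaussian.
  have hbd : ∀ j, G.bdry j (π e.2.1 - π l) =
      (if j = e.2.1 then 1 else 0) - (if j = l then 1 else 0) := by
    intro j
    rw [bdry_sub, h.bdry_flow _ hs, h.bdry_flow _ hl]
    ring
  have hv : π e.2.1 - π l ≠ 0 := by
    intro h0
    have h1 := hbd e.2.1
    rw [h0] at h1
    simp [bdry, hl1.symm] at h1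
  have hlen := len_pos hv
  have hex0 := mt (G.mem_balanced hs).2 hb.1
  have hex1 := G.one_le_abs_excess hex0
  have hexn := G.abs_excess_le e.2.1
  set v := π e.2.1 - π l with hvdef
  set q := (G.excess e.2.1)⁻¹ * (σ / len v) with hq
  have hgap : ∀ (X : Fin n → Pt d) (y : Pt d),
      G.gap ℓ e (X + shift v ((σ / len v) • y)) = G.gap ℓ e X + q • y := by
    intro X y
    rw [gap, G.ctr_add_shift ℓ hb.1, G.ctr_add_shift ℓ hb.2, hbd, hbd, if_pos rfl,
      if_neg (Ne.symm hl1), if_neg (Ne.symm hne), if_neg (Ne.symm hl2), hq, smul_smul]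
    simp only [gap, sub_zero, mul_one, mul_zero, zero_smul, add_zero]
    abel
  -- The direction has squared length at most `4 * n`, and the squared excess is at most `n ^ 2`.
  have hqsq : σ ^ 2 / (4 * n ^ 3) ≤ q ^ 2 := by
    have h1 : len v ^ 2 ≤ 4 * n := by
      have := h.len_flow_sub_le hs hl
      calc len v ^ 2 ≤ (2 * √n) ^ 2 := by gcongr
        _ = _ := by
          rw [mul_pow, Real.sq_sqrt (Nat.cast_nonneg n)]
          ring
    have h2 : G.excess e.2.1 ^ 2 ≤ n ^ 2 := by
      rw [← sq_abs]
      gcongr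
    have h3 : 0 < G.excess e.2.1 ^ 2 := by positivity
    rw [hq, mul_pow, inv_pow, div_pow, inv_mul_eq_div, div_div]
    refine div_le_div_of_nonneg_left (sq_nonneg σ) (by positivity) ?_
    calc _ ≤ 4 * (n : ℝ) * n ^ 2 := by gcongr
      _ = _ := by ring
  have hnpos : (0 : ℝ) < n := by
    exact_mod_cast Fin.pos e.1
  have hqpos : 0 < q ^ 2 := lt_of_lt_of_le (by positivity) hqsq
  have hstep : ∀ X, ∫⁻ y, G.weight ℓ c δ δ' e (X + shift v ((σ / len v) • y)) ^ (s + 3)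
      ∂stdGaussian (Pt d) ≤ K := by
    intro X
    calc _ ≤ ∫⁻ y, ENNReal.ofReal (c / δ) ^ s *
          {z : Pt d | δ ≤ ‖z‖}.indicator (fun z => ENNReal.ofReal (c / ‖z‖) ^ 3)
            (G.gap ℓ e X + q • y) ∂stdGaussian (Pt d) := by
          refine lintegral_mono fun y => ?_
          -- Three of the `s + 3` factors are kept for the inverse moment; the others are bounded by
          -- `c / δ`.
          rw [pow_add]
          gcongr
          · exact G.weight_le ℓ hc hδ δ' e _
          · rw [weight, hgap]
            by_cases hz : G.gap ℓ e X + q • y ∈ G.farSet d δ δ' e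
            · rw [Set.indicator_of_mem hz, Set.indicator_of_mem (by exact hz.1)]
            · rw [Set.indicator_of_notMem hz]
              simp
      _ = ENNReal.ofReal (c / δ) ^ s * ∫⁻ y,
          {z : Pt d | δ ≤ ‖z‖}.indicator (fun z => ENNReal.ofReal (c / ‖z‖) ^ 3)
            (G.gap ℓ e X + q • y) ∂stdGaussian (Pt d) := by
          refine lintegral_const_mul _ ?_
          refine Measurable.comp (g := {z : Pt d | δ ≤ ‖z‖}.indicator
            fun z => ENNReal.ofReal (c / ‖z‖) ^ 3) ?_ (by fun_prop)
          exact ((measurable_const.div measurable_norm).ennreal_ofReal.pow_const 3).indicator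
            (measurableSet_le measurable_const measurable_norm)
      _ ≤ ENNReal.ofReal (c / δ) ^ s * ENNReal.ofReal (8 * c ^ 3 / (q ^ 2 * δ)) := by
          gcongr
          exact lintegral_inv_norm_cube_le_of_ne hd _ (by rintro h0; simp [h0] at hqpos) hδ hc
      _ ≤ ENNReal.ofReal (c / δ) ^ s * ENNReal.ofReal (32 * c ^ 3 * n ^ 3 / (σ ^ 2 * δ)) := by
          gcongr ENNReal.ofReal (c / δ) ^ s * ENNReal.ofReal ?_
          calc _ ≤ 8 * c ^ 3 / (σ ^ 2 / (4 * n ^ 3) * δ) := by gcongr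
            _ = _ := by field_simp; ring
      _ ≤ K := hKu
  exact lintegral_mul_le_of_direction a σ hv (h := fun _ => K) hmeas
    ((G.measurable_weight ℓ c δ δ' e).pow_const _) measurable_const
    (fun X y => Finset.prod_congr rfl fun i hi => G.bdryInd_add_shift β (by
      have h1 : i ≠ e.2.1 := fun h' => hb.1 (h' ▸ hi)
      have h2 : i ≠ l := fun h' => hlb (h' ▸ hi)
      rw [hbd, if_neg h1, if_neg h2, sub_zero]) X y)
    (fun _ _ => rfl) hstep

/-- The probability that the points are placed as in an iteration of small improvement that follows
a blueprint with an unbalanced node. -/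
theorem measure_isTight_le (hG : G.WeaklyConnected) (hd : 2 ≤ d) (hr : r ∈ G.verts)
    (hrb : r ∉ G.balanced)
    (a : Fin n → Pt d) {σ : ℝ} (hσ : 0 < σ) {β : ℝ} (hβ : 0 ≤ β) (ℓ : Fin k → Pt d)
    {τ c δ δ' : ℝ} (hτ : 0 ≤ τ) (hc : τ * √n / σ ≤ c) (hδ : 0 < δ) (hδ' : 0 < δ')
    (hβδ : k * β < δ) {s T : ℕ} (hT : s + 3 + T + G.verts.card = G.edges.card + 1)
    {K : ℝ≥0∞} (hKb : G.balanced.Nonempty → ENNReal.ofReal (c / δ') ^ (s + 3) ≤ K)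
    (hKu : ENNReal.ofReal (c / δ) ^ s * ENNReal.ofReal (32 * c ^ 3 * n ^ 3 / (σ ^ 2 * δ)) ≤ K) :
    perturbedLaw a σ {X | G.IsTight ℓ τ δ δ' β X} ≤
      ENNReal.ofReal (β * √n / σ) ^ (d * G.balanced.card) * ENNReal.ofReal (c / δ) ^ T *
        ((s + 3 : ℕ) * K) := by
  obtain ⟨F, π, h⟩ := G.exists_isTree hG hr
  have hc0 : 0 ≤ c := le_trans (by positivity) hc
  set R := G.edges \ F with hR
  have hRG : ∀ e ∈ R, e ∈ G.edges := fun e he => (Finset.mem_sdiff.1 he).1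
  have hRcard : R.card = s + 3 + T := by
    have := h.card_sdiff_add
    rw [← hR] at this
    omega
  -- Of the non-tree edges, `s + 3` are reserved for the power of `ε`; the remaining `T` are bounded
  -- crudely.
  obtain ⟨R₀, hR₀, hR₀c⟩ := Finset.exists_subset_card_eq (show s + 3 ≤ R.card by omega)
  have hmeas : Measurable fun X : Fin n → Pt d => ∏ i ∈ G.balanced, G.bdryInd d β i X :=
    Finset.measurable_fun_prod _ fun i _ => G.measurable_bdryInd β i
  have hcyc := fun e he => h.bdry_cycleVec (hRG e he)
  -- Averaging along the fundamental cycles turns all slab indicators into weights. The cycles fix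
  -- all boundaries, hence the weights and the boundary indicators as well.
  have key := lintegral_mul_prod_le a σ R (cycleVec π)
    (fun e => G.slabInd ℓ τ δ δ' e) (fun e => G.weight ℓ c δ δ' e)
    (f := fun X => ∏ i ∈ G.balanced, G.bdryInd d β i X)
    (fun e he h0 => by
      have := h.cycleVec_apply he he
      simp [h0] at this)
    (fun e _ => G.measurable_slabInd ..) (fun e _ => G.measurable_weight ..)
    (fun e he e' he' hne => G.slabInd_add_shift ℓ τ δ δ' (fun i _ => hcyc e' he' i)
      (by rw [h.cycleVec_apply he' he, if_neg hne]))
    (fun e _ e' he' => G.weight_add_shift ℓ c δ δ' fun i _ => hcyc e' he' i)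
    (fun e he => G.lintegral_slabInd_le ℓ hδ hσ (fun i _ => hcyc e he i)
      (by rw [h.cycleVec_apply he he, if_pos rfl]) (by
        refine le_trans ?_ hc
        have := h.len_cycleVec_le he
        calc _ ≤ τ * (2 * √n) / (2 * σ) := by gcongr
          _ = _ := by field_simp))
    hmeas (fun e he X y => Finset.prod_congr rfl fun i _ => G.bdryInd_add_shift β (hcyc e he i) X y)
  calc _ ≤ ∫⁻ X, (∏ i ∈ G.balanced, G.bdryInd d β i X) * ∏ e ∈ R, G.slabInd ℓ τ δ δ' e X
        ∂perturbedLaw a σ := by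
        refine measure_le_lintegral_of_one_le _ (hmeas.mul
          (Finset.measurable_fun_prod _ fun e _ => G.measurable_slabInd ..)) fun X hX => ?_
        exact G.one_le_of_isTight hX hRG
    _ ≤ _ := key
    _ ≤ ∫⁻ X, ENNReal.ofReal (c / δ) ^ T * ∑ t ∈ R₀, (∏ i ∈ G.balanced, G.bdryInd d β i X) *
          G.weight ℓ c δ δ' t X ^ (s + 3) ∂perturbedLaw a σ := by
        refine lintegral_mono fun X => ?_
        dsimp only
        rw [← Finset.mul_sum, ← Finset.prod_sdiff hR₀, mul_left_comm]
        gcongr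
        · refine (Finset.prod_le_pow_card _ _ _ fun e _ => G.weight_le ℓ hc0 hδ δ' e X).trans_eq ?_
          congr 1
          rw [Finset.card_sdiff_of_subset hR₀]
          omega
        · rw [← hR₀c]
          exact prod_le_sum_pow _ (Finset.card_pos.1 (by omega)) _
    _ = ENNReal.ofReal (c / δ) ^ T * ∑ t ∈ R₀, ∫⁻ X, (∏ i ∈ G.balanced, G.bdryInd d β i X) *
          G.weight ℓ c δ δ' t X ^ (s + 3) ∂perturbedLaw a σ := by
        have hm : ∀ t, Measurable fun X : Fin n → Pt d => (∏ i ∈ G.balanced, G.bdryInd d β i X) *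
            G.weight ℓ c δ δ' t X ^ (s + 3) := fun t =>
          hmeas.mul ((G.measurable_weight ℓ c δ δ' t).pow_const _)
        rw [lintegral_const_mul _ (Finset.measurable_fun_sum _ fun t _ => hm t),
          lintegral_finsetSum _ fun t _ => hm t]
    _ ≤ ENNReal.ofReal (c / δ) ^ T * ∑ t ∈ R₀,
          (∫⁻ X, (∏ i ∈ G.balanced, G.bdryInd d β i X) ∂perturbedLaw a σ) * K := by
        gcongr with t ht
        exact h.lintegral_bdryInd_mul_weight_pow_le hd a hσ hβ ℓ hc0 hδ hδ' hβδ hKb hKu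
          (hRG t (hR₀ ht))
    _ ≤ ENNReal.ofReal (c / δ) ^ T * ∑ t ∈ R₀,
          ENNReal.ofReal (β * √n / σ) ^ (d * G.balanced.card) * K := by
        gcongr
        exact h.lintegral_bdryInd_le hrb a hσ hβ
    _ = _ := by
        rw [Finset.sum_const, hR₀c, nsmul_eq_mul]
        ring

end Tree

end TransitionGraph

/-! ### What a small improvement means for points and centers. -/

section Iteration

variable {n k d : ℕ} {X : Fin n → Pt d} {C C' : Fin n → Fin k}

theorem mem_cluster {i : Fin k} {x : Fin n} : x ∈ cluster C i ↔ C x = i := by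
  simp [cluster]

theorem cluster_nonempty {i : Fin k} : (cluster C i).Nonempty ↔ i ∈ active C := by
  simp [Finset.Nonempty, cluster, active]

theorem disjoint_cluster {i j : Fin k} (h : i ≠ j) : Disjoint (cluster C i) (cluster C j) := by
  rw [Finset.disjoint_left]
  intro x hx hx'
  exact h ((mem_cluster.1 hx).symm.trans (mem_cluster.1 hx'))

theorem card_smul_mass (X : Fin n → Pt d) (S : Finset (Fin n)) :
    (S.card : ℝ) • mass X S = ∑ x ∈ S, X x := by
  rcases S.eq_empty_or_nonempty with rfl | h
  · simp
  · have : (S.card : ℝ) ≠ 0 := by exact_mod_cast h.card_pos.ne'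
    rw [mass, smul_inv_smul₀ this]

/-- The parallel axis identity: the mixed term vanishes because deviations from the center of mass
sum to zero. -/
theorem sum_norm_sub_sq (X : Fin n → Pt d) (S : Finset (Fin n)) (p : Pt d) :
    ∑ x ∈ S, ‖X x - p‖ ^ 2 =
      ∑ x ∈ S, ‖X x - mass X S‖ ^ 2 + S.card * ‖p - mass X S‖ ^ 2 := by
  have h0 : ∑ x ∈ S, (X x - mass X S) = 0 := by
    rw [Finset.sum_sub_distrib, Finset.sum_const, ← Nat.cast_smul_eq_nsmul ℝ, card_smul_mass,
      sub_self]
  have h : ∀ x ∈ S, ‖X x - p‖ ^ 2 = ‖X x - mass X S‖ ^ 2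
      - 2 * inner ℝ (X x - mass X S) (p - mass X S) + ‖p - mass X S‖ ^ 2 := by
    intro x _
    rw [show X x - p = (X x - mass X S) - (p - mass X S) by abel, norm_sub_sq_real]
  rw [Finset.sum_congr rfl h, Finset.sum_add_distrib, Finset.sum_sub_distrib, ← Finset.mul_sum,
    ← sum_inner, h0, inner_zero_left, Finset.sum_const, nsmul_eq_mul]
  ring

theorem sum_cluster (C : Fin n → Fin k) (f : Fin n → ℝ) :
    ∑ i, ∑ x ∈ cluster C i, f x = ∑ x, f x :=
  Finset.sum_fiberwise _ _ _

/-- The improvement splits into the gains of the data points and those of the centers. -/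
theorem improvement_eq (X : Fin n → Pt d) (C C' : Fin n → Fin k) :
    improvement X C C' =
      ∑ x, (‖X x - centers X C (C x)‖ ^ 2 - ‖X x - centers X C (C' x)‖ ^ 2) +
        ∑ i, (cluster C' i).card * ‖centers X C i - centers X C' i‖ ^ 2 := by
  have h : ∑ x, ‖X x - centers X C (C' x)‖ ^ 2 = potential X (centers X C') C' +
      ∑ i, (cluster C' i).card * ‖centers X C i - centers X C' i‖ ^ 2 := by
    rw [potential, ← sum_cluster C', ← sum_cluster C', ← Finset.sum_add_distrib]
    refine Finset.sum_congr rfl fun i _ => ?_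
    have h1 : ∀ c : Fin k → Pt d, ∑ x ∈ cluster C' i, ‖X x - c (C' x)‖ ^ 2 =
        ∑ x ∈ cluster C' i, ‖X x - c i‖ ^ 2 := fun c =>
      Finset.sum_congr rfl fun x hx => by rw [mem_cluster.1 hx]
    rw [h1, h1, sum_norm_sub_sq]
    rfl
  rw [Finset.sum_sub_distrib, h, improvement, potential, potential]
  ring

theorem IsIteration.gain_nonneg (h : IsIteration X C C') (x : Fin n) :
    0 ≤ ‖X x - centers X C (C x)‖ ^ 2 - ‖X x - centers X C (C' x)‖ ^ 2 := by
  have := (h x).2 (C x) (Finset.mem_image_of_mem C (Finset.mem_univ x))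
  have h2 := pow_le_pow_left₀ (norm_nonneg _) this 2
  linarith

theorem IsIteration.gain_le (h : IsIteration X C C') {ε : ℝ} (hε : improvement X C C' ≤ ε)
    (x : Fin n) : ‖X x - centers X C (C x)‖ ^ 2 - ‖X x - centers X C (C' x)‖ ^ 2 ≤ ε := by
  refine le_trans ?_ hε
  rw [improvement_eq]
  refine le_trans (Finset.single_le_sum (f := fun x => ‖X x - centers X C (C x)‖ ^ 2 -
    ‖X x - centers X C (C' x)‖ ^ 2) (fun x _ => h.gain_nonneg x) (Finset.mem_univ x)) ?_
  exact le_add_of_nonneg_right (Finset.sum_nonneg fun i _ => by positivity)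

theorem IsIteration.card_mul_le (h : IsIteration X C C') {ε : ℝ} (hε : improvement X C C' ≤ ε)
    (i : Fin k) : (cluster C' i).card * ‖centers X C i - centers X C' i‖ ^ 2 ≤ ε := by
  refine le_trans ?_ hε
  rw [improvement_eq]
  refine le_trans (Finset.single_le_sum (f := fun i => ((cluster C' i).card : ℝ) *
    ‖centers X C i - centers X C' i‖ ^ 2) (fun x _ => by positivity) (Finset.mem_univ i)) ?_
  exact le_add_of_nonneg_left (Finset.sum_nonneg fun x _ => h.gain_nonneg x)

namespace TransitionGraph

variable {G : TransitionGraph n k} {h : ∀ x, C' x ∈ active C}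

theorem IsComponent.mem_edges (hG : G.IsComponent (ofIteration C C' h)) {e : Fin n × Fin k × Fin k}
    (he : e ∈ G.edges) : C e.1 = e.2.1 ∧ C' e.1 = e.2.2 := by
  rw [hG.2.2, Finset.mem_filter] at he
  obtain ⟨x, -, rfl⟩ := Finset.mem_image.1 he.1
  exact ⟨rfl, rfl⟩

theorem IsComponent.sum_outEdges {M : Type*} [AddCommGroup M]
    (hG : G.IsComponent (ofIteration C C' h)) {i : Fin k} (hi : i ∈ G.verts) (X : Fin n → M) :
    ∑ e ∈ G.outEdges i, X e.1 = ∑ x with C x = i ∧ C' x ≠ i, X x := by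
  refine Finset.sum_nbij' (fun e => e.1) (fun x => (x, C x, C' x)) ?_ ?_ ?_ ?_ ?_
  · intro e he
    rw [outEdges, Finset.mem_filter] at he
    have h1 := hG.mem_edges he.1
    have h2 := G.src_ne_tgt e he.1
    simp only [Finset.mem_filter, Finset.mem_univ, true_and]
    rw [h1.1, h1.2, ← he.2]
    exact ⟨rfl, h2.symm⟩
  · intro x hx
    simp only [Finset.mem_filter, Finset.mem_univ, true_and] at hx
    rw [outEdges, Finset.mem_filter, hG.2.2, Finset.mem_filter]
    refine ⟨⟨Finset.mem_image.2 ⟨x, by simp [hx.1, hx.2.symm], rfl⟩, Or.inl ?_⟩, hx.1⟩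
    simpa [hx.1] using hi
  · intro e he
    have h1 := hG.mem_edges (Finset.mem_filter.1 he).1
    simp only [h1.1, h1.2]
  · intro x _
    rfl
  · intro e _
    rfl

theorem IsComponent.sum_inEdges {M : Type*} [AddCommGroup M]
    (hG : G.IsComponent (ofIteration C C' h)) {i : Fin k} (hi : i ∈ G.verts) (X : Fin n → M) :
    ∑ e ∈ G.inEdges i, X e.1 = ∑ x with C' x = i ∧ C x ≠ i, X x := by
  refine Finset.sum_nbij' (fun e => e.1) (fun x => (x, C x, C' x)) ?_ ?_ ?_ ?_ ?_
  · intro e he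
    rw [inEdges, Finset.mem_filter] at he
    have h1 := hG.mem_edges he.1
    have h2 := G.src_ne_tgt e he.1
    simp only [Finset.mem_filter, Finset.mem_univ, true_and]
    rw [h1.1, h1.2, ← he.2]
    exact ⟨rfl, h2⟩
  · intro x hx
    simp only [Finset.mem_filter, Finset.mem_univ, true_and] at hx
    rw [inEdges, Finset.mem_filter, hG.2.2, Finset.mem_filter]
    refine ⟨⟨Finset.mem_image.2 ⟨x, by simp [hx.1, hx.2], rfl⟩, Or.inr ?_⟩, hx.1⟩
    simpa [hx.1] using hi
  · intro e he
    have h1 := hG.mem_edges (Finset.mem_filter.1 he).1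
    simp only [h1.1, h1.2]
  · intro x _
    rfl
  · intro e _
    rfl

/-- The flow out of a cluster is the difference of its sums before and after the iteration. -/
theorem IsComponent.bdry_eq {M : Type*} [AddCommGroup M]
    (hG : G.IsComponent (ofIteration C C' h)) {i : Fin k} (hi : i ∈ G.verts) (X : Fin n → M) :
    G.bdry i X = ∑ x ∈ cluster C i, X x - ∑ x ∈ cluster C' i, X x := by
  have key : ∀ A B : Fin n → Fin k, ∑ x ∈ cluster A i, X x =
      ∑ x with A x = i ∧ B x ≠ i, X x + ∑ x with A x = i ∧ B x = i, X x := by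
    intro A B
    rw [cluster, ← Finset.sum_filter_add_sum_filter_not _ (fun x => B x ≠ i), Finset.filter_filter,
      Finset.filter_filter]
    simp only [not_not]
  rw [bdry, hG.sum_outEdges hi, hG.sum_inEdges hi, key C C', key C' C]
  have : ∑ x with C' x = i ∧ C x = i, X x = ∑ x with C x = i ∧ C' x = i, X x := by
    simp only [and_comm]
  rw [this]
  abel

theorem IsComponent.excess_eq (hG : G.IsComponent (ofIteration C C' h)) {i : Fin k}
    (hi : i ∈ G.verts) :
    G.excess i = (cluster C i).card - (cluster C' i).card := by
  rw [excess_eq_bdry, hG.bdry_eq hi]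
  simp

/-- This exact identity is the source of approximate centers: if the center hardly moves, the
boundary is close to excess times center. -/
theorem IsComponent.card_smul_sub (hG : G.IsComponent (ofIteration C C' h)) {i : Fin k}
    (hi : i ∈ G.verts) (X : Fin n → Pt d) :
    ((cluster C' i).card : ℝ) • (centers X C' i - centers X C i) =
      G.excess i • centers X C i - G.bdry i X := by
  rw [hG.bdry_eq hi, hG.excess_eq hi, smul_sub, sub_smul, centers, centers, card_smul_mass,
    card_smul_mass]
  abel

/-- The improvement bounds size · (movement)²; one more factor size ≤ n turns this into a bound for
(size · movement)². -/
theorem IsComponent.norm_le (hG : G.IsComponent (ofIteration C C' h)) {i : Fin k}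
    (hi : i ∈ G.verts) (hit : IsIteration X C C') {ε : ℝ} (hε : improvement X C C' ≤ ε) :
    ‖G.excess i • centers X C i - G.bdry i X‖ ≤ √(n * ε) := by
  rw [← hG.card_smul_sub hi, norm_smul, Real.norm_natCast, norm_sub_rev]
  refine Real.le_sqrt_of_sq_le ?_
  have h1 := hit.card_mul_le hε i
  have h2 : ((cluster C' i).card : ℝ) ≤ n := by
    exact_mod_cast (Finset.card_le_univ _).trans (by simp)
  calc (((cluster C' i).card : ℝ) * ‖centers X C i - centers X C' i‖) ^ 2 =
      (cluster C' i).card * ((cluster C' i).card * ‖centers X C i - centers X C' i‖ ^ 2) := by ring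
    _ ≤ n * ε := by gcongr

theorem IsComponent.norm_bdry_le (hG : G.IsComponent (ofIteration C C' h)) {i : Fin k}
    (hi : i ∈ G.balanced) (hit : IsIteration X C C') {ε : ℝ} (hε : improvement X C C' ≤ ε) :
    ‖G.bdry i X‖ ≤ √(n * ε) := by
  have hv := (Finset.mem_filter.1 hi).1
  have := hG.norm_le hv hit hε
  rwa [(G.mem_balanced hv).1 hi, zero_smul, zero_sub, norm_neg] at this

/-- Dividing by a nonzero excess does not increase the error, since the excess is an integer. -/
theorem IsComponent.norm_ctr_sub_le (hG : G.IsComponent (ofIteration C C' h)) {i : Fin k}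
    (hi : i ∈ G.verts) (hit : IsIteration X C C') {ε : ℝ} (hε : improvement X C C' ≤ ε)
    {ℓ : Fin k → Pt d} (hℓ : i ∈ G.balanced → ‖ℓ i - centers X C i‖ ≤ √(n * ε)) :
    ‖G.ctr ℓ i X - centers X C i‖ ≤ √(n * ε) := by
  unfold ctr
  split_ifs with hb
  · exact hℓ hb
  · have h0 : G.excess i ≠ 0 := fun h0 => hb ((G.mem_balanced hi).2 h0)
    have h1 := hG.norm_le hi hit hε
    have h2 := G.one_le_abs_excess h0
    rw [show (G.excess i)⁻¹ • G.bdry i X - centers X C i =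
      -((G.excess i)⁻¹ • (G.excess i • centers X C i - G.bdry i X)) by
        rw [smul_sub, inv_smul_smul₀ h0]; abel, norm_neg, norm_smul, norm_inv, Real.norm_eq_abs]
    calc |G.excess i|⁻¹ * ‖G.excess i • centers X C i - G.bdry i X‖
        ≤ 1 * √(n * ε) := by
          gcongr
          exact inv_le_one_of_one_le₀ h2
      _ = _ := one_mul _

end TransitionGraph

end Iteration

/-! ### Centers are far apart for points in general position. -/

section Separation

variable {n k d : ℕ} {X : Fin n → Pt d} {C C' : Fin n → Fin k}

/-- The point sets of which `q` points are within distance `η` of a common hyperplane. -/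
def nearHyperplane (n d q : ℕ) (η : ℝ) : Set (Fin n → Pt d) :=
  {X | ∃ (S : Finset (Fin n)) (u : Pt d) (b : ℝ), q ≤ S.card ∧ ‖u‖ = 1 ∧
    ∀ x ∈ S, |inner ℝ u (X x) - b| ≤ η}

/-- The point sets with two disjoint subsets of at most `q` points altogether whose centers of mass
have distance at most `δ`. -/
def closeMasses (n d q : ℕ) (δ : ℝ) : Set (Fin n → Pt d) :=
  {X | ∃ S S' : Finset (Fin n), S.Nonempty ∧ S'.Nonempty ∧ Disjoint S S' ∧ S.card + S'.card ≤ q ∧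
    ‖mass X S - mass X S'‖ ≤ δ}

theorem card_add_card_le {S S' : Finset (Fin n)} (h : Disjoint S S') : S.card + S'.card ≤ n := by
  rw [← Finset.card_union_of_disjoint h]
  exact (Finset.card_le_univ _).trans (by simp)

theorem centers_injOn (h0 : X ∉ closeMasses n d n 0) {i j : Fin k} (hi : i ∈ active C)
    (hj : j ∈ active C) (hij : i ≠ j) : centers X C i ≠ centers X C j := by
  intro h
  refine h0 ⟨_, _, cluster_nonempty.2 hi, cluster_nonempty.2 hj, disjoint_cluster hij,
    card_add_card_le (disjoint_cluster hij), ?_⟩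
  have h' : mass X (cluster C i) = mass X (cluster C j) := h
  rw [h', sub_self, norm_zero]

/-- The centers that produced `C`, not those of `C` itself, have bisectors that separate its
clusters. They are distinct initially by assumption, and later because distinct active clusters have
distinct centers of mass outside of the null event `closeMasses n d n 0`. -/
theorem Occurs.exists_centers (hC : Occurs X C) (h0 : X ∉ closeMasses n d n 0) :
    ∃ c : Fin k → Pt d, ∀ i ∈ active C, ∀ j ∈ active C, i ≠ j →
      c i ≠ c j ∧ ∀ x ∈ cluster C i, ‖X x - c i‖ ≤ ‖X x - c j‖ := by
  cases hC with
  | first c hc C h =>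
    refine ⟨c, fun i _ j _ hij => ⟨hc.ne hij, fun x hx => ?_⟩⟩
    rw [← mem_cluster.1 hx]
    exact (h x).2 j (Finset.mem_univ j)
  | next B C hB h =>
    have hsub : ∀ i ∈ active C, i ∈ active B := by
      intro i hi
      obtain ⟨x, -, rfl⟩ := Finset.mem_image.1 hi
      exact (h x).1
    refine ⟨centers X B, fun i hi j hj hij => ⟨centers_injOn h0 (hsub i hi) (hsub j hj) hij, ?_⟩⟩
    intro x hx
    rw [← mem_cluster.1 hx]
    exact (h x).2 j (hsub j hj)

theorem inner_mass (X : Fin n → Pt d) (S : Finset (Fin n)) (u : Pt d) (b : ℝ) :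
    ∑ x ∈ S, (inner ℝ u (X x) - b) = S.card * (inner ℝ u (mass X S) - b) := by
  rw [Finset.sum_sub_distrib, ← inner_sum, ← card_smul_mass, inner_smul_right, Finset.sum_const,
    nsmul_eq_mul]
  ring

/-- Points on one side of a hyperplane are close to it if their center of mass is. -/
theorem abs_inner_sub_le {S : Finset (Fin n)} {u : Pt d} {b t : ℝ}
    (h : ∀ x ∈ S, 0 ≤ inner ℝ u (X x) - b) (ht : inner ℝ u (mass X S) - b ≤ t) {x : Fin n}
    (hx : x ∈ S) : |inner ℝ u (X x) - b| ≤ n * t := by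
  rw [abs_of_nonneg (h x hx)]
  have hS : S.Nonempty := ⟨x, hx⟩
  have h1 : 0 ≤ (S.card : ℝ) * (inner ℝ u (mass X S) - b) := by
    rw [← inner_mass X S u b]
    exact Finset.sum_nonneg h
  have h2 : 0 ≤ inner ℝ u (mass X S) - b :=
    nonneg_of_mul_nonneg_right h1 (by exact_mod_cast hS.card_pos)
  have h3 : (S.card : ℝ) ≤ n := by exact_mod_cast (Finset.card_le_univ _).trans (by simp)
  calc inner ℝ u (X x) - b ≤ ∑ x ∈ S, (inner ℝ u (X x) - b) :=
        Finset.single_le_sum (f := fun x => inner ℝ u (X x) - b) h hx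
    _ = S.card * (inner ℝ u (mass X S) - b) := inner_mass X S u b
    _ ≤ n * t := by gcongr

/-- The points of two clusters are close to a common hyperplane if their centers are close to each
other. -/
theorem Occurs.exists_hyperplane (hC : Occurs X C) (h0 : X ∉ closeMasses n d n 0) {i j : Fin k}
    (hi : i ∈ active C) (hj : j ∈ active C) (hij : i ≠ j) :
    ∃ (u : Pt d) (b : ℝ), ‖u‖ = 1 ∧ ∀ x ∈ cluster C i ∪ cluster C j,
      |inner ℝ u (X x) - b| ≤ n * ‖centers X C i - centers X C j‖ := by
  obtain ⟨c, hc⟩ := hC.exists_centers h0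
  obtain ⟨hne, h1⟩ := hc i hi j hj hij
  obtain ⟨-, h2⟩ := hc j hj i hi hij.symm
  have hw : 0 < ‖c i - c j‖ := norm_sub_pos_iff.2 hne
  set w := c i - c j with hwdef
  set u : Pt d := ‖w‖⁻¹ • w with hu
  set b : ℝ := inner ℝ u (c j) + ‖w‖ / 2 with hb
  have hu1 : ‖u‖ = 1 := by
    rw [hu, norm_smul, norm_inv, norm_norm, inv_mul_cancel₀ hw.ne']
  -- The signed distance from the bisector of `c i` and `c j`, expressed by squared distances from
  -- these two points.
  have key : ∀ p : Pt d, inner ℝ u p - b = (‖p - c j‖ ^ 2 - ‖p - c i‖ ^ 2) / (2 * ‖w‖) := by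
    intro p
    have e1 : ‖p - c i‖ ^ 2 = ‖p - c j‖ ^ 2 - 2 * inner ℝ (p - c j) w + ‖w‖ ^ 2 := by
      rw [show p - c i = (p - c j) - w by rw [hwdef]; abel, norm_sub_sq_real]
    rw [e1, hb, hu, inner_smul_left, inner_smul_left, real_inner_comm w (p - c j),
      inner_sub_right]
    simp only [map_inv₀, conj_trivial]
    field_simp
    ring
  have hpos : ∀ x ∈ cluster C i, 0 ≤ inner ℝ u (X x) - b := by
    intro x hx
    rw [key]
    have := pow_le_pow_left₀ (norm_nonneg _) (h1 x hx) 2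
    have h3 : 0 ≤ ‖X x - c j‖ ^ 2 - ‖X x - c i‖ ^ 2 := by linarith
    positivity
  have hneg : ∀ x ∈ cluster C j, 0 ≤ inner ℝ (-u) (X x) - -b := by
    intro x hx
    rw [inner_neg_left]
    have h4 := key (X x)
    have := pow_le_pow_left₀ (norm_nonneg _) (h2 x hx) 2
    have h3 : 0 ≤ (‖X x - c i‖ ^ 2 - ‖X x - c j‖ ^ 2) / (2 * ‖w‖) := by
      have : 0 ≤ ‖X x - c i‖ ^ 2 - ‖X x - c j‖ ^ 2 := by linarith
      positivity
    rw [show -inner ℝ u (X x) - -b = -(inner ℝ u (X x) - b) by ring, h4, ← neg_div, neg_sub]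
    exact h3
  have hmi : 0 ≤ inner ℝ u (centers X C i) - b := by
    have h3 := Finset.sum_nonneg hpos
    rw [inner_mass] at h3
    exact nonneg_of_mul_nonneg_right h3 (by exact_mod_cast (cluster_nonempty.2 hi).card_pos)
  have hmj : 0 ≤ inner ℝ (-u) (centers X C j) - -b := by
    have h3 := Finset.sum_nonneg hneg
    rw [inner_mass] at h3
    exact nonneg_of_mul_nonneg_right h3 (by exact_mod_cast (cluster_nonempty.2 hj).card_pos)
  -- The two centers of mass lie on opposite sides of the bisector, so each is no farther from it
  -- than they are from each other. Points on one side with small mean distance are individually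
  -- close, at the price of a factor `n`.
  have hdiff : inner ℝ u (centers X C i) - inner ℝ u (centers X C j) ≤
      ‖centers X C i - centers X C j‖ := by
    rw [← inner_sub_right]
    refine (real_inner_le_norm _ _).trans ?_
    rw [hu1, one_mul]
  rw [inner_neg_left] at hmj
  refine ⟨u, b, hu1, fun x hx => ?_⟩
  rcases Finset.mem_union.1 hx with hx | hx
  · exact abs_inner_sub_le hpos (by change inner ℝ u (centers X C i) - b ≤ _; linarith) hx
  · have := abs_inner_sub_le (t := ‖centers X C i - centers X C j‖) hneg
      (by change inner ℝ (-u) (centers X C j) - -b ≤ _; rw [inner_neg_left]; linarith) hx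
    rwa [inner_neg_left, ← neg_sub', abs_neg] at this

/-- Centers are not close to each other if the point set is in general position. -/
theorem Occurs.lt_norm_sub (hC : Occurs X C) (h0 : X ∉ closeMasses n d n 0) {i j : Fin k}
    (hi : i ∈ active C) (hj : j ∈ active C) (hij : i ≠ j) {q : ℕ} {δ : ℝ}
    (hq : q ≤ (cluster C i).card + (cluster C j).card) (hX : X ∉ nearHyperplane n d q (n * δ)) :
    δ < ‖centers X C i - centers X C j‖ := by
  by_contra hle
  rw [not_lt] at hle
  obtain ⟨u, b, hu, h⟩ := hC.exists_hyperplane h0 hi hj hij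
  refine hX ⟨_, u, b, ?_, hu, fun x hx => (h x hx).trans (by gcongr)⟩
  rwa [Finset.card_union_of_disjoint (disjoint_cluster hij)]

/-- Two clusters with at most `q` points together fall under `closeMasses`; larger ones would put `q
+ 1` points near a hyperplane. -/
theorem Occurs.lt_norm_sub_of_notMem (hC : Occurs X C) (h0 : X ∉ closeMasses n d n 0) {i j : Fin k}
    (hi : i ∈ active C) (hj : j ∈ active C) (hij : i ≠ j) {q : ℕ} {δ : ℝ}
    (h1 : X ∉ closeMasses n d q δ) (hX : X ∉ nearHyperplane n d (q + 1) (n * δ)) :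
    δ < ‖centers X C i - centers X C j‖ := by
  by_cases hq : (cluster C i).card + (cluster C j).card ≤ q
  · by_contra hle
    rw [not_lt] at hle
    exact h1 ⟨_, _, cluster_nonempty.2 hi, cluster_nonempty.2 hj, disjoint_cluster hij, hq, hle⟩
  · exact hC.lt_norm_sub h0 hi hj hij (by omega) hX

end Separation

/-! ### Finite grids covering a cube. -/

section Cube

variable {n k d : ℕ}

/-- The points with coordinates `r z j`. -/
noncomputable def gridPt (r : ℝ) (z : Fin d → ℤ) : Pt d := WithLp.toLp 2 fun j => r * z j

/-- A grid of spacing `r` that covers the cube of side length `D`. -/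
noncomputable def grid (d : ℕ) (D r : ℝ) : Finset (Pt d) :=
  (Fintype.piFinset fun _ : Fin d => Finset.Icc (-⌈D / r⌉) ⌈D / r⌉).image (gridPt r)

theorem norm_le_of_abs_le {p : Pt d} {t : ℝ} (ht : 0 ≤ t) (h : ∀ j, |p j| ≤ t) : ‖p‖ ≤ √d * t := by
  rw [EuclideanSpace.norm_eq, Real.sqrt_le_left (by positivity), mul_pow,
    Real.sq_sqrt (Nat.cast_nonneg d)]
  calc ∑ j, ‖p j‖ ^ 2 ≤ ∑ _j : Fin d, t ^ 2 := by
        gcongr with j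
        exact h j
    _ = d * t ^ 2 := by simp

theorem card_Icc_ceil_le {D r : ℝ} (hr : 0 < r) (hD : r ≤ D) :
    ((Finset.Icc (-⌈D / r⌉) ⌈D / r⌉).card : ℝ) ≤ 5 * D / r := by
  have h2 : 1 ≤ D / r := (one_le_div hr).2 hD
  have h4 : 0 ≤ ⌈D / r⌉ + 1 - -⌈D / r⌉ := by
    have : 0 ≤ ⌈D / r⌉ := Int.ceil_nonneg (by linarith)
    omega
  have h5 := Int.ceil_lt_add_one (D / r)
  rw [Int.card_Icc, ← Int.cast_natCast (R := ℝ), Int.toNat_of_nonneg h4, mul_div_assoc]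
  push_cast
  linarith

theorem card_grid_le {D r : ℝ} (hr : 0 < r) (hD : r ≤ D) :
    ((grid d D r).card : ℝ) ≤ (5 * D / r) ^ d := by
  have h1 : (grid d D r).card ≤ (Finset.Icc (-⌈D / r⌉) ⌈D / r⌉).card ^ d := by
    refine Finset.card_image_le.trans ?_
    simp
  calc ((grid d D r).card : ℝ) ≤ ((Finset.Icc (-⌈D / r⌉) ⌈D / r⌉).card : ℝ) ^ d := by
        exact_mod_cast h1
    _ ≤ _ := by
        gcongr
        exact card_Icc_ceil_le hr hD

theorem exists_grid {D r : ℝ} (hr : 0 < r) (p : Pt d) (hp : ∀ j, |p j| ≤ D) :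
    ∃ q ∈ grid d D r, ∀ j, |q j - p j| ≤ r := by
  refine ⟨gridPt r fun j => ⌊p j / r⌋, Finset.mem_image_of_mem _ ?_, fun j => ?_⟩
  · rw [Fintype.mem_piFinset]
    intro j
    have h1 := abs_le.1 (hp j)
    rw [Finset.mem_Icc]
    constructor
    · rw [Int.le_floor]
      push_cast
      have h2 := Int.le_ceil (D / r)
      have h3 : -(D / r) ≤ p j / r := by
        rw [← neg_div]
        gcongr
        exact h1.1
      linarith
    · refine (Int.floor_le_ceil _).trans (Int.ceil_le_ceil ?_)
      gcongr
      exact h1.2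
  · change |r * (⌊p j / r⌋ : ℝ) - p j| ≤ r
    have h1 := Int.floor_le (p j / r)
    have h2 := Int.lt_floor_add_one (p j / r)
    rw [le_div_iff₀ hr] at h1
    rw [div_lt_iff₀ hr] at h2
    rw [abs_le]
    constructor <;> nlinarith

theorem abs_mass_le {X : Fin n → Pt d} {t : ℝ} (hX : ∀ x j, |X x j| ≤ t) {S : Finset (Fin n)}
    (hS : S.Nonempty) (j : Fin d) : |mass X S j| ≤ t := by
  have hc : (0 : ℝ) < S.card := by exact_mod_cast hS.card_pos
  have h1 : mass X S j = (S.card : ℝ)⁻¹ * ∑ x ∈ S, X x j := by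
    simp [mass]
  rw [h1, abs_mul, abs_of_nonneg (inv_nonneg.2 hc.le), inv_mul_le_iff₀ hc]
  calc |∑ x ∈ S, X x j| ≤ ∑ x ∈ S, |X x j| := Finset.abs_sum_le_sum_abs _ _
    _ ≤ ∑ _x ∈ S, t := Finset.sum_le_sum fun x _ => hX x j
    _ = _ := by simp

end Cube

/-! ### Slow iterations on points in general position are tight. -/

section Tight

variable {n k d : ℕ} {X : Fin n → Pt d} {C C' : Fin n → Fin k} {G : TransitionGraph n k}
  {h : ∀ x, C' x ∈ active C}

theorem abs_sq_sub_sq_le {x p c : Pt d} {s t : ℝ} (h1 : ‖p - c‖ ≤ s) (h2 : ‖x - c‖ ≤ t) :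
    |‖x - p‖ ^ 2 - ‖x - c‖ ^ 2| ≤ s * (s + 2 * t) := by
  have h3 : |‖x - p‖ - ‖x - c‖| ≤ s := by
    refine (abs_norm_sub_norm_le _ _).trans ?_
    rwa [show x - p - (x - c) = -(p - c) by abel, norm_neg]
  have h4 : ‖x - p‖ + ‖x - c‖ ≤ s + 2 * t := by
    have := (abs_le.1 h3).2
    linarith
  rw [show ‖x - p‖ ^ 2 - ‖x - c‖ ^ 2 = (‖x - p‖ - ‖x - c‖) * (‖x - p‖ + ‖x - c‖) by ring, abs_mul,
    abs_of_nonneg (a := ‖x - p‖ + ‖x - c‖) (by positivity)]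
  gcongr
  exact (abs_nonneg _).trans h3

/-- An iteration of small improvement on a point set in general position makes its transition graph
tight, for some choice of grid points for the balanced clusters. -/
theorem TransitionGraph.IsComponent.exists_isTight (hG : G.IsComponent (.ofIteration C C' h))
    (hgen : G.IsGeneralGraph d) (hX : ∀ x, X x ∈ cube n k d) (hC : Occurs X C)
    (hit : IsIteration X C C') {ε δ δ' : ℝ} (hε : 0 < ε) (hε1 : ε ≤ 1)
    (hi : improvement X C C' ≤ ε) (hD : 1 ≤ sideLength n k d) (hdn : d ≤ n) (hn : 1 ≤ n)
    (hδ : 4 * √(n * ε) ≤ δ) (hδ' : 4 * √(n * ε) ≤ δ')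
    (h0 : X ∉ closeMasses n d n 0) (h1 : X ∉ closeMasses n d (4 * d) δ)
    (h2 : X ∉ nearHyperplane n d (4 * d + 1) (n * δ))
    (h3 : X ∉ nearHyperplane n d (8 * d + 1) (n * δ')) :
    ∃ ℓ : Fin k → Pt d, (∀ i ∈ G.balanced, ℓ i ∈ grid d (sideLength n k d) √ε) ∧
      (∀ i ∉ G.balanced, ℓ i = 0) ∧
      G.IsTight ℓ (7 * n * sideLength n k d * √ε) (δ / 2) (δ' / 2) √(n * ε) X := by
  set D := sideLength n k d
  have hr : 0 < √ε := Real.sqrt_pos.2 hε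
  have hr1 : √ε ≤ 1 := Real.sqrt_le_one.2 hε1
  have hn1 : (1 : ℝ) ≤ n := by exact_mod_cast hn
  have hdn' : √(d : ℝ) ≤ √n := Real.sqrt_le_sqrt (by exact_mod_cast hdn)
  have hact : ∀ i ∈ G.verts, i ∈ active C := fun i hi => hG.2.1 hi
  have hcube : ∀ i ∈ G.verts, ∀ j, |centers X C i j| ≤ D / 2 := fun i hi j =>
    abs_mass_le (fun x j => hX x j) (cluster_nonempty.2 (hact i hi)) j
  have hex : ∀ i, ∃ q : Pt d, i ∈ G.verts → q ∈ grid d D √ε ∧ ∀ j, |q j - centers X C i j| ≤ √ε := by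
    intro i
    by_cases hi : i ∈ G.verts
    · obtain ⟨q, hq⟩ := exists_grid (D := D) hr (centers X C i) fun j =>
        (hcube i hi j).trans (by linarith)
      exact ⟨q, fun _ => hq⟩
    · exact ⟨0, fun h => absurd h hi⟩
  choose q hq hq' using hex
  have hbv : ∀ i ∈ G.balanced, i ∈ G.verts := fun i hi => (Finset.mem_filter.1 hi).1
  set ℓ : Fin k → Pt d := fun i => if i ∈ G.balanced then q i else 0 with hℓdef
  have hℓ : ∀ i ∈ G.balanced, ‖ℓ i - centers X C i‖ ≤ √(n * ε) := by
    intro i hb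
    have := norm_le_of_abs_le hr.le (p := q i - centers X C i) fun j => hq' i (hbv i hb) j
    rw [hℓdef]
    simp only [hb, if_true]
    rw [Real.sqrt_mul (Nat.cast_nonneg n)]
    exact this.trans (by gcongr)
  have hctr : ∀ i ∈ G.verts, ‖G.ctr ℓ i X - centers X C i‖ ≤ √(n * ε) := fun i hv =>
    hG.norm_ctr_sub_le hv hit hi (hℓ i)
  -- Each approximate center is off by at most `√(n * ε) ≤ t / 4`, so half of the distance survives.
  have hfar : ∀ e ∈ G.edges, ∀ t : ℝ, 4 * √(n * ε) ≤ t →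
      t < ‖centers X C e.2.1 - centers X C e.2.2‖ → t / 2 ≤ ‖G.gap ℓ e X‖ := by
    intro e he t ht hlt
    have e1 := hctr _ (G.src_mem e he)
    have e2 := hctr _ (G.tgt_mem e he)
    have e3 : ‖centers X C e.2.1 - centers X C e.2.2‖ ≤ ‖G.gap ℓ e X‖ +
        ‖G.ctr ℓ e.2.2 X - centers X C e.2.2‖ + ‖G.ctr ℓ e.2.1 X - centers X C e.2.1‖ := by
      rw [show centers X C e.2.1 - centers X C e.2.2 = G.gap ℓ e X +
        (G.ctr ℓ e.2.2 X - centers X C e.2.2) - (G.ctr ℓ e.2.1 X - centers X C e.2.1) by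
          rw [TransitionGraph.gap]; abel]
      exact (norm_sub_le _ _).trans (by gcongr; exact norm_add_le _ _)
    linarith
  refine ⟨ℓ, fun i hb => ?_, fun i hb => ?_, ⟨fun e he => ?_, fun e he => ⟨?_, fun hb => ?_⟩, ?_⟩⟩
  · simp only [hℓdef, hb, if_true]
    exact hq i (hbv i hb)
  · simp only [hℓdef, hb, if_false]
  · have hdist : ∀ i ∈ G.verts, ‖X e.1 - centers X C i‖ ≤ √n * D := by
      intro i hv
      have := norm_le_of_abs_le (p := X e.1 - centers X C i) (t := D) (by positivity) fun j => by
        have e1 := hX e.1 j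
        have e2 := hcube i hv j
        change |X e.1 j - centers X C i j| ≤ D
        exact (abs_sub _ _).trans (by linarith)
      exact this.trans (by gcongr)
    have hsq : √(n : ℝ) * √n = n := Real.mul_self_sqrt (Nat.cast_nonneg n)
    -- Replacing one true center by its approximation costs `3 * n * D * √ε`. Two replacements and
    -- the gain, at most `ε ≤ n * D * √ε`, add up to the constant 7.
    have hb : √(n * ε) * (√(n * ε) + 2 * (√n * D)) ≤ 3 * (n * D * √ε) := by
      rw [Real.sqrt_mul (Nat.cast_nonneg n)]
      calc √n * √ε * (√n * √ε + 2 * (√n * D)) = (√n * √n) * √ε * (√ε + 2 * D) := by ring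
        _ ≤ n * √ε * (D + 2 * D) := by
          rw [hsq]
          gcongr
          linarith
        _ = _ := by ring
    have e1 := abs_le.1 (abs_sq_sub_sq_le (hctr _ (G.src_mem e he)) (hdist _ (G.src_mem e he)))
    have e2 := abs_le.1 (abs_sq_sub_sq_le (hctr _ (G.tgt_mem e he)) (hdist _ (G.tgt_mem e he)))
    have e3 := hit.gain_nonneg e.1
    have e4 := hit.gain_le hi e.1
    rw [(hG.mem_edges he).1, (hG.mem_edges he).2] at e3 e4
    have e5 : ε ≤ n * D * √ε := by
      calc ε = √ε * √ε := (Real.mul_self_sqrt hε.le).symm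
        _ ≤ (1 * 1) * √ε := by gcongr; linarith
        _ ≤ n * D * √ε := by gcongr
    rw [TransitionGraph.sqDiff, show 7 * n * D * √ε = 7 * (n * D * √ε) by ring, abs_le]
    constructor <;> linarith [e1.1, e1.2, e2.1, e2.2]
  · refine hfar e he δ hδ ?_
    exact hC.lt_norm_sub_of_notMem h0 (hact _ (G.src_mem e he)) (hact _ (G.tgt_mem e he))
      (G.src_ne_tgt e he) h1 h2
  · refine hfar e he δ' hδ' ?_
    -- A balanced cluster contains all points it loses, at least `8 * d + 1` of them, so the
    -- hyperplane event alone separates its center.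
    have hcard : ∀ i ∈ G.balanced, 8 * d + 1 ≤ (cluster C i).card := by
      intro i hb
      refine (hgen.balanced_degree i hb).2.trans ?_
      refine (Finset.card_image_of_injOn (f := Prod.fst) (s := G.outEdges i) ?_).symm.trans_le
        (Finset.card_le_card ?_)
      · intro e he f hf hef
        exact G.label_inj e (Finset.mem_filter.1 he).1 f (Finset.mem_filter.1 hf).1 hef
      · intro x hx
        obtain ⟨e, he, rfl⟩ := Finset.mem_image.1 hx
        rw [TransitionGraph.outEdges, Finset.mem_filter] at he
        rw [mem_cluster, (hG.mem_edges he.1).1, he.2]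
    refine hC.lt_norm_sub h0 (hact _ (G.src_mem e he)) (hact _ (G.tgt_mem e he))
      (G.src_ne_tgt e he) ?_ h3
    rcases hb with hb | hb
    · exact (hcard _ hb).trans (Nat.le_add_right _ _)
    · exact (hcard _ hb).trans (Nat.le_add_left _ _)
  · exact fun i hb => hG.norm_bdry_le hb hit hi

end Tight

/-! ### The unlikely events: close centers of mass and points near a hyperplane. -/

section BadEvents

variable {n k d : ℕ}

theorem shift_mass {X : Fin n → Pt d} {x : Fin n} (y : Pt d) (S : Finset (Fin n)) :
    mass (X + shift (Pi.single x 1) y) S =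
      mass X S + (if x ∈ S then (S.card : ℝ)⁻¹ else 0) • y := by
  simp only [mass, Pi.add_apply, shift, Finset.sum_add_distrib, smul_add, ← Finset.sum_smul,
    smul_smul]
  congr 2
  simp [Pi.single_apply]

theorem measurable_mass (S : Finset (Fin n)) : Measurable fun X : Fin n → Pt d => mass X S := by
  unfold mass
  fun_prop

/-- The centers of mass of two given disjoint sets are unlikely to be close to each other. -/
theorem measure_norm_mass_sub_mass_le (a : Fin n → Pt d) {σ : ℝ} (hσ : 0 < σ) {δ : ℝ} (hδ : 0 ≤ δ)
    {S S' : Finset (Fin n)} (hS : S.Nonempty) (hSS' : Disjoint S S') :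
    perturbedLaw a σ {X | ‖mass X S - mass X S'‖ ≤ δ} ≤ ENNReal.ofReal (n * δ / σ) ^ d := by
  obtain ⟨x, hx⟩ := hS
  have hx' : x ∉ S' := Finset.disjoint_left.1 hSS' hx
  have hc : (0 : ℝ) < S.card := by exact_mod_cast Finset.card_pos.2 ⟨x, hx⟩
  have hcn : (S.card : ℝ) ≤ n := by exact_mod_cast (Finset.card_le_univ S).trans (by simp)
  have hmeas : MeasurableSet {X : Fin n → Pt d | ‖mass X S - mass X S'‖ ≤ δ} :=
    measurableSet_le ((measurable_mass S).sub (measurable_mass S')).norm measurable_const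
  have hlen : len (Pi.single x (1 : ℝ) : Fin n → ℝ) = 1 := by
    simp [len, Pi.single_apply]
  -- Moving a single point of `S` by `y` moves the difference of the centers of mass by `y / |S|`,
  -- with `|S| ≤ n`.
  have key := lintegral_mul_le_of_direction a σ (v := Pi.single x 1) (by simp)
    (f := fun _ => 1) (g := {X | ‖mass X S - mass X S'‖ ≤ δ}.indicator fun _ => 1)
    (h := fun _ => ENNReal.ofReal (n * δ / σ) ^ d) measurable_const
    (measurable_const.indicator hmeas) measurable_const (fun _ _ => rfl) (fun _ _ => rfl) ?_
  · simpa [lintegral_indicator hmeas] using key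
  · intro X
    have e1 : ∀ y : Pt d, {X : Fin n → Pt d | ‖mass X S - mass X S'‖ ≤ δ}.indicator
        (fun _ => (1 : ℝ≥0∞)) (X + shift (Pi.single x 1) ((σ / 1) • y)) =
        {y : Pt d | ‖(mass X S - mass X S') + (σ / S.card) • y‖ ≤ δ}.indicator (fun _ => 1) y := by
      intro y
      simp only [Set.indicator, Set.mem_ofPred_eq, shift_mass, hx, hx', if_true, if_false, zero_smul,
        add_zero]
      rw [show mass X S + (S.card : ℝ)⁻¹ • (σ / 1) • y - mass X S' =
        (mass X S - mass X S') + (σ / S.card) • y by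
          rw [smul_smul, div_one, inv_mul_eq_div]; abel]
    have hm2 : MeasurableSet {y : Pt d | ‖(mass X S - mass X S') + (σ / S.card) • y‖ ≤ δ} :=
      measurableSet_le (by fun_prop) measurable_const
    rw [hlen, lintegral_congr e1, lintegral_indicator hm2, setLIntegral_const, one_mul]
    refine (stdGaussian_ball_le _ (by positivity) _).trans ?_
    refine pow_le_pow_left' (ENNReal.ofReal_le_ofReal ?_) d
    rw [div_div_eq_mul_div, mul_comm]
    gcongr

theorem exists_image_eq {α : Type*} [DecidableEq α] {W : Finset α} (hW : W.Nonempty) {q : ℕ}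
    (hq : W.card ≤ q) : ∃ f : Fin q → α, Finset.univ.image f = W := by
  obtain ⟨e⟩ : Nonempty (W ↪ Fin q) := Function.Embedding.nonempty_of_card_le (by simpa)
  have : Nonempty W := hW.to_subtype
  have hs := Function.invFun_surjective e.injective
  refine ⟨fun i => ((Function.invFun e i : W) : α), ?_⟩
  ext w
  simp only [Finset.mem_image, Finset.mem_univ, true_and]
  constructor
  · rintro ⟨i, rfl⟩
    exact (Function.invFun e i).2
  · intro hw
    obtain ⟨i, hi⟩ := hs ⟨w, hw⟩
    exact ⟨i, by rw [hi]⟩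

/-- A union bound: a pair of sets is encoded as a list of `q` points, each with a mark telling its
set, with repetitions allowed. This gives `(2 * n) ^ q` choices. -/
theorem measure_closeMasses_le (a : Fin n → Pt d) {σ : ℝ} (hσ : 0 < σ) {δ : ℝ} (hδ : 0 ≤ δ)
    (q : ℕ) :
    perturbedLaw a σ (closeMasses n d q δ) ≤ (2 * n : ℕ) ^ q * ENNReal.ofReal (n * δ / σ) ^ d := by
  set P : (Fin q → Fin n × Bool) → Bool → Finset (Fin n) := fun f b =>
    Finset.univ.filter fun x => (x, b) ∈ Finset.univ.image f with hP
  have hsub : closeMasses n d q δ ⊆ ⋃ f : Fin q → Fin n × Bool,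
      {X | ((P f true).Nonempty ∧ Disjoint (P f true) (P f false)) ∧
        ‖mass X (P f true) - mass X (P f false)‖ ≤ δ} := by
    rintro X ⟨S, S', hS, -, hd, hq, hX⟩
    set W : Finset (Fin n × Bool) := S ×ˢ {true} ∪ S' ×ˢ {false} with hW
    have hWcard : W.card ≤ q := by
      refine (Finset.card_union_le _ _).trans ?_
      simpa using hq
    have hWne : W.Nonempty := by
      obtain ⟨x, hx⟩ := hS
      exact ⟨(x, true), by simp [hW, hx]⟩
    obtain ⟨f, hf⟩ := exists_image_eq hWne hWcard
    have h1 : P f true = S := by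
      ext x
      simp only [hP, hf]
      simp [hW]
    have h2 : P f false = S' := by
      ext x
      simp only [hP, hf]
      simp [hW]
    refine Set.mem_iUnion.2 ⟨f, ?_⟩
    rw [Set.mem_ofPred_eq, h1, h2]
    exact ⟨⟨hS, hd⟩, hX⟩
  refine (measure_mono hsub).trans ((measure_iUnion_fintype_le _ _).trans ?_)
  have hle : ∀ f : Fin q → Fin n × Bool, perturbedLaw a σ
      {X | ((P f true).Nonempty ∧ Disjoint (P f true) (P f false)) ∧
        ‖mass X (P f true) - mass X (P f false)‖ ≤ δ} ≤ ENNReal.ofReal (n * δ / σ) ^ d := by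
    intro f
    by_cases hf : (P f true).Nonempty ∧ Disjoint (P f true) (P f false)
    · simp only [hf, true_and]
      exact measure_norm_mass_sub_mass_le a hσ hδ hf.1 hf.2
    · simp [hf]
  refine (Finset.sum_le_sum fun f _ => hle f).trans ?_
  simp [mul_comm]

theorem measure_closeMasses_zero (a : Fin n → Pt d) {σ : ℝ} (hσ : 0 < σ) (hd : d ≠ 0) (q : ℕ) :
    perturbedLaw a σ (closeMasses n d q 0) = 0 := by
  have := measure_closeMasses_le a hσ le_rfl q
  simpa [hd] using this

/-- Given points are unlikely to be close to a given hyperplane. -/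
theorem measure_abs_inner_sub_le (a : Fin n → Pt d) {σ : ℝ} (hσ : 0 < σ) {u : Pt d}
    (hu : 1 / 2 ≤ ‖u‖) (b : ℝ) {η : ℝ} (hη : 0 ≤ η) (S : Finset (Fin n)) :
    perturbedLaw a σ {X | ∀ x ∈ S, |inner ℝ u (X x) - b| ≤ 3 * η} ≤
      ENNReal.ofReal (6 * η / σ) ^ S.card := by
  have hprob : ∀ i, IsProbabilityMeasure ((stdGaussian (Pt d)).map fun z => a i + σ • z) := fun i =>
    Measure.isProbabilityMeasure_map (by fun_prop)
  have hset : {X : Fin n → Pt d | ∀ x ∈ S, |inner ℝ u (X x) - b| ≤ 3 * η} =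
      Set.univ.pi fun x => if x ∈ S then {p | |inner ℝ u p - b| ≤ 3 * η} else Set.univ := by
    ext X
    simp only [Set.mem_ofPred_eq, Set.mem_univ_pi]
    refine forall_congr' fun x => ?_
    by_cases hx : x ∈ S <;> simp [hx]
  have hone : ∀ x, ((stdGaussian (Pt d)).map fun z => a x + σ • z)
      (if x ∈ S then {p | |inner ℝ u p - b| ≤ 3 * η} else Set.univ) ≤
      if x ∈ S then ENNReal.ofReal (6 * η / σ) else 1 := by
    intro x
    split_ifs with hx
    · have hu0 : σ • u ≠ 0 := by
        refine smul_ne_zero hσ.ne' fun h => ?_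
        rw [h, norm_zero] at hu
        norm_num at hu
      have hm : MeasurableSet {p : Pt d | |inner ℝ u p - b| ≤ 3 * η} :=
        measurableSet_le (by fun_prop) measurable_const
      rw [Measure.map_apply (by fun_prop) hm]
      have h1 := stdGaussian_slab_le hu0 (inner ℝ u (a x) - b) (3 * η)
      refine le_trans (le_of_eq ?_) (h1.trans (ENNReal.ofReal_le_ofReal ?_))
      · congr 1
        ext z
        simp only [Set.mem_preimage, Set.mem_ofPred_eq, inner_add_right, inner_smul_right,
          inner_smul_left, conj_trivial]
        rw [show inner ℝ u (a x) + σ * inner ℝ u z - b = σ * inner ℝ u z + (inner ℝ u (a x) - b) by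
          ring]
      · rw [norm_smul, Real.norm_of_nonneg hσ.le]
        have h3 : σ * (1 / 2) ≤ σ * ‖u‖ := by gcongr
        calc 3 * η / (σ * ‖u‖) ≤ 3 * η / (σ * (1 / 2)) := by gcongr
          _ = 6 * η / σ := by field_simp; ring
    · exact prob_le_one
  unfold perturbedLaw
  rw [hset, Measure.pi_pi]
  refine (Finset.prod_le_prod' fun x _ => hone x).trans (le_of_eq ?_)
  rw [Finset.prod_ite_mem, Finset.univ_inter, Finset.prod_const]

/-- Rounding the normal vector costs at most `η / 2` for points of the cube, and rounding the offset
at most `η`. Together with the original `η` this stays below `3 * η`, and the rounded normal keeps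
length at least 1/2. -/
theorem exists_near_grid {X : Fin n → Pt d} (hX : ∀ x, X x ∈ cube n k d) {η : ℝ} (hη : 0 < η)
    (hη2 : η ≤ 1 / 2) (hD : 1 ≤ sideLength n k d) (hdn : d ≤ n) (hn : 2 ≤ n) {q : ℕ} (hq : q ≠ 0)
    (h : X ∈ nearHyperplane n d q η) :
    ∃ S ∈ Finset.powersetCard q (Finset.univ : Finset (Fin n)),
      ∃ u ∈ grid d 1 (η / (n * sideLength n k d)),
      ∃ z ∈ Finset.Icc (-⌈n * sideLength n k d / η⌉) ⌈n * sideLength n k d / η⌉,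
        1 / 2 ≤ ‖u‖ ∧ ∀ x ∈ S, |inner ℝ u (X x) - η * z| ≤ 3 * η := by
  obtain ⟨S', u, b, hq', hu, hS'⟩ := h
  obtain ⟨S, hS, rfl⟩ := Finset.exists_subset_card_eq hq'
  set D := sideLength n k d
  set r := η / (n * D) with hr
  have hn' : (2 : ℝ) ≤ n := by exact_mod_cast hn
  have hrpos : 0 < r := by positivity
  have hnorm : ∀ x, ‖X x‖ ≤ √n * (D / 2) := fun x =>
    (norm_le_of_abs_le (by positivity) (hX x)).trans (by gcongr)
  have hsn : √(n : ℝ) ≤ n := by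
    rw [Real.sqrt_le_left (by positivity)]
    nlinarith
  have hsqn : √(n : ℝ) * √n = n := Real.mul_self_sqrt (Nat.cast_nonneg n)
  obtain ⟨u', hu', huu⟩ := exists_grid (D := 1) hrpos u fun j => by
    rw [← hu]
    exact PiLp.norm_apply_le u j
  have hdist : ‖u' - u‖ ≤ √n * r :=
    (norm_le_of_abs_le hrpos.le (p := u' - u) huu).trans (by gcongr)
  have hnr : n * r = η / D := by
    rw [hr]
    field_simp
  obtain ⟨x₀, hx₀⟩ := Finset.card_pos.1 (Nat.pos_of_ne_zero hq)
  have hb : |b| ≤ n * D := by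
    have h1 := abs_le.1 (hS' x₀ (hS hx₀))
    have h2 : |inner ℝ u (X x₀)| ≤ n * (D / 2) := by
      refine (abs_real_inner_le_norm _ _).trans ?_
      rw [hu, one_mul]
      exact (hnorm x₀).trans (by gcongr)
    have h3 := abs_le.1 h2
    have h4 : 2 * 1 ≤ n * D := by gcongr
    rw [abs_le]
    constructor <;> linarith [h1.1, h1.2, h3.1, h3.2]
  refine ⟨S, Finset.mem_powersetCard.2 ⟨Finset.subset_univ _, rfl⟩, u', hu', ⌊b / η⌋, ?_, ?_, ?_⟩
  · have h1 := abs_le.1 hb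
    rw [Finset.mem_Icc, Int.le_floor]
    push_cast
    constructor
    · have h2 := Int.le_ceil (n * D / η)
      have h3 : -(n * D / η) ≤ b / η := by
        rw [← neg_div]
        gcongr
        exact h1.1
      linarith
    · refine (Int.floor_le_ceil _).trans (Int.ceil_le_ceil ?_)
      gcongr
      exact h1.2
  · have h1 : √n * r ≤ 1 / 2 := by
      calc √n * r ≤ n * r := by gcongr
        _ = η / D := hnr
        _ ≤ η / 1 := by gcongr
        _ ≤ 1 / 2 := by rwa [div_one]
    have h2 := norm_sub_norm_le u u'
    rw [norm_sub_rev, hu] at h2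
    linarith
  · intro x hx
    have h1 : |inner ℝ (u' - u) (X x)| ≤ η / 2 := by
      refine (abs_real_inner_le_norm _ _).trans ?_
      calc ‖u' - u‖ * ‖X x‖ ≤ (√n * r) * (√n * (D / 2)) := by
            gcongr
            exact hnorm x
        _ = (√n * √n) * r * D / 2 := by ring
        _ = η / 2 := by
          rw [hsqn, hnr]
          field_simp
    have h2 := abs_le.1 (hS' x (hS hx))
    have h3 := Int.floor_le (b / η)
    have h4 := Int.lt_floor_add_one (b / η)
    rw [le_div_iff₀ hη] at h3
    rw [div_lt_iff₀ hη] at h4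
    rw [inner_sub_left] at h1
    have h5 := abs_le.1 h1
    rw [abs_le]
    constructor <;> nlinarith [h2.1, h2.2, h5.1, h5.2]

/-- It is unlikely that many points are close to a common hyperplane. -/
theorem measure_nearHyperplane_le (a : Fin n → Pt d) {σ : ℝ} (hσ : 0 < σ) {η : ℝ} (hη : 0 < η)
    (hη2 : η ≤ 1 / 2) (hD : 1 ≤ sideLength n k d) (hdn : d ≤ n) (hn : 2 ≤ n) {q : ℕ} (hq : q ≠ 0) :
    perturbedLaw a σ {X | (∀ x, X x ∈ cube n k d) ∧ X ∈ nearHyperplane n d q η} ≤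
      ENNReal.ofReal (n ^ q * (5 * (n * sideLength n k d) / η) ^ (d + 1) * (6 * η / σ) ^ q) := by
  set D := sideLength n k d
  set A := Finset.powersetCard q (Finset.univ : Finset (Fin n))
  set N := grid d 1 (η / (n * D)) with hN
  set I := Finset.Icc (-⌈n * D / η⌉) ⌈n * D / η⌉
  have hn' : (2 : ℝ) ≤ n := by exact_mod_cast hn
  have hnD : 2 * 1 ≤ n * D := by gcongr
  -- A rounded hyperplane has `d` coordinates of the normal and one offset, hence the exponent `d +
  -- 1` of the grid count.
  have hsub : {X : Fin n → Pt d | (∀ x, X x ∈ cube n k d) ∧ X ∈ nearHyperplane n d q η} ⊆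
      ⋃ p ∈ A ×ˢ N ×ˢ I, {X | 1 / 2 ≤ ‖p.2.1‖ ∧
        ∀ x ∈ p.1, |inner ℝ p.2.1 (X x) - η * p.2.2| ≤ 3 * η} := by
    rintro X ⟨hX, h⟩
    obtain ⟨S, hS, u, hu, z, hz, h1⟩ := exists_near_grid hX hη hη2 hD hdn hn hq h
    exact Set.mem_biUnion (x := (S, u, z))
      (Finset.mem_coe.2 (Finset.mk_mem_product hS (Finset.mk_mem_product hu hz))) h1
  refine (measure_mono hsub).trans ((measure_biUnion_finset_le _ _).trans ?_)
  have hle : ∀ p ∈ A ×ˢ N ×ˢ I, perturbedLaw a σ {X | 1 / 2 ≤ ‖p.2.1‖ ∧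
      ∀ x ∈ p.1, |inner ℝ p.2.1 (X x) - η * p.2.2| ≤ 3 * η} ≤
      ENNReal.ofReal ((6 * η / σ) ^ q) := by
    intro p hp
    rw [ENNReal.ofReal_pow (by positivity)]
    by_cases hu : 1 / 2 ≤ ‖p.2.1‖
    · simp only [hu, true_and]
      rw [← (Finset.mem_powersetCard.1 (Finset.mem_product.1 hp).1).2]
      exact measure_abs_inner_sub_le a hσ hu _ hη.le _
    · simp only [hu, false_and]
      simp
  refine (Finset.sum_le_sum hle).trans ?_
  rw [Finset.sum_const, nsmul_eq_mul, ← ENNReal.ofReal_natCast,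
    ← ENNReal.ofReal_mul (Nat.cast_nonneg _)]
  refine ENNReal.ofReal_le_ofReal (mul_le_mul_of_nonneg_right ?_ (by positivity))
  have hA : (A.card : ℝ) ≤ n ^ q := by
    have : A.card ≤ n ^ q := by
      rw [Finset.card_powersetCard, Finset.card_univ, Fintype.card_fin]
      exact Nat.choose_le_pow n q
    exact_mod_cast this
  have hNc : (N.card : ℝ) ≤ (5 * (n * D) / η) ^ d := by
    have := card_grid_le (d := d) (D := 1) (r := η / (n * D)) (by positivity)
      ((div_le_one (by positivity)).2 (by linarith))
    rwa [mul_one, div_div_eq_mul_div] at this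
  have hI : (I.card : ℝ) ≤ 5 * (n * D) / η := card_Icc_ceil_le hη (by linarith)
  rw [Finset.card_product, Finset.card_product]
  push_cast
  rw [pow_succ]
  gcongr

end BadEvents

/-! ### Numerical estimates. -/

/-- The numerical assumptions: the bound of the theorem for `ε = r ^ 2` is nontrivial. -/
structure IsSmall (n k D σ r : ℝ) : Prop where
  one_le_k : 1 ≤ k
  k_le_n : k ≤ n
  one_le_D : 1 ≤ D
  D_le : D ≤ 10 * n ^ 2
  σ_pos : 0 < σ
  σ_le : σ ≤ 1
  r_pos : 0 < r
  r_le : r ^ 2 * (10 ^ 20 * n ^ 33 * k ^ 30 * D ^ 3) ≤ σ ^ 6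

/-- The distance that any two centers have outside of an unlikely event. -/
noncomputable def sepDist (n k D σ r : ℝ) : ℝ := 28 * n ^ 10 * k ^ 16 * √(D / σ) ^ 3 * r

/-- The bound of the theorem for `ε = r ^ 2`, up to the constant. -/
noncomputable def bound (n k D σ r : ℝ) : ℝ := r ^ 2 * n ^ 33 * k ^ 30 * D ^ 3 / σ ^ 6

namespace IsSmall

variable {n k D σ r : ℝ}

theorem one_le_n (h : IsSmall n k D σ r) : 1 ≤ n := h.one_le_k.trans h.k_le_n

theorem sqrt_pow_six (h : IsSmall n k D σ r) : √(D / σ) ^ 6 = D ^ 3 / σ ^ 3 := by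
  have : 0 ≤ D / σ := div_nonneg (zero_le_one.trans h.one_le_D) h.σ_pos.le
  rw [show √(D / σ) ^ 6 = (√(D / σ) ^ 2) ^ 3 by ring, Real.sq_sqrt this, div_pow]

theorem one_le_sqrt (h : IsSmall n k D σ r) : 1 ≤ √(D / σ) := by
  rw [Real.one_le_sqrt, one_le_div h.σ_pos]
  exact h.σ_le.trans h.one_le_D

/-- Essentially the square root of `r_le`. This and its variant `mul_sqrt_le` serve to absorb
surplus powers of `r`. -/
theorem mul_le (h : IsSmall n k D σ r) : r * n ^ 16 * k ^ 15 * D ≤ σ ^ 3 / 10 ^ 10 := by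
  obtain ⟨hk, hkn, hD, -, hσ, -, hr, hle⟩ := h
  have hn : 1 ≤ n := hk.trans hkn
  rw [le_div_iff₀ (by positivity)]
  refine le_of_sq_le_sq ?_ (by positivity)
  calc (r * n ^ 16 * k ^ 15 * D * 10 ^ 10) ^ 2 =
      r ^ 2 * (10 ^ 20 * n ^ 32 * k ^ 30 * D ^ 2) := by ring
    _ ≤ r ^ 2 * (10 ^ 20 * n ^ 33 * k ^ 30 * D ^ 3) := by
      gcongr <;> first | assumption | norm_num
    _ ≤ σ ^ 6 := hle
    _ = _ := by ring

theorem mul_sqrt_le (h : IsSmall n k D σ r) :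
    r * n ^ 16 * k ^ 15 * √(D / σ) ^ 3 ≤ √σ ^ 3 / 10 ^ 10 := by
  have h6 := h.sqrt_pow_six
  have hn := h.one_le_n
  obtain ⟨hk, hkn, hD, -, hσ, -, hr, hle⟩ := h
  have hs : √σ ^ 2 = σ := Real.sq_sqrt hσ.le
  rw [le_div_iff₀ (by positivity)]
  refine le_of_sq_le_sq ?_ (by positivity)
  calc (r * n ^ 16 * k ^ 15 * √(D / σ) ^ 3 * 10 ^ 10) ^ 2 =
      r ^ 2 * (10 ^ 20 * n ^ 32 * k ^ 30) * √(D / σ) ^ 6 := by ring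
    _ = r ^ 2 * (10 ^ 20 * n ^ 32 * k ^ 30 * D ^ 3) / σ ^ 3 := by
      rw [h6]
      ring
    _ ≤ r ^ 2 * (10 ^ 20 * n ^ 33 * k ^ 30 * D ^ 3) / σ ^ 3 := by
      gcongr
      norm_num
    _ ≤ σ ^ 6 / σ ^ 3 := by gcongr
    _ = (√σ ^ 2) ^ 3 := by
      rw [hs]
      field_simp
    _ = _ := by ring

theorem sepDist_pos (h : IsSmall n k D σ r) : 0 < sepDist n k D σ r := by
  have hg := h.one_le_sqrt
  have hn := h.one_le_n
  obtain ⟨hk, hkn, hD, -, hσ, -, hr, hle⟩ := h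
  unfold sepDist
  positivity

theorem sepDist_sq (h : IsSmall n k D σ r) :
    sepDist n k D σ r ^ 2 = 784 * n ^ 20 * k ^ 32 * (D ^ 3 / σ ^ 3) * r ^ 2 := by
  rw [← h.sqrt_pow_six, sepDist]
  ring

theorem mul_sepDist_le (h : IsSmall n k D σ r) :
    n ^ 5 * sepDist n k D σ r ≤ √σ ^ 3 / 10 ^ 8 := by
  have h1 := h.mul_sqrt_le
  have hg := h.one_le_sqrt
  have hn := h.one_le_n
  obtain ⟨hk, hkn, hD, -, hσ, -, hr, hle⟩ := h
  have hσ' : 0 ≤ √σ ^ 3 := by positivity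
  calc n ^ 5 * sepDist n k D σ r = 28 * (n ^ 15 * k * (r * k ^ 15 * √(D / σ) ^ 3)) := by
        rw [sepDist]
        ring
    _ ≤ 28 * (n ^ 15 * n * (r * k ^ 15 * √(D / σ) ^ 3)) := by gcongr
    _ = 28 * (r * n ^ 16 * k ^ 15 * √(D / σ) ^ 3) := by ring
    _ ≤ 28 * (√σ ^ 3 / 10 ^ 10) := by gcongr
    _ ≤ _ := by linarith

theorem sqrt_pow_le_one (h : IsSmall n k D σ r) (m : ℕ) : √σ ^ m ≤ 1 :=
  pow_le_one₀ (Real.sqrt_nonneg _) (Real.sqrt_le_one.2 h.σ_le)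

theorem r_mul_le (h : IsSmall n k D σ r) : r * n ^ 16 ≤ σ ^ 3 / 10 ^ 10 := by
  have h1 := h.mul_le
  have hn := h.one_le_n
  obtain ⟨hk, hkn, hD, -, hσ, -, hr, hle⟩ := h
  refine le_trans ?_ h1
  calc r * n ^ 16 = r * n ^ 16 * 1 ^ 15 * 1 := by ring
    _ ≤ _ := by gcongr

theorem sqrt_r_mul_le (h : IsSmall n k D σ r) : √r * n ^ 8 ≤ 1 / 10 ^ 5 := by
  have h1 := h.r_mul_le
  have hn := h.one_le_n
  have h2 : σ ^ 3 ≤ 1 := pow_le_one₀ h.σ_pos.le h.σ_le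
  refine le_of_sq_le_sq ?_ (by positivity)
  rw [mul_pow, Real.sq_sqrt h.r_pos.le]
  norm_num at h1 ⊢
  rw [← pow_mul]
  linarith

theorem bound_pos (h : IsSmall n k D σ r) : 0 < bound n k D σ r := by
  have hn := h.one_le_n
  obtain ⟨hk, hkn, hD, -, hσ, -, hr, hle⟩ := h
  unfold bound
  positivity

/-- Probability that two small sets have centers of mass close to each other. -/
theorem closeMasses_le (h : IsSmall n k D σ r) {d : ℕ} (hd : 2 ≤ d) :
    (2 * n) ^ (4 * d) * (n * sepDist n k D σ r / σ) ^ d ≤ 10 ^ 6 * bound n k D σ r := by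
  have h1 := h.mul_sepDist_le
  have h2 := h.sepDist_sq
  have h3 := h.sepDist_pos
  have h4 := h.sqrt_pow_le_one 1
  have hn := h.one_le_n
  obtain ⟨hk, hkn, hD, -, hσ, hσ1, hr, hle⟩ := h
  set δ := sepDist n k D σ r
  have hs : √σ ^ 2 = σ := Real.sq_sqrt hσ.le
  have hx : 16 * n ^ 5 * δ / σ ≤ 1 := by
    rw [div_le_one hσ]
    calc 16 * n ^ 5 * δ = 16 * (n ^ 5 * δ) := by ring
      _ ≤ 16 * (√σ ^ 3 / 10 ^ 8) := by gcongr
      _ = √σ ^ 2 * √σ ^ 1 * (16 / 10 ^ 8) := by ring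
      _ ≤ √σ ^ 2 * 1 * 1 := by gcongr; norm_num
      _ = σ := by rw [hs]; ring
  calc (2 * n) ^ (4 * d) * (n * δ / σ) ^ d = (16 * n ^ 5 * δ / σ) ^ d := by
        rw [pow_mul, ← mul_pow]
        congr 1
        ring
    _ ≤ (16 * n ^ 5 * δ / σ) ^ 2 := pow_le_pow_of_le_one (by positivity) hx hd
    _ = 256 * n ^ 10 * δ ^ 2 / σ ^ 2 := by ring
    _ = 200704 * (r ^ 2 * n ^ 30 * (k ^ 30 * (k ^ 2 * 1)) * D ^ 3 * σ) / σ ^ 6 := by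
      rw [h2]
      field_simp
      ring
    -- Here two powers of `k` are traded for powers of `n`, which leaves `k ^ 30`.
    _ ≤ 10 ^ 6 * (r ^ 2 * n ^ 30 * (k ^ 30 * (n ^ 2 * n)) * D ^ 3 * 1) / σ ^ 6 := by
      gcongr
      norm_num
    _ = _ := by
      rw [bound]
      ring

/-- The factors are regrouped as a prefactor times a `d`-th power whose base is at most 1, so `d =
2` is the worst case. The base has order δ³: two of the six powers of δ yield `r ^ 2`, and the other
four pay for the prefactor. -/
theorem nearHyperplane_le (h : IsSmall n k D σ r) {d : ℕ} (hd : 2 ≤ d) :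
    n ^ (4 * d + 1) * (5 * (n * D) / (n * sepDist n k D σ r)) ^ (d + 1) *
      (6 * (n * sepDist n k D σ r) / σ) ^ (4 * d + 1) ≤ bound n k D σ r := by
  have h1 := h.mul_sepDist_le
  have h2 := h.sepDist_sq
  have h3 := h.sepDist_pos
  have h4 := h.sqrt_pow_le_one 1
  have hn := h.one_le_n
  obtain ⟨hk, hkn, hD, hDn, hσ, hσ1, hr, hle⟩ := h
  set δ := sepDist n k D σ r
  have hs : √σ ^ 2 = σ := Real.sq_sqrt hσ.le
  have hs8 : √σ ^ 8 = σ ^ 4 := by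
    calc √σ ^ 8 = (√σ ^ 2) ^ 4 := by ring
      _ = σ ^ 4 := by rw [hs]
  have hx : 6480 * n ^ 8 * D * δ ^ 3 / σ ^ 4 ≤ 1 := by
    rw [div_le_one (by positivity)]
    calc 6480 * n ^ 8 * D * δ ^ 3 ≤ 6480 * n ^ 8 * (10 * n ^ 2) * δ ^ 3 := by gcongr
      _ = 64800 * n ^ 10 * 1 * δ ^ 3 := by ring
      _ ≤ 64800 * n ^ 10 * n ^ 5 * δ ^ 3 := by gcongr; exact one_le_pow₀ hn
      _ = 64800 * (n ^ 5 * δ) ^ 3 := by ring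
      _ ≤ 64800 * (√σ ^ 3 / 10 ^ 8) ^ 3 := by gcongr
      _ = √σ ^ 8 * √σ ^ 1 * (64800 / 10 ^ 24) := by ring
      _ ≤ √σ ^ 8 * 1 * 1 := by gcongr; norm_num
      _ = σ ^ 4 := by rw [hs8]; ring
  have hδ4 : n ^ 20 * δ ^ 4 ≤ σ ^ 6 / 10 ^ 32 := by
    calc n ^ 20 * δ ^ 4 = (n ^ 5 * δ) ^ 4 := by ring
      _ ≤ (√σ ^ 3 / 10 ^ 8) ^ 4 := by gcongr
      _ = (√σ ^ 2) ^ 6 / 10 ^ 32 := by ring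
      _ = _ := by rw [hs]
  have e1 : n * (5 * (n * D) / (n * δ)) * (6 * (n * δ) / σ) = 30 * n ^ 2 * D / σ := by
    field_simp
    norm_num
  have e2 : n ^ 4 * (5 * (n * D) / (n * δ)) * (6 * (n * δ) / σ) ^ 4 =
      6480 * n ^ 8 * D * δ ^ 3 / σ ^ 4 := by
    field_simp
    norm_num
  calc n ^ (4 * d + 1) * (5 * (n * D) / (n * δ)) ^ (d + 1) * (6 * (n * δ) / σ) ^ (4 * d + 1)
      = (n * (5 * (n * D) / (n * δ)) * (6 * (n * δ) / σ)) *
          (n ^ 4 * (5 * (n * D) / (n * δ)) * (6 * (n * δ) / σ) ^ 4) ^ d := by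
        generalize 5 * (n * D) / (n * δ) = X
        generalize 6 * (n * δ) / σ = Y
        ring
    _ = (30 * n ^ 2 * D / σ) * (6480 * n ^ 8 * D * δ ^ 3 / σ ^ 4) ^ d := by rw [e1, e2]
    _ ≤ (30 * n ^ 2 * D / σ) * (6480 * n ^ 8 * D * δ ^ 3 / σ ^ 4) ^ 2 := by
        gcongr ?_ * ?_
        exact pow_le_pow_of_le_one (by positivity) hx hd
    _ = 1259712000 * D ^ 3 / σ ^ 9 * δ ^ 2 * (n ^ 18 * δ ^ 4) := by ring
    _ ≤ 1259712000 * D ^ 3 / σ ^ 9 * δ ^ 2 * (n ^ 20 * δ ^ 4) := by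
        gcongr
        norm_num
    _ ≤ 1259712000 * D ^ 3 / σ ^ 9 * δ ^ 2 * (σ ^ 6 / 10 ^ 32) := by gcongr
    _ = 1259712000 * 784 / 10 ^ 32 * (r ^ 2 * n ^ 20 * (k ^ 30 * k ^ 2) * D ^ 3 * D ^ 3)
          / σ ^ 6 := by
        rw [h2]
        field_simp
    _ ≤ (1000 : ℝ)⁻¹ * (r ^ 2 * n ^ 20 * (k ^ 30 * n ^ 2) * D ^ 3 * (10 * n ^ 2) ^ 3) / σ ^ 6 := by
        gcongr
        norm_num
    _ = r ^ 2 * n ^ 28 * k ^ 30 * D ^ 3 / σ ^ 6 := by ring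
    _ ≤ r ^ 2 * n ^ 33 * k ^ 30 * D ^ 3 / σ ^ 6 := by
        gcongr
        norm_num

/-- As for `nearHyperplane_le`, with a base of order (√r)⁷, whose square is `r ^ 7`: two powers of
`r` are needed, five are spare. -/
theorem nearHyperplane_sqrt_le (h : IsSmall n k D σ r) {d : ℕ} (hd : 2 ≤ d) :
    n ^ (8 * d + 1) * (5 * (n * D) / (n * √r)) ^ (d + 1) * (6 * (n * √r) / σ) ^ (8 * d + 1) ≤
      bound n k D σ r := by
  have h1 := h.mul_le
  have hn := h.one_le_n
  obtain ⟨hk, hkn, hD, hDn, hσ, hσ1, hr, hle⟩ := h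
  have hs : √r ^ 2 = r := Real.sq_sqrt hr.le
  have hsp : 0 < √r := Real.sqrt_pos.2 hr
  have hw : r * n ^ 16 * D ≤ σ ^ 3 / 10 ^ 10 := by
    refine le_trans ?_ h1
    calc r * n ^ 16 * D = r * n ^ 16 * 1 ^ 15 * D := by ring
      _ ≤ _ := by gcongr
  have hr1 : r ≤ 1 := by
    calc r = r * 1 * 1 := by ring
      _ ≤ r * n ^ 16 * D := by
        gcongr
        exact one_le_pow₀ hn
      _ ≤ σ ^ 3 / 10 ^ 10 := hw
      _ ≤ 1 / 1 := by
        gcongr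
        · exact pow_le_one₀ hσ.le hσ1
        · norm_num
      _ = 1 := by norm_num
  have hsle : √r ≤ 1 := Real.sqrt_le_one.2 hr1
  have hx : 8398080 * n ^ 16 * D * √r ^ 7 / σ ^ 8 ≤ 1 := by
    rw [div_le_one (by positivity)]
    calc 8398080 * n ^ 16 * D * √r ^ 7 = 8398080 * n ^ 16 * D * (√r ^ 2) ^ 3 * √r := by ring
      _ = 8398080 * (n ^ 16) ^ 1 * D ^ 1 * r ^ 3 * √r := by rw [hs]; ring
      _ ≤ 8398080 * (n ^ 16) ^ 3 * D ^ 3 * r ^ 3 * 1 := by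
        gcongr
        · exact one_le_pow₀ hn
        · norm_num
        · norm_num
      _ = 8398080 * (r * n ^ 16 * D) ^ 3 := by ring
      _ ≤ 8398080 * (σ ^ 3 / 10 ^ 10) ^ 3 := by gcongr
      _ = σ ^ 8 * σ * (8398080 / 10 ^ 30) := by ring
      _ ≤ σ ^ 8 * 1 * 1 := by gcongr; norm_num
      _ = σ ^ 8 := by ring
  have hw5 : n ^ 34 * D ^ 3 * r ^ 5 ≤ σ ^ 15 / 10 ^ 50 := by
    calc n ^ 34 * D ^ 3 * r ^ 5 ≤ n ^ 80 * D ^ 5 * r ^ 5 := by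
          gcongr <;> first | assumption | norm_num
      _ = (r * n ^ 16 * D) ^ 5 := by ring
      _ ≤ (σ ^ 3 / 10 ^ 10) ^ 5 := by gcongr
      _ = _ := by ring
  have e1 : n * (5 * (n * D) / (n * √r)) * (6 * (n * √r) / σ) = 30 * n ^ 2 * D / σ := by
    field_simp
    norm_num
  have e2 : n ^ 8 * (5 * (n * D) / (n * √r)) * (6 * (n * √r) / σ) ^ 8 =
      8398080 * n ^ 16 * D * √r ^ 7 / σ ^ 8 := by
    field_simp
    norm_num
  calc n ^ (8 * d + 1) * (5 * (n * D) / (n * √r)) ^ (d + 1) * (6 * (n * √r) / σ) ^ (8 * d + 1)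
      = (n * (5 * (n * D) / (n * √r)) * (6 * (n * √r) / σ)) *
          (n ^ 8 * (5 * (n * D) / (n * √r)) * (6 * (n * √r) / σ) ^ 8) ^ d := by
        generalize 5 * (n * D) / (n * √r) = X
        generalize 6 * (n * √r) / σ = Y
        ring
    _ = (30 * n ^ 2 * D / σ) * (8398080 * n ^ 16 * D * √r ^ 7 / σ ^ 8) ^ d := by rw [e1, e2]
    _ ≤ (30 * n ^ 2 * D / σ) * (8398080 * n ^ 16 * D * √r ^ 7 / σ ^ 8) ^ 2 := by
        gcongr ?_ * ?_
        exact pow_le_pow_of_le_one (by positivity) hx hd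
    _ = 30 * 8398080 ^ 2 * (n ^ 34 * D ^ 3 * (√r ^ 2) ^ 7) / σ ^ 17 := by ring
    _ = 30 * 8398080 ^ 2 * r ^ 2 * (n ^ 34 * D ^ 3 * r ^ 5) / σ ^ 17 := by
        rw [hs]
        ring
    _ ≤ 30 * 8398080 ^ 2 * r ^ 2 * (σ ^ 15 / 10 ^ 50) / σ ^ 17 := by gcongr
    _ = 30 * 8398080 ^ 2 / 10 ^ 50 * (r ^ 2 * 1 * 1 * 1) * σ ^ 4 / σ ^ 6 := by
        field_simp
    _ ≤ 1 * (r ^ 2 * n ^ 33 * k ^ 30 * D ^ 3) * 1 / σ ^ 6 := by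
        gcongr
        · norm_num
        · exact one_le_pow₀ hn
        · exact one_le_pow₀ hk
        · exact one_le_pow₀ hD
        · exact pow_le_one₀ hσ.le hσ1
    _ = _ := by
        rw [bound]
        ring

/-- A slab is thin in comparison with the separation of the centers. -/
theorem div_sepDist_eq (h : IsSmall n k D σ r) :
    7 * n ^ 2 * D * r / σ / (sepDist n k D σ r / 2) = (2 * (n * k ^ 2) ^ 8 * √(D / σ))⁻¹ := by
  have hg := h.one_le_sqrt
  have hn := h.one_le_n
  obtain ⟨hk, hkn, hD, hDn, hσ, hσ1, hr, hle⟩ := h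
  have hs : √(D / σ) ^ 2 = D / σ := Real.sq_sqrt (by positivity)
  -- The constants in `sepDist` are chosen for this quotient: with N = `n * k ^ 2` it equals 1 / (2
  -- N⁸ √(D / σ)), so one slab factor pays for eight labeled edges.
  rw [sepDist, show 7 * n ^ 2 * D * r / σ = 7 * n ^ 2 * (D / σ) * r by ring]
  generalize √(D / σ) = g at hg hs ⊢
  rw [← hs]
  field_simp
  norm_num

theorem div_sepDist_le (h : IsSmall n k D σ r) :
    7 * n ^ 2 * D * r / σ / (sepDist n k D σ r / 2) ≤ (n * k ^ 2)⁻¹ ^ 8 := by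
  have hg := h.one_le_sqrt
  have hn := h.one_le_n
  rw [h.div_sepDist_eq, inv_pow]
  obtain ⟨hk, hkn, hD, hDn, hσ, hσ1, hr, hle⟩ := h
  gcongr
  calc (n * k ^ 2) ^ 8 = 1 * (n * k ^ 2) ^ 8 * 1 := by ring
    _ ≤ _ := by
      gcongr
      norm_num

theorem one_le_mul_sq (h : IsSmall n k D σ r) : 1 ≤ n * k ^ 2 :=
  one_le_mul_of_one_le_of_one_le h.one_le_n (one_le_pow₀ h.one_le_k)

/-- The third-moment term has order r³ / r. One slab quotient is split off, worth eight edges, and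
the rest has order `r ^ 2`. -/
theorem unbalanced_le (h : IsSmall n k D σ r) :
    32 * (7 * n ^ 2 * D * r / σ) ^ 3 * n ^ 3 / (σ ^ 2 * (sepDist n k D σ r / 2)) ≤
      (n * k ^ 2)⁻¹ ^ 8 * (784 * 2 * bound n k D σ r) := by
  have h1 := h.div_sepDist_le
  have h0 := h.sepDist_pos
  have hn := h.one_le_n
  obtain ⟨hk, hkn, hD, hDn, hσ, hσ1, hr, hle⟩ := h
  calc _ = 7 * n ^ 2 * D * r / σ / (sepDist n k D σ r / 2) *
        (784 * 2 * (r ^ 2 * n ^ 7 * 1 * D ^ 2 * σ ^ 2) / σ ^ 6) := by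
        field_simp
        norm_num
    _ ≤ (n * k ^ 2)⁻¹ ^ 8 * (784 * 2 * (r ^ 2 * n ^ 33 * k ^ 30 * D ^ 3 * 1) / σ ^ 6) := by
        gcongr
        · norm_num
        · exact one_le_pow₀ hk
        · norm_num
        · exact pow_le_one₀ hσ.le hσ1
    _ = _ := by
        rw [bound]
        ring

/-- `T` slab quotients together with the one contained in the third-moment term pay for `8 * (T +
1)` edges. -/
theorem graph_le_of_balanced_empty (h : IsSmall n k D σ r) {m T : ℕ} (hm : m ≤ 8 * (T + 1)) :
    (7 * n ^ 2 * D * r / σ / (sepDist n k D σ r / 2)) ^ T *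
      (3 * (32 * (7 * n ^ 2 * D * r / σ) ^ 3 * n ^ 3 / (σ ^ 2 * (sepDist n k D σ r / 2)))) ≤
      (n * k ^ 2)⁻¹ ^ m * (10 ^ 7 * bound n k D σ r) := by
  have hb := h.bound_pos
  have hN := h.one_le_mul_sq
  have h0 := h.sepDist_pos
  have hq : 0 ≤ 7 * n ^ 2 * D * r / σ / (sepDist n k D σ r / 2) := by
    rw [h.div_sepDist_eq]
    positivity
  have h1 := h.div_sepDist_le
  have h2 := h.unbalanced_le
  have hn := h.one_le_n
  obtain ⟨hk, hkn, hD, hDn, hσ, hσ1, hr, hle⟩ := h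
  calc _ ≤ ((n * k ^ 2)⁻¹ ^ 8) ^ T * (3 * ((n * k ^ 2)⁻¹ ^ 8 * (784 * 2 * bound n k D σ r))) := by
        gcongr
    _ = (n * k ^ 2)⁻¹ ^ (8 * (T + 1)) * (4704 * bound n k D σ r) := by ring
    _ ≤ _ := by
        gcongr ?_ * (?_ * _)
        · exact pow_le_pow_of_le_one (by positivity) (inv_le_one_of_one_le₀ hN) hm
        · norm_num

/-- The few lattice points are outweighed by the many cycles. -/
theorem lattice_mul_le (h : IsSmall n k D σ r) {m e T : ℕ} (hm : m + 16 * e ≤ 8 * T)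
    (he : 3 * e ≤ T) :
    (5 * D / r) ^ e * ((n * r / σ) ^ e * (7 * n ^ 2 * D * r / σ / (sepDist n k D σ r / 2)) ^ T) ≤
      (n * k ^ 2)⁻¹ ^ m := by
  have hN := h.one_le_mul_sq
  have hg := h.one_le_sqrt
  have hn := h.one_le_n
  have hle := h.div_sepDist_le
  have hq : 0 ≤ 7 * n ^ 2 * D * r / σ / (sepDist n k D σ r / 2) := by
    rw [h.div_sepDist_eq]
    positivity
  have heq := h.div_sepDist_eq
  set q := 7 * n ^ 2 * D * r / σ / (sepDist n k D σ r / 2)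
  obtain ⟨hk, hkn, hD, hDn, hσ, hσ1, hr, -⟩ := h
  have hs : √(D / σ) ^ 2 = D / σ := Real.sq_sqrt (by positivity)
  -- Per grid coordinate, the `r` in the cost `5 * D / r` cancels against the boundary probability
  -- `n * r / σ`. Three slab quotients absorb the remaining 5 n D / σ, thanks to their factor (D /
  -- σ) ^ (-3/2).
  have key : 5 * D / r * (n * r / σ) * q ^ 3 ≤ (n * k ^ 2)⁻¹ ^ 8 := by
    have hnN : n ≤ n * k ^ 2 := le_mul_of_one_le_right (by positivity) (one_le_pow₀ hk)
    calc 5 * D / r * (n * r / σ) * q ^ 3 = 5 * (D / σ) * n * q ^ 3 := by field_simp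
      _ = 5 / 8 * n * (n * k ^ 2)⁻¹ ^ 24 * (√(D / σ))⁻¹ := by
        rw [heq]
        generalize √(D / σ) = g at hg hs ⊢
        rw [← hs]
        field_simp
        norm_num
      _ ≤ 1 * (n * k ^ 2) * (n * k ^ 2)⁻¹ ^ 24 * 1 := by
        gcongr
        · norm_num
        · exact inv_le_one_of_one_le₀ hg
      _ = (n * k ^ 2)⁻¹ ^ 23 := by
        field_simp
      _ ≤ _ := pow_le_pow_of_le_one (by positivity) (inv_le_one_of_one_le₀ hN) (by norm_num)
  obtain ⟨t, rfl⟩ := Nat.exists_eq_add_of_le he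
  calc (5 * D / r) ^ e * ((n * r / σ) ^ e * q ^ (3 * e + t)) =
      (5 * D / r * (n * r / σ) * q ^ 3) ^ e * q ^ t := by
        rw [pow_add, pow_mul, mul_pow (5 * D / r * (n * r / σ)), mul_pow (5 * D / r)]
        ring
    _ ≤ ((n * k ^ 2)⁻¹ ^ 8) ^ e * ((n * k ^ 2)⁻¹ ^ 8) ^ t := by gcongr
    _ = (n * k ^ 2)⁻¹ ^ (8 * (e + t)) := by ring
    _ ≤ _ := pow_le_pow_of_le_one (by positivity) (inv_le_one_of_one_le₀ hN) (by omega)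

/-- The two ways of gaining `r ^ 2` from four slab factors: (r / √r)⁴ at an edge with a balanced
end, and otherwise a crude quotient times the third-moment term. -/
theorem balanced_le (h : IsSmall n k D σ r) :
    4 * ((7 * n ^ 2 * D * r / σ / (√r / 2)) ^ 4 +
      7 * n ^ 2 * D * r / σ / (sepDist n k D σ r / 2) *
      (32 * (7 * n ^ 2 * D * r / σ) ^ 3 * n ^ 3 / (σ ^ 2 * (sepDist n k D σ r / 2)))) ≤
      10 ^ 7 * bound n k D σ r := by
  have hb := h.bound_pos
  have hN := h.one_le_mul_sq
  have h0 := h.sepDist_pos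
  have hn := h.one_le_n
  have hN8 : (n * k ^ 2)⁻¹ ^ 8 ≤ 1 :=
    pow_le_one₀ (by positivity) (inv_le_one_of_one_le₀ hN)
  have h1 : 7 * n ^ 2 * D * r / σ / (sepDist n k D σ r / 2) *
      (32 * (7 * n ^ 2 * D * r / σ) ^ 3 * n ^ 3 / (σ ^ 2 * (sepDist n k D σ r / 2))) ≤
      1 * (1 * (784 * 2 * bound n k D σ r)) := by
    have e1 := h.div_sepDist_le.trans hN8
    have e2 := h.unbalanced_le
    obtain ⟨hk, hkn, hD, hDn, hσ, hσ1, hr, -⟩ := h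
    gcongr
    exact e2.trans (by gcongr)
  have h2 : (7 * n ^ 2 * D * r / σ / (√r / 2)) ^ 4 ≤ 384160 * bound n k D σ r := by
    obtain ⟨hk, hkn, hD, hDn, hσ, hσ1, hr, -⟩ := h
    have hs : √r ^ 2 = r := Real.sq_sqrt hr.le
    have hsp : 0 < √r := Real.sqrt_pos.2 hr
    have hs4 : √r ^ 4 = r ^ 2 := by
      calc √r ^ 4 = (√r ^ 2) ^ 2 := by ring
        _ = r ^ 2 := by rw [hs]
    calc (7 * n ^ 2 * D * r / σ / (√r / 2)) ^ 4 = 38416 * n ^ 8 * D ^ 4 * r ^ 4 / σ ^ 4 / √r ^ 4 := by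
          field_simp
          norm_num
      _ = 38416 * (r ^ 2 * n ^ 8 * 1 * (D ^ 3 * D) * σ ^ 2) / σ ^ 6 := by
          rw [hs4]
          field_simp
      _ ≤ 38416 * (r ^ 2 * n ^ 8 * k ^ 30 * (D ^ 3 * (10 * n ^ 2)) * 1) / σ ^ 6 := by
          gcongr
          · exact one_le_pow₀ hk
          · exact pow_le_one₀ hσ.le hσ1
      _ = 384160 * (r ^ 2 * n ^ 10 * k ^ 30 * D ^ 3) / σ ^ 6 := by ring
      _ ≤ 384160 * (r ^ 2 * n ^ 33 * k ^ 30 * D ^ 3) / σ ^ 6 := by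
          gcongr
          norm_num
      _ = _ := by
          rw [bound]
          ring
  linarith

/-- The slab factor times N, called `p`, has order √r. Eight edges per grid coordinate turn the cost
1 / r into r⁻¹ r⁴ = r³, and one spare `r` absorbs the large powers of `n`, `k` and `D`. -/
theorem graph_le_of_all_balanced (h : IsSmall n k D σ r) {m e : ℕ} (hm : 8 * e ≤ m) (he : e ≠ 0) :
    (5 * D / r) ^ e * (7 * n ^ 2 * D * r / σ / (√r / 2)) ^ m ≤
      (n * k ^ 2)⁻¹ ^ m * (10 ^ 7 * bound n k D σ r) := by
  have hb := h.bound_pos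
  have hn := h.one_le_n
  have hNN := h.one_le_mul_sq
  have hw := h.mul_le
  obtain ⟨hk, hkn, hD, hDn, hσ, hσ1, hr, hle⟩ := h
  have hs : √r ^ 2 = r := Real.sq_sqrt hr.le
  have hsp : 0 < √r := Real.sqrt_pos.2 hr
  set N := n * k ^ 2 with hNdef
  set p := N * (7 * n ^ 2 * D * r / σ / (√r / 2)) with hp
  have hp0 : 0 ≤ p := by positivity
  have hpeq : p = 14 * n ^ 3 * k ^ 2 * D * √r / σ := by
    rw [hp, hNdef]
    nth_rewrite 1 [← hs]
    field_simp
    norm_num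
  have hp1 : p ≤ 1 := by
    refine le_of_sq_le_sq ?_ zero_le_one
    calc p ^ 2 = 196 * n ^ 6 * k ^ 4 * D ^ 2 * √r ^ 2 / σ ^ 2 := by
          rw [hpeq]
          ring
      _ = 196 * (r * n ^ 6 * k ^ 4 * (D * D)) / σ ^ 2 := by
          rw [hs]
          ring
      _ ≤ 196 * (r * n ^ 6 * k ^ 4 * (D * (10 * n ^ 2))) / σ ^ 2 := by gcongr
      _ = 1960 * (r * n ^ 8 * k ^ 4 * D) / σ ^ 2 := by ring
      _ ≤ 1960 * (r * n ^ 16 * k ^ 15 * D) / σ ^ 2 := by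
          gcongr <;> first | assumption | norm_num
      _ ≤ 1960 * (σ ^ 3 / 10 ^ 10) / σ ^ 2 := by gcongr
      _ = σ * (1960 / 10 ^ 10) := by field_simp
      _ ≤ 1 * 1 := by
          gcongr
          norm_num
      _ = 1 ^ 2 := by norm_num
  have hy : 5 * D / r * p ^ 8 ≤ 10 ^ 7 * bound n k D σ r := by
    calc 5 * D / r * p ^ 8 = 5 * 14 ^ 8 * (n ^ 24 * k ^ 16 * D ^ 9) * (√r ^ 2) ^ 4 / (r * σ ^ 8) := by
          rw [hpeq]
          field_simp
      _ = 5 * 14 ^ 8 * r ^ 2 * n ^ 8 * k * D ^ 3 * D ^ 5 * (r * n ^ 16 * k ^ 15 * D) / σ ^ 8 := by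
          rw [hs]
          field_simp
      _ ≤ 5 * 14 ^ 8 * r ^ 2 * n ^ 8 * k * D ^ 3 * (10 * n ^ 2) ^ 5 * (σ ^ 3 / 10 ^ 10) / σ ^ 8 := by
          gcongr
      _ = 5 * 14 ^ 8 / 10 ^ 5 * (r ^ 2 * n ^ 18 * k ^ 1 * D ^ 3 * σ) / σ ^ 6 := by
          field_simp
      _ ≤ 10 ^ 7 * (r ^ 2 * n ^ 33 * k ^ 30 * D ^ 3 * 1) / σ ^ 6 := by
          gcongr <;> first | assumption | norm_num
      _ = _ := by
          rw [bound]
          ring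
  have hb1 : 10 ^ 7 * bound n k D σ r ≤ 1 := by
    rw [bound, ← mul_div_assoc, div_le_one (by positivity)]
    refine le_trans ?_ hle
    calc 10 ^ 7 * (r ^ 2 * n ^ 33 * k ^ 30 * D ^ 3) ≤ 10 ^ 20 * (r ^ 2 * n ^ 33 * k ^ 30 * D ^ 3) := by
          gcongr <;> norm_num
      _ = _ := by ring
  calc (5 * D / r) ^ e * (7 * n ^ 2 * D * r / σ / (√r / 2)) ^ m
      = N⁻¹ ^ m * ((5 * D / r) ^ e * p ^ m) := by
        rw [hp, mul_pow N, inv_pow]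
        field_simp
    _ ≤ N⁻¹ ^ m * ((5 * D / r) ^ e * p ^ (8 * e)) := by
        gcongr _ * (_ * ?_)
        exact pow_le_pow_of_le_one hp0 hp1 hm
    _ = N⁻¹ ^ m * (5 * D / r * p ^ 8) ^ e := by
        rw [pow_mul, ← mul_pow]
    _ ≤ N⁻¹ ^ m * (5 * D / r * p ^ 8) := by
        gcongr
        exact pow_le_of_le_one (by positivity) (hy.trans hb1) he
    _ ≤ _ := by gcongr

/-- Needed with `n' = 1`, to compare approximate with true centers, and with `n' = k`, to exclude
small gaps when only two nodes are unbalanced. -/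
theorem sqrt_mul_le_sepDist (h : IsSmall n k D σ r) {n' : ℝ} (hn' : n' ≤ n) :
    4 * (n' * (√n * r)) < sepDist n k D σ r := by
  have hg := h.one_le_sqrt
  have hn := h.one_le_n
  obtain ⟨hk, hkn, hD, hDn, hσ, hσ1, hr, hle⟩ := h
  have hsn : √n ≤ n := by
    rw [Real.sqrt_le_left (by positivity)]
    nlinarith
  calc 4 * (n' * (√n * r)) ≤ 4 * (n * (n * r)) := by gcongr
    _ = 4 * n ^ 2 * 1 ^ 16 * 1 ^ 3 * r := by ring
    _ < 28 * n ^ 2 * 1 ^ 16 * 1 ^ 3 * r := by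
      gcongr
      norm_num
    _ ≤ 28 * n ^ 10 * k ^ 16 * √(D / σ) ^ 3 * r := by
      gcongr
      norm_num

theorem sqrt_mul_le_sqrt (h : IsSmall n k D σ r) : 4 * (√n * r) ≤ √r := by
  have h1 := h.sqrt_r_mul_le
  have hn := h.one_le_n
  have hsn : √n ≤ n ^ 8 := by
    rw [Real.sqrt_le_left (by positivity), ← pow_mul]
    exact le_self_pow₀ hn (by norm_num)
  have hs : √r * √r = r := Real.mul_self_sqrt h.r_pos.le
  calc 4 * (√n * r) = 4 * (√r * √n) * √r := by
        rw [← hs]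
        ring_nf
        rw [Real.sqrt_sq (Real.sqrt_nonneg r)]
    _ ≤ 4 * (1 / 10 ^ 5) * √r := by
        gcongr
        exact le_trans (by gcongr) h1
    _ ≤ 1 * √r := by
        gcongr
        norm_num
    _ = √r := one_mul _

theorem mul_sepDist_le_half (h : IsSmall n k D σ r) : n * sepDist n k D σ r ≤ 1 / 2 := by
  have h1 := h.mul_sepDist_le
  have h2 := h.sepDist_pos
  have hn := h.one_le_n
  have h3 := h.sqrt_pow_le_one 3
  calc n * sepDist n k D σ r ≤ n ^ 5 * sepDist n k D σ r := by
        gcongr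
        exact le_self_pow₀ hn (by norm_num)
    _ ≤ √σ ^ 3 / 10 ^ 8 := h1
    _ ≤ 1 / 2 := by linarith

theorem mul_sqrt_le_half (h : IsSmall n k D σ r) : n * √r ≤ 1 / 2 := by
  have h1 := h.sqrt_r_mul_le
  have hn := h.one_le_n
  have h2 : n ≤ n ^ 8 := le_self_pow₀ hn (by norm_num)
  calc n * √r ≤ n ^ 8 * √r := by gcongr
    _ = √r * n ^ 8 := mul_comm _ _
    _ ≤ 1 / 10 ^ 5 := h1
    _ ≤ 1 / 2 := by norm_num

end IsSmall

/-! ### The bound for one graph, summed over the grid choices. -/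

namespace TransitionGraph

variable {n k d : ℕ} {G : TransitionGraph n k}

/-- The choices of grid points for the balanced clusters. -/
noncomputable def gridChoices (G : TransitionGraph n k) (d : ℕ) (D r : ℝ) : Finset (Fin k → Pt d) :=
  Fintype.piFinset fun i => if i ∈ G.balanced then grid d D r else {0}

theorem card_gridChoices_le {D r : ℝ} (hr : 0 < r) (hD : r ≤ D) :
    ((G.gridChoices d D r).card : ℝ) ≤ (5 * D / r) ^ (d * G.balanced.card) := by
  have h1 : (G.gridChoices d D r).card = (grid d D r).card ^ G.balanced.card := by
    rw [gridChoices, Fintype.card_piFinset]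
    calc ∏ i, (if i ∈ G.balanced then grid d D r else {0}).card =
        ∏ i, if i ∈ G.balanced then (grid d D r).card else 1 :=
          Finset.prod_congr rfl fun i _ => by split_ifs <;> rfl
      _ = _ := by rw [Finset.prod_ite_mem, Finset.univ_inter, Finset.prod_const]
  rw [h1, pow_mul]
  push_cast
  exact pow_le_pow_left₀ (Nat.cast_nonneg _) (card_grid_le hr hD) _

theorem IsGeneralGraph.card_verts_le (h : G.IsGeneralGraph d) : G.verts.card ≤ G.edges.card := by
  obtain ⟨u₂, u₃, h1, -, h2, -, -⟩ := h.exists_counts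
  have h3 : 2 * G.balanced.card ≤ (16 * d + 2) * G.balanced.card := by
    gcongr
    omega
  omega

variable {D σ r : ℝ}

/-- The bound for one transition graph and one choice of grid points, in the case that some cluster
is unbalanced. -/
theorem IsGeneralGraph.measure_isTight_le (hG : G.IsGeneralGraph d) (h : IsSmall n k D σ r)
    (hd : 2 ≤ d) {i : Fin k} (hi : i ∈ G.verts) (hib : i ∉ G.balanced) (a : Fin n → Pt d)
    (ℓ : Fin k → Pt d) :
    perturbedLaw a σ {X | G.IsTight ℓ (7 * n * D * r) (sepDist n k D σ r / 2) (√r / 2)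
      (√n * r) X} * ENNReal.ofReal ((5 * D / r) ^ (d * G.balanced.card)) ≤
      ENNReal.ofReal (((n : ℝ) * k ^ 2)⁻¹ ^ G.edges.card * (10 ^ 7 * bound n k D σ r)) := by
  have hδ := h.sepDist_pos
  have hn := h.one_le_n
  have hk := h.one_le_k
  have hD := h.one_le_D
  have hσ := h.σ_pos
  have hr := h.r_pos
  have hb := h.bound_pos
  have hβδ := h.sqrt_mul_le_sepDist h.k_le_n
  have hsr : 0 < √r := Real.sqrt_pos.2 hr
  have hsn : √(n : ℝ) ≤ n := by
    rw [Real.sqrt_le_left (by positivity)]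
    nlinarith
  have hsn2 : √(n : ℝ) * √n = n := Real.mul_self_sqrt (Nat.cast_nonneg n)
  have hT := hG.card_verts_le
  obtain ⟨T, hT⟩ := Nat.exists_eq_add_of_le (hT.trans (Nat.le_succ _))
  have hT' : T + G.verts.card = G.edges.card + 1 := by omega
  set δ := sepDist n k D σ r
  set c := 7 * n ^ 2 * D * r / σ with hc
  have hcτ : 7 * n * D * r * √n / σ ≤ c := by
    refine div_le_div_of_nonneg_right ?_ hσ.le
    calc 7 * n * D * r * √n ≤ 7 * n * D * r * n := by gcongr
      _ = _ := by ring
  have hβσ : √n * r * √n / σ = n * r / σ := by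
    rw [show √(n : ℝ) * r * √n = (√n * √n) * r by ring, hsn2]
  have hKpos : 0 ≤ 32 * c ^ 3 * n ^ 3 / (σ ^ 2 * (δ / 2)) := by positivity
  have key := fun (s T : ℕ) (K : ℝ≥0∞) hT hKb hKu => G.measure_isTight_le (d := d) hG.connected hd hi
    hib a hσ (β := √n * r) (by positivity) ℓ (τ := 7 * n * D * r) (c := c) (δ := δ / 2)
    (δ' := √r / 2) (by positivity) hcτ (by positivity) (by positivity) (by linarith) (s := s)
    (T := T) (K := K) hT hKb hKu
  -- Without balanced nodes three reserved factors (`s = 0`) give `r ^ 2` by the third moment alone.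
  -- With balanced nodes four are reserved (`s = 1`), because factors of order √r may occur.
  rcases G.balanced.eq_empty_or_nonempty with hbal | hbal
  · obtain ⟨h3, hm⟩ := hG.cycles_of_balanced_empty hbal hT'
    obtain ⟨t, rfl⟩ := Nat.exists_eq_add_of_le h3
    refine le_trans (mul_le_mul_left (key 0 t (ENNReal.ofReal (32 * c ^ 3 * n ^ 3 / (σ ^ 2 * (δ / 2))))
      (by omega) (fun h => absurd hbal h.ne_empty) (by simp)) _) ?_
    rw [hbal, Finset.card_empty, mul_zero, pow_zero, pow_zero, ENNReal.ofReal_one, one_mul, mul_one,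
      ← ENNReal.ofReal_natCast, ← ENNReal.ofReal_pow (by positivity),
      ← ENNReal.ofReal_mul (by positivity), ← ENNReal.ofReal_mul (by positivity)]
    refine ENNReal.ofReal_le_ofReal ?_
    have := h.graph_le_of_balanced_empty (m := G.edges.card) (T := t) (by omega)
    norm_num
    norm_num at this
    exact this
  · obtain ⟨h3, hm⟩ := hG.cycles_of_balanced_nonempty hd hbal hT'
    obtain ⟨t, rfl⟩ := Nat.exists_eq_add_of_le h3
    have hm2 := hG.le_card_edges
    have hq3 : 0 ≤ c / (√r / 2) := by positivity
    have hq2 : 0 ≤ c / (δ / 2) := by positivity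
    -- `K` is the sum of the bounds for the two kinds of edges, so it dominates either of them.
    refine le_trans (mul_le_mul_left (key 1 t (ENNReal.ofReal ((c / (√r / 2)) ^ 4 +
      c / (δ / 2) * (32 * c ^ 3 * n ^ 3 / (σ ^ 2 * (δ / 2))))) (by omega) (fun _ => ?_) ?_) _) ?_
    · rw [← ENNReal.ofReal_pow (by positivity)]
      refine ENNReal.ofReal_le_ofReal ?_
      exact le_add_of_nonneg_right (by positivity)
    · rw [pow_one, ← ENNReal.ofReal_mul (by positivity)]
      refine ENNReal.ofReal_le_ofReal ?_
      exact le_add_of_nonneg_left (by positivity)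
    · rw [hβσ, ← ENNReal.ofReal_natCast, ← ENNReal.ofReal_pow (by positivity),
        ← ENNReal.ofReal_pow (by positivity), ← ENNReal.ofReal_mul (by positivity),
        ← ENNReal.ofReal_mul (by positivity), ← ENNReal.ofReal_mul (by positivity),
        ← ENNReal.ofReal_mul (by positivity)]
      refine ENNReal.ofReal_le_ofReal ?_
      have e1 := h.lattice_mul_le (m := G.edges.card) (e := d * G.balanced.card) (T := t) (by omega)
        (by omega)
      have e2 := h.balanced_le
      rw [← hc] at e1 e2
      calc _ = (5 * D / r) ^ (d * G.balanced.card) * ((n * r / σ) ^ (d * G.balanced.card) *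
            (c / (δ / 2)) ^ t) * (4 * ((c / (√r / 2)) ^ 4 +
              c / (δ / 2) * (32 * c ^ 3 * n ^ 3 / (σ ^ 2 * (δ / 2))))) := by
            push_cast
            ring
        _ ≤ _ := by gcongr

/-- The bound for one transition graph and one choice of grid points, in the case that all clusters
are balanced. -/
theorem IsGeneralGraph.measure_isTight_le_of_all_balanced (hG : G.IsGeneralGraph d)
    (h : IsSmall n k D σ r) (hd : 2 ≤ d) (hbal : G.balanced = G.verts) (a : Fin n → Pt d)
    (ℓ : Fin k → Pt d) :
    perturbedLaw a σ {X | G.IsTight ℓ (7 * n * D * r) (sepDist n k D σ r / 2) (√r / 2)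
      (√n * r) X} * ENNReal.ofReal ((5 * D / r) ^ (d * G.balanced.card)) ≤
      ENNReal.ofReal (((n : ℝ) * k ^ 2)⁻¹ ^ G.edges.card * (10 ^ 7 * bound n k D σ r)) := by
  have hδ := h.sepDist_pos
  have hn := h.one_le_n
  have hD := h.one_le_D
  have hσ := h.σ_pos
  have hr := h.r_pos
  have hsr : 0 < √r := Real.sqrt_pos.2 hr
  have hc : 7 * n * D * r / (2 * σ) ≤ 7 * n ^ 2 * D * r / σ := by
    calc 7 * n * D * r / (2 * σ) = 7 * (n * 1) * D * r / σ / 2 := by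
          field_simp
      _ ≤ 7 * (n * n) * D * r / σ / 1 := by
          gcongr
          norm_num
      _ = _ := by ring
  have h1 := G.measure_isTight_le_of_all_balanced a hσ hbal ℓ (δ := sepDist n k D σ r / 2)
    (δ' := √r / 2) (√n * r) (by positivity) (by positivity) (by positivity) hc
  refine le_trans (mul_le_mul_left h1 _) ?_
  rw [← ENNReal.ofReal_pow (by positivity), ← ENNReal.ofReal_mul (by positivity), mul_comm]
  refine ENNReal.ofReal_le_ofReal (h.graph_le_of_all_balanced hG.le_card_edges ?_)
  have : 0 < G.balanced.card := by
    rw [hbal]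
    exact hG.connected.1.card_pos
  positivity

/-- The bound for one transition graph. -/
theorem IsGeneralGraph.measure_exists_isTight_le (hG : G.IsGeneralGraph d)
    (h : IsSmall n k D σ r) (hrD : r ≤ D) (hd : 2 ≤ d) (a : Fin n → Pt d) :
    perturbedLaw a σ {X | ∃ ℓ ∈ G.gridChoices d D r, G.IsTight ℓ (7 * n * D * r)
      (sepDist n k D σ r / 2) (√r / 2) (√n * r) X} ≤
      ENNReal.ofReal (((n : ℝ) * k ^ 2)⁻¹ ^ G.edges.card * (10 ^ 7 * bound n k D σ r)) := by
  have hr := h.r_pos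
  have hone : ∀ ℓ : Fin k → Pt d, perturbedLaw a σ {X | G.IsTight ℓ (7 * n * D * r)
      (sepDist n k D σ r / 2) (√r / 2) (√n * r) X} *
      ENNReal.ofReal ((5 * D / r) ^ (d * G.balanced.card)) ≤
      ENNReal.ofReal (((n : ℝ) * k ^ 2)⁻¹ ^ G.edges.card * (10 ^ 7 * bound n k D σ r)) := by
    intro ℓ
    by_cases hbal : G.balanced = G.verts
    · exact hG.measure_isTight_le_of_all_balanced h hd hbal a ℓ
    · obtain ⟨i, hi, hib⟩ : ∃ i ∈ G.verts, i ∉ G.balanced := by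
        by_contra hcon
        push Not at hcon
        exact hbal (Finset.Subset.antisymm (Finset.filter_subset _ _) hcon)
      exact hG.measure_isTight_le h hd hi hib a ℓ
  have hpos : 0 < (5 * D / r) ^ (d * G.balanced.card) := by
    have := h.one_le_D
    positivity
  -- The bound for a single choice is divided by the bound for the number of grid choices, so that
  -- summing over the choices cancels it.
  have hone' := fun ℓ => (ENNReal.le_div_iff_mul_le
    (Or.inl (ENNReal.ofReal_pos.2 hpos).ne') (Or.inl ENNReal.ofReal_ne_top)).2 (hone ℓ)
  have hset : {X : Fin n → Pt d | ∃ ℓ ∈ G.gridChoices d D r, G.IsTight ℓ (7 * n * D * r)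
      (sepDist n k D σ r / 2) (√r / 2) (√n * r) X} = ⋃ ℓ ∈ G.gridChoices d D r,
      {X | G.IsTight ℓ (7 * n * D * r) (sepDist n k D σ r / 2) (√r / 2) (√n * r) X} := by
    ext X
    simp
  rw [hset]
  refine (measure_biUnion_finset_le _ _).trans ((Finset.sum_le_sum fun ℓ _ => hone' ℓ).trans ?_)
  rw [Finset.sum_const, nsmul_eq_mul, mul_div_assoc']
  refine ENNReal.div_le_of_le_mul ?_
  rw [mul_comm]
  refine mul_le_mul_right ?_ _
  rw [← ENNReal.ofReal_natCast]
  exact ENNReal.ofReal_le_ofReal (G.card_gridChoices_le hr hrD)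

end TransitionGraph

/-! ### The union bound over all graphs. -/

section Union

variable {n k d : ℕ} {D σ r : ℝ}

/-- The binomial theorem gives (1 + 1/N)^N ≤ e. The weight `N⁻¹` per edge is thus just small enough
to sum over all edge sets. -/
theorem sum_pow_card_le {ι : Type*} [Fintype ι] {N : ℝ} (hN : 0 < N) (h : Fintype.card ι = N) :
    ∑ E : Finset ι, N⁻¹ ^ E.card ≤ 3 := by
  have h1 := Fintype.sum_pow_mul_eq_add_pow ι N⁻¹ 1
  simp only [one_pow, mul_one] at h1
  rw [h1]
  calc (N⁻¹ + 1) ^ Fintype.card ι ≤ Real.exp N⁻¹ ^ Fintype.card ι := by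
        gcongr
        exact Real.add_one_le_exp _
    _ = Real.exp 1 := by
        rw [← Real.exp_nat_mul, h, mul_inv_cancel₀ hN.ne']
    _ ≤ 3 := Real.exp_one_lt_three.le

/-- It is unlikely that the points are tight for any transition graph. -/
theorem measure_exists_graph_le (h : IsSmall n k D σ r) (hrD : r ≤ D) (hd : 2 ≤ d)
    (a : Fin n → Pt d) :
    perturbedLaw a σ {X | ∃ G : TransitionGraph n k, G.IsGeneralGraph d ∧
      ∃ ℓ ∈ G.gridChoices d D r, G.IsTight ℓ (7 * n * D * r) (sepDist n k D σ r / 2) (√r / 2)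
        (√n * r) X} ≤ ENNReal.ofReal (3 * (10 ^ 7 * bound n k D σ r)) := by
  have hb := h.bound_pos
  have hN := h.one_le_mul_sq
  have hsub : {X : Fin n → Pt d | ∃ G : TransitionGraph n k, G.IsGeneralGraph d ∧
      ∃ ℓ ∈ G.gridChoices d D r, G.IsTight ℓ (7 * n * D * r) (sepDist n k D σ r / 2) (√r / 2)
        (√n * r) X} ⊆ ⋃ E : Finset (Fin n × Fin k × Fin k), {X | ∃ G : TransitionGraph n k,
      (G.IsGeneralGraph d ∧ G.edges = E) ∧ ∃ ℓ ∈ G.gridChoices d D r, G.IsTight ℓ (7 * n * D * r)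
        (sepDist n k D σ r / 2) (√r / 2) (√n * r) X} := by
    rintro X ⟨G, hG, hX⟩
    exact Set.mem_iUnion.2 ⟨G.edges, G, ⟨hG, rfl⟩, hX⟩
  have hone : ∀ E : Finset (Fin n × Fin k × Fin k), perturbedLaw a σ {X | ∃ G : TransitionGraph n k,
      (G.IsGeneralGraph d ∧ G.edges = E) ∧ ∃ ℓ ∈ G.gridChoices d D r, G.IsTight ℓ (7 * n * D * r)
        (sepDist n k D σ r / 2) (√r / 2) (√n * r) X} ≤
      ENNReal.ofReal (((n : ℝ) * k ^ 2)⁻¹ ^ E.card * (10 ^ 7 * bound n k D σ r)) := by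
    intro E
    by_cases hE : ∃ G : TransitionGraph n k, G.IsGeneralGraph d ∧ G.edges = E
    · obtain ⟨G, hG, rfl⟩ := hE
      refine le_trans (measure_mono ?_) (hG.measure_exists_isTight_le h hrD hd a)
      rintro X ⟨G', ⟨hG', he⟩, hX⟩
      rwa [hG'.eq_of_edges_eq hG he] at hX
    · refine le_of_eq_of_le ?_ bot_le
      rw [bot_eq_zero, ← measure_empty (μ := perturbedLaw a σ)]
      congr 1
      ext X
      simp only [Set.mem_ofPred_eq, Set.mem_empty_iff_false, iff_false]
      rintro ⟨G, hG, -⟩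
      exact hE ⟨G, hG⟩
  refine (measure_mono hsub).trans ((measure_iUnion_fintype_le _ _).trans
    ((Finset.sum_le_sum fun E _ => hone E).trans ?_))
  rw [← ENNReal.ofReal_sum_of_nonneg fun E _ => by positivity, ← Finset.sum_mul]
  refine ENNReal.ofReal_le_ofReal (mul_le_mul_of_nonneg_right ?_ (by positivity))
  refine sum_pow_card_le (by positivity) ?_
  simp [pow_two]

/-- The point sets with an iteration of improvement at most `ε` in the general case. -/
def slowSet (n k d : ℕ) (ε : ℝ) : Set (Fin n → Pt d) :=
  {X | (∀ x, X x ∈ cube n k d) ∧ ∃ (C C' : Fin n → Fin k) (h : ∀ x, C' x ∈ active C)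
    (G : TransitionGraph n k), Occurs X C ∧ IsIteration X C C' ∧
      G.IsComponent (.ofIteration C C' h) ∧ G.IsGeneralGraph d ∧ improvement X C C' ≤ ε}

/-- There are finitely many pairs of clusterings, so the infimum is attained by an actual iteration.
Its lattice points are forgotten, as grid points are chosen anew; hence `ε'` may exceed `ε`, which
makes `ε = 0` accessible. -/
theorem setOf_delta6_le_subset {ε ε' : ℝ} (hε : ε ≤ ε') :
    {X | (∀ i, X i ∈ cube n k d) ∧ delta6 k X ε ≤ (ε : EReal)} ⊆ slowSet n k d ε' := by
  rintro X ⟨hX, hle⟩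
  refine ⟨hX, ?_⟩
  set S := {δ : EReal | ∃ C C' : Fin n → Fin k, Occurs X C ∧ IsIteration X C C' ∧
    active C ⊆ active C' ∧
    (∃ (m b : ℕ) (B : Blueprint n k d m b ε), B.IsFollowedBy X C C' ∧ B.IsGeneral X) ∧
    δ = (improvement X C C' : EReal)} with hS
  have hle' : sInf S ≤ (ε : EReal) := hle
  have hfin : S.Finite := by
    refine (Set.finite_range fun p : (Fin n → Fin k) × (Fin n → Fin k) =>
      (improvement X p.1 p.2 : EReal)).subset ?_
    rintro δ ⟨C, C', -, -, -, -, rfl⟩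
    exact ⟨(C, C'), rfl⟩
  have hne : S.Nonempty := by
    rw [Set.nonempty_iff_ne_empty]
    intro h0
    rw [h0, sInf_empty, top_le_iff] at hle'
    exact EReal.coe_ne_top _ hle'
  obtain ⟨C, C', hC, hit, -, ⟨m, b, B, hB, hgen⟩, heq⟩ := hne.csInf_mem hfin
  rw [heq] at hle'
  obtain ⟨⟨h, hcomp⟩, -⟩ := hB
  exact ⟨C, C', h, B.graph, hC, hit, hcomp,
    ⟨B.connected, hgen.balanced_degree, hgen.degree_ne_one, hgen.pairs_le_two,
      hgen.exists_large_degree⟩, (EReal.coe_le_coe_iff.1 hle').trans hε⟩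

theorem one_le_sideLength (hk : 1 ≤ k) (hd : 2 ≤ d) (hn : 2 ≤ n) : 1 ≤ sideLength n k d := by
  have h1 : (1 : ℝ) ≤ k := by exact_mod_cast hk
  have h2 : (2 : ℝ) ≤ d := by exact_mod_cast hd
  have h3 : (2 : ℝ) ≤ n := by exact_mod_cast hn
  have h4 : 1 / 2 ≤ Real.log n := by
    have := Real.log_le_log (by norm_num) h3
    have := Real.log_two_gt_d9
    linarith
  rw [sideLength, Real.one_le_sqrt]
  calc (1 : ℝ) ≤ 90 * 1 * 2 * (1 / 2) := by norm_num
    _ ≤ _ := by gcongr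

theorem sideLength_le (hkn : k ≤ n) (hdn : d ≤ n) (hn : 1 ≤ n) :
    sideLength n k d ≤ 10 * (n : ℝ) ^ 2 := by
  have h3 : (1 : ℝ) ≤ n := by exact_mod_cast hn
  rw [sideLength, Real.sqrt_le_left (by positivity)]
  calc 90 * (k : ℝ) * d * Real.log n ≤ 90 * n * n * n := by
        gcongr
        exact Real.log_le_self (by positivity)
    _ = 90 * (n : ℝ) ^ 3 := by ring
    _ ≤ 100 * (n : ℝ) ^ 4 := by
        gcongr <;> norm_num
    _ = _ := by ring

/-- Outside of the null event and the three unlikely events a slow iteration forces tightness. The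
constants 10⁶ + 1 + 1 + 3 · 10⁷ are below 10⁸. -/
theorem measure_slowSet_le (hd : 2 ≤ d) (hdn : d ≤ n) {ε : ℝ} (hε : 0 < ε) (hε1 : ε ≤ 1)
    (h : IsSmall n k (sideLength n k d) σ √ε) (a : Fin n → Pt d) :
    perturbedLaw a σ (slowSet n k d ε) ≤
      ENNReal.ofReal (10 ^ 8 * bound n k (sideLength n k d) σ √ε) := by
  have hD := h.one_le_D
  have hσ := h.σ_pos
  have hn : 2 ≤ n := hd.trans hdn
  have hnpos : (0 : ℝ) < n := by positivity
  set D := sideLength n k d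
  set r := √ε with hr
  have hrp := h.r_pos
  have hsr : 0 < √r := Real.sqrt_pos.2 hrp
  have hδ := h.sepDist_pos
  have hb := h.bound_pos
  have hr1 : r ≤ 1 := Real.sqrt_le_one.2 hε1
  have hβ : √(n * ε) = √n * r := Real.sqrt_mul (Nat.cast_nonneg n) ε
  set δ := sepDist n k D σ r with hδdef
  have hβδ : 4 * √(n * ε) ≤ δ := by
    have := h.sqrt_mul_le_sepDist h.one_le_n
    rw [hβ]
    linarith
  have hβδ' : 4 * √(n * ε) ≤ √r := by
    rw [hβ]
    exact h.sqrt_mul_le_sqrt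
  have hsub : slowSet n k d ε ⊆ closeMasses n d n 0 ∪ (closeMasses n d (4 * d) δ ∪
      ({X | (∀ x, X x ∈ cube n k d) ∧ X ∈ nearHyperplane n d (4 * d + 1) (n * δ)} ∪
      ({X | (∀ x, X x ∈ cube n k d) ∧ X ∈ nearHyperplane n d (8 * d + 1) (n * √r)} ∪
      {X | ∃ G : TransitionGraph n k, G.IsGeneralGraph d ∧ ∃ ℓ ∈ G.gridChoices d D r,
        G.IsTight ℓ (7 * n * D * r) (δ / 2) (√r / 2) (√n * r) X}))) := by
    rintro X ⟨hX, C, C', hC', G, hC, hit, hcomp, hgen, himp⟩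
    by_contra hcon
    simp only [Set.mem_union, not_or, Set.mem_ofPred_eq, not_and] at hcon
    obtain ⟨h0, h1, h2, h3, h4⟩ := hcon
    obtain ⟨ℓ, hℓ, hℓ', ht⟩ := hcomp.exists_isTight hgen hX hC hit hε hε1 himp hD hdn (by omega)
      hβδ hβδ' h0 h1 (h2 hX) (h3 hX)
    rw [hβ] at ht
    refine h4 ⟨G, hgen, ℓ, Fintype.mem_piFinset.2 fun i => ?_, ht⟩
    split_ifs with hi
    · exact hℓ i hi
    · exact Finset.mem_singleton.2 (hℓ' i hi)
  have e0 := measure_closeMasses_zero (n := n) (d := d) a hσ (by omega) n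
  have e1 : perturbedLaw a σ (closeMasses n d (4 * d) δ) ≤
      ENNReal.ofReal (10 ^ 6 * bound n k D σ r) := by
    refine (measure_closeMasses_le a hσ hδ.le _).trans ?_
    rw [← ENNReal.ofReal_natCast, ← ENNReal.ofReal_pow (by positivity),
      ← ENNReal.ofReal_pow (by positivity), ← ENNReal.ofReal_mul (by positivity)]
    refine ENNReal.ofReal_le_ofReal ?_
    push_cast
    exact h.closeMasses_le hd
  have e2 : perturbedLaw a σ {X | (∀ x, X x ∈ cube n k d) ∧
      X ∈ nearHyperplane n d (4 * d + 1) (n * δ)} ≤ ENNReal.ofReal (bound n k D σ r) :=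
    (measure_nearHyperplane_le a hσ (by positivity) h.mul_sepDist_le_half hD hdn hn
      (by omega)).trans (ENNReal.ofReal_le_ofReal (h.nearHyperplane_le hd))
  have e3 : perturbedLaw a σ {X | (∀ x, X x ∈ cube n k d) ∧
      X ∈ nearHyperplane n d (8 * d + 1) (n * √r)} ≤ ENNReal.ofReal (bound n k D σ r) :=
    (measure_nearHyperplane_le a hσ (by positivity) h.mul_sqrt_le_half hD hdn hn
      (by omega)).trans (ENNReal.ofReal_le_ofReal (h.nearHyperplane_sqrt_le hd))
  have e4 := measure_exists_graph_le h (hr1.trans hD) hd a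
  calc _ ≤ 0 + (ENNReal.ofReal (10 ^ 6 * bound n k D σ r) + (ENNReal.ofReal (bound n k D σ r) +
        (ENNReal.ofReal (bound n k D σ r) + ENNReal.ofReal (3 * (10 ^ 7 * bound n k D σ r))))) := by
        refine (measure_mono hsub).trans ((measure_union_le _ _).trans (add_le_add e0.le ?_))
        refine (measure_union_le _ _).trans (add_le_add e1 ?_)
        refine (measure_union_le _ _).trans (add_le_add e2 ?_)
        exact (measure_union_le _ _).trans (add_le_add e3 e4)
    _ = ENNReal.ofReal (0 + (10 ^ 6 * bound n k D σ r + (bound n k D σ r +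
        (bound n k D σ r + 3 * (10 ^ 7 * bound n k D σ r))))) := by
        rw [zero_add, zero_add, ENNReal.ofReal_add, ENNReal.ofReal_add, ENNReal.ofReal_add] <;>
          positivity
    _ ≤ _ := ENNReal.ofReal_le_ofReal (by linarith)

/-- The bound of the theorem for positive `ε`. -/
theorem measure_slowSet_le_of_pos (hk : 1 ≤ k) (hkn : k ≤ n) (hd : 2 ≤ d) (hdn : d ≤ n)
    (hσ : 0 < σ) (hσ1 : σ ≤ 1) {ε : ℝ} (hε : 0 < ε) (hε1 : ε ≤ 1) (a : Fin n → Pt d) :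
    perturbedLaw a σ (slowSet n k d ε) ≤ ENNReal.ofReal
      (ε * (10 ^ 20 * (n : ℝ) ^ 33 * (k : ℝ) ^ 30 * (d : ℝ) ^ 3 * sideLength n k d ^ 3 / σ ^ 6)) := by
  have hD := one_le_sideLength hk hd (hd.trans hdn)
  have hd1 : (1 : ℝ) ≤ d := by exact_mod_cast (by omega : 1 ≤ d)
  have hk1 : (1 : ℝ) ≤ k := by exact_mod_cast hk
  have hs : √ε ^ 2 = ε := Real.sq_sqrt hε.le
  -- If the claimed bound exceeds 1 there is nothing to prove; otherwise the constant 10²⁰ provides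
  -- `IsSmall`.
  rcases le_total (ε * (10 ^ 20 * (n : ℝ) ^ 33 * (k : ℝ) ^ 30 * (d : ℝ) ^ 3 *
    sideLength n k d ^ 3 / σ ^ 6)) 1 with h | h
  · have hle : ε * (10 ^ 20 * (n : ℝ) ^ 33 * (k : ℝ) ^ 30 * sideLength n k d ^ 3) ≤
        ε * (10 ^ 20 * (n : ℝ) ^ 33 * (k : ℝ) ^ 30 * (d : ℝ) ^ 3 * sideLength n k d ^ 3) := by
      refine mul_le_mul_of_nonneg_left (mul_le_mul_of_nonneg_right ?_ (by positivity)) hε.le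
      exact le_mul_of_one_le_right (by positivity) (one_le_pow₀ hd1)
    have hsmall : IsSmall n k (sideLength n k d) σ √ε := by
      refine ⟨hk1, by exact_mod_cast hkn, hD, sideLength_le hkn hdn (by omega), hσ, hσ1,
        Real.sqrt_pos.2 hε, ?_⟩
      rw [← mul_div_assoc, div_le_one (by positivity)] at h
      rw [hs]
      exact hle.trans h
    refine (measure_slowSet_le hd hdn hε hε1 hsmall a).trans (ENNReal.ofReal_le_ofReal ?_)
    rw [bound, hs]
    calc 10 ^ 8 * (ε * (n : ℝ) ^ 33 * (k : ℝ) ^ 30 * sideLength n k d ^ 3 / σ ^ 6) ≤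
        10 ^ 20 * (ε * (n : ℝ) ^ 33 * (k : ℝ) ^ 30 * sideLength n k d ^ 3 / σ ^ 6) := by
          gcongr <;> norm_num
      _ = ε * (10 ^ 20 * (n : ℝ) ^ 33 * (k : ℝ) ^ 30 * sideLength n k d ^ 3) / σ ^ 6 := by ring
      _ ≤ _ := by
        rw [← mul_div_assoc]
        gcongr
  · exact prob_le_one.trans (ENNReal.one_le_ofReal.2 h)

end Union

end KMeans
-- Conclusion, including the limit case `ε = 0`.
theorem mainTheorem3 :
    ∃ c : ℝ, 0 < c ∧
      ∀ (n k d : ℕ), 1 ≤ k → k ≤ n → 2 ≤ d → d ≤ n →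
      ∀ (σ : ℝ), 0 < σ → σ ≤ 1 →
      ∀ (ε : ℝ), 0 ≤ ε → ε ≤ 1 →
      ∀ (a : Fin n → KMeans.Pt d), (∀ i j, 0 ≤ a i j ∧ a i j ≤ 1) →
        KMeans.perturbedLaw a σ
            {X | (∀ i, X i ∈ KMeans.cube n k d) ∧ KMeans.delta6 k X ε ≤ (ε : EReal)} ≤
          ENNReal.ofReal
            (ε * (c * (n : ℝ) ^ 33 * (k : ℝ) ^ 30 * (d : ℝ) ^ 3 * KMeans.sideLength n k d ^ 3 /
              σ ^ 6)) := by
  refine ⟨10 ^ 20, by norm_num, fun n k d hk hkn hd hdn σ hσ hσ1 ε hε hε1 a _ => ?_⟩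
  set A := 10 ^ 20 * (n : ℝ) ^ 33 * (k : ℝ) ^ 30 * (d : ℝ) ^ 3 * KMeans.sideLength n k d ^ 3 / σ ^ 6
  have hpos : ∀ ε' : ℝ, 0 < ε' → ε' ≤ 1 → ε ≤ ε' → KMeans.perturbedLaw a σ
      {X | (∀ i, X i ∈ KMeans.cube n k d) ∧ KMeans.delta6 k X ε ≤ (ε : EReal)} ≤
        ENNReal.ofReal (ε' * A) := fun ε' h0 h1 h =>
    (measure_mono (KMeans.setOf_delta6_le_subset h)).trans
      (KMeans.measure_slowSet_le_of_pos hk hkn hd hdn hσ hσ1 h0 h1 a)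
  -- For `ε = 0` the event lies in the slow event of every positive `ε'`, and the bound `ε' * A`
  -- tends to zero.
  rcases hε.eq_or_lt with rfl | hε0
  · have hlim : Filter.Tendsto (fun ε' : ℝ => ENNReal.ofReal (ε' * A)) (nhdsWithin 0 (Set.Ioi 0))
        (nhds (ENNReal.ofReal (0 * A))) :=
      (ENNReal.continuous_ofReal.comp (continuous_id.mul continuous_const)).continuousAt.tendsto.mono_left
        nhdsWithin_le_nhds
    refine ge_of_tendsto hlim ?_
    filter_upwards [Ioc_mem_nhdsGT (zero_lt_one (α := ℝ))] with ε' h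
    exact hpos ε' h.1 h.2 h.1.le
  · exact hpos ε hε0 hε1 le_rfl
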